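/- **Theorem.** Let $E_4$ be a polygonal chain in $\mathbb R^3$ with vertices $0,1,2,3,4$ at $\vec p_0,\dots,\vec p_4$ and edges $e_1=01$, $e_2=12$, $e_3=23$, $e_4=34$, such that no two non-adjacent edges are coplanar. For unit $\vec\xi$ let $K_{\vec\xi}$ be the knotoid diagram obtained by projecting $E_4$ to the plane with normal $\vec\xi$ (defined for almost all $\vec\xi$), and let $wr$ be its writhe. The bracket polynomial of $E_4$ is $\langle E_4\rangle=\frac1{4\pi}\int_{S^2}\langle K_{\vec\xi}\rangle\,dS$, where $\langle K\rangle=\sum_S A^{\sigma(S)}d^{\|S\|-1}$, $d=-A^2-A^{-2}$, is the Kauffman bracket of a knotoid diagram. "Probability" means area of the set of directions divided by $4\pi$. $k0$ is the trivial knotoid in $S^2$ and $k2.1$ the non-trivial knotoid with a diagram with two crossings (up to mirror images). *Notation.* $L(e_i,e_j)$ is the Gauss linking integral, $\epsilon_{i,j}\in\{1,-1\}$ its sign. $Q_{i,j}\subset S^2$ is the spherical quadrangle of directions from points of $e_j$ to points of $e_i$, $X^A$ is the antipodal of $X$, and $A(X)$ is the area. $Q_{i,j,k}=(Q_{i,j}\cap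 Q_{i,k})\cup(Q_{i,j}^A\cap Q_{i,k})$, $Q_1=Q_{1,3,4}\setminus(Q_{2,4}\cup Q_{2,4}^A)$, $Q_2=Q_{4,2,1}\setminus (Q_{1,3}\cup Q_{1,3}^A)$, and $Q$ is the set of $\vec\xi\in Q_{1,4}$ for which $K_{\vec\xi}$ is $k2.1$. For edges $e_i$, $e_j$ with endpoints $a,b$ and $c,d$ let $\vec r_{xy}=\vec p_x-\vec p_y$; the normal vectors of the quadrilateral $T_{i,j}$ are the normalized vectors $\vec r_{ac}\times\vec r_{ad}$, $\vec r_{ad}\times\vec r_{bd}$, $\vec r_{bd}\times\vec r_{bc}$, $\vec r_{bc}\times\vec r_{ac}$. Let $\vec n_k,\vec u_k,\vec v_k$ ($k=1,\dots,4$) be those of $T_{1,3},T_{1,4},T_{2,4}$. $(\vec w_1,\dots,\vec w_m)$ is the spherical polygon $\{\vec\xi\in S^2:\vec w_i\cdot\vec\xi>0\text{ for all }i\}$. Let $w=(\vec u_2\times(-\vec n_2))\cdot(\vec u_2\times\vec n_4)$, $w_0=(\vec v_3\times(-\vec n_1))\cdot(\vec v_3\times\vec n_3)$ and $\vec p_{i,j}=\vec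 p_j-\vec p_i$. Polygons are identified when they agree up to null sets and the antipodal map. *Formula.* All coefficients of $\langle K_{\vec \xi}\rangle$ are integrable, and $$\langle E_4\rangle=p_{k21}\langle k2.1\rangle+p_{k0,\epsilon_{2,4}}(-A^3)^{\epsilon_{2,4}}+p_{k0,-\epsilon_{2,4}}(-A^3)^{-\epsilon_{2,4}}+p_{k0,-2\epsilon_{2,4}}(-A^3)^{-2\epsilon_{2,4}}+p_{k0,2\epsilon_{2,4}}(-A^3)^{2\epsilon_{2,4}}+p_{k0,0},$$ where $\langle k2.1\rangle=A^{2\epsilon_{1,4}}+1-A^{-4\epsilon_{1,4}}$ is the bracket of the standard diagrams of $k2.1$ whose two crossings have sign $\epsilon_{1,4}$, and the coefficients are as follows, according to the cases (I) $\epsilon_{1,3}=\epsilon_{1,4}=-\epsilon_{2,4}$, (II) $\epsilon_{2,4}=\epsilon_{1,4}=-\epsilon_{1,3}$, (III) $\epsilon_{2,4}=\epsilon_{1,3}=-\epsilon_{1,4}$, (IV) $\epsilon_{1,3}=\epsilon_{1,4}=\epsilon_{2,4}$. - $p_{k21}=P(K_{\vec\xi}=k2.1)=P(K_{\vec\xi}=k2.1,\,wr=2\epsilon_{1,4})$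 equals $\frac1{2\pi}A(Q)$ if $\epsilon_{1,3}=\epsilon_{1,4}$ or $\epsilon_{1,4}=\epsilon_{2,4}$, and $0$ otherwise. - $p_{k0,\epsilon_{2,4}}=P(K_{\vec\xi}=k0,\,wr=\epsilon_{2,4})$ equals: (I) $2|L(e_2,e_4)|-\frac1{2\pi}A(Q_{4,2,1})$; (II) $2|L(e_2,e_4)|+2|L(e_1,e_4)|-\frac1{2\pi}(A(Q_{4,2,1})+A(Q_2)+A(Q_1))$; (III) $2|L(e_2,e_4)|+2|L(e_1,e_3)|-\frac1{2\pi}(A(Q_{4,2,1})+A(Q_1))$; (IV) $2|L(e_1,e_3)|+2|L(e_1,e_4)|+2|L(e_2,e_4)|$. - $p_{k0,-\epsilon_{2,4}}=P(K_{\vec\xi}=k0,\,wr=-\epsilon_{2,4})$ equals: (I) $2|L(e_1,e_3)|+2|L(e_1,e_4)|-\frac1{2\pi}(A(Q_{1,3,4})+A(Q_2)+A(Q_1))$; (II) $2|L(e_1,e_3)|-\frac1{2\pi}A(Q_{1,3,4})$; (III) $2|L(e_1,e_4)|-\frac1{2\pi}(A(Q_{1,3,4})+A(Q_2))$; (IV)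 $0$. - $p_{k0,2\epsilon_{2,4}}=P(K_{\vec\xi}=k0,\,wr=2\epsilon_{2,4})$ equals $\frac1{2\pi}(A(Q_2)-A(Q))$ in case (II), and $0$ otherwise. - $p_{k0,-2\epsilon_{2,4}}=P(K_{\vec\xi}=k0,\,wr=-2\epsilon_{2,4})$ equals $\frac1{2\pi}(A(Q_1)-A(Q))$ in case (I), and $0$ otherwise. - $p_{k0,0}=P(K_{\vec\xi}=k0,\,wr=0)=1-(p_{k0,-2\epsilon_{2,4}}+p_{k0,2\epsilon_{2,4}}+p_{k0,-\epsilon_{2,4}}+p_{k0,\epsilon_{2,4}}+p_{k21})$. *The polygon $Q$.* $Q=Q_{Bi}(E_4)\cup Q_{Bi}(R(E_4))$, where $R(E_4)$ is the chain with reversed numbering of the vertices and $Q_{Bi}$ is $\emptyset$ if $\epsilon_{1,3}\ne\epsilon_{1,4}$ or $w>0$ or $w_0>0$; if $\epsilon_{1,3}=\epsilon_{1,4}$, $w<0$ and $w_0<0$, it is $(\vec v_3,-\vec v_2,-\vec u_2)$ when $(\vec p_{4,1}\cdot\vec n_1)\epsilon_{1,3}<0$ and $(\vec v_3,-\vec v_2,\vec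 n_1,-\vec u_2)$ when $(\vec p_{4,1}\cdot\vec n_1)\epsilon_{1,3}>0$. *The polygons $Q_{1,3,4}$ and $Q_1$* are given by the rows below (a row applies when its strict inequalities hold); $Q_{4,2,1}$ and $Q_2$ are given by the same rows for the chain $R(E_4)$. 1. $\epsilon_{1,3}=\epsilon_{1,4}$, $w<0$, $w_0<0$: $Q_{1,3,4}=(\vec n_4,F,-\vec u_2,G)$ and $Q_1=(\vec n_4,-\vec v_3,-\vec u_2,G)\cup Q_{Bi}(E_4)$. With $c_{3,1}=(\vec p_{3,1}\cdot\vec n_1)\epsilon_{1,3}$ and $c_{4,1}=(\vec p_{4,1}\cdot\vec n_1)\epsilon_{1,3}$, $F$ is $\vec n_1$ if $c_{3,1},c_{4,1}>0$; $-\vec u_3$ if $c_{3,1},c_{4,1}<0$; $\vec n_1,-\vec u_3$ if $c_{3,1}>0>c_{4,1}$; $-\vec u_3,\vec n_1$ if $c_{3,1}<0<c_{4,1}$. With $c_{3,0}=(\vec p_{3,0}\cdot\vec n_3)\epsilon_{1,3}$ and $c_{4,0}=(\vec p_{4,0}\cdot\vec n_3)\epsilon_{1,3}$, $G$ is $\vec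 n_3$ if $c_{3,0},c_{4,0}>0$; $-\vec u_1$ if $c_{3,0},c_{4,0}<0$; $-\vec u_1,\vec n_3$ if $c_{3,0}>0>c_{4,0}$; $\vec n_3,-\vec u_1$ if $c_{3,0}<0<c_{4,0}$. 2. $\epsilon_{1,3}=\epsilon_{1,4}$ and ($w>0$ or $w_0>0$): $Q_{1,3,4}=Q_1=\emptyset$. 3. $\epsilon_{1,3}=-\epsilon_{1,4}$; here put $c_{4,0}=(\vec p_{4,0}\cdot\vec n_1)\epsilon_{1,3}$, $c_{4,1}=(\vec p_{4,1}\cdot\vec n_3)\epsilon_{1,3}$ and $c'=(\vec p_{0,3}\cdot(-\vec v_2))\epsilon_{2,4}$. - $w<0$, $c_{4,0}>0$, $c_{4,1}>0$: $Q_{1,3,4}=(\vec n_2,-\vec u_1,-\vec u_2,-\vec u_3)$, $Q_1=Q_{1,3,4}\setminus(\vec v_1,\vec v_2,\vec v_3,\vec n_2)$. - $w<0$, $c_{4,0}<0$, $c_{4,1}<0$: $Q_{1,3,4}=(\vec n_2,\vec n_1,-\vec u_2,\vec n_3)=Q_1$. - $w<0$, $c_{4,0}<0$, $c_{4,1}>0$: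 $Q_{1,3,4}=(\vec n_2,\vec n_1,-\vec u_2,-\vec u_3)$, $Q_1=Q_{1,3,4}\setminus(\vec v_1,\vec v_2,\vec n_1,\vec n_2)$. - $w<0$, $c_{4,0}>0$, $c_{4,1}<0$: $Q_{1,3,4}=(\vec n_2,-\vec u_1,-\vec u_2,\vec n_3)=Q_1$. - $w>0$, $c_{4,0}>0$, $c_{4,1}>0$: $Q_{1,3,4}=(\vec n_2,-\vec u_1,\vec n_4,-\vec u_3)$, $Q_1=Q_{1,3,4}\setminus(-\vec u_3,\vec n_4,\vec v_3,\vec n_2)$. - $w>0$, $c_{4,0}<0$, $c_{4,1}<0$: $Q_{1,3,4}=(\vec n_2,\vec n_1,\vec n_4,\vec n_3)$, and $Q_1=Q_{1,3,4}\setminus(\vec v_3,\vec v_2,\vec n_1,\vec n_4)$ if $c'>0$, $Q_1=Q_{1,3,4}\setminus(\vec v_3,\vec v_2,\vec n_2,\vec n_1,\vec n_4)$ if $c'<0$. - $w>0$, $c_{4,0}<0$, $c_{4,1}>0$: $Q_{1,3,4}=(\vec n_2,\vec n_1,\vec n_4,-\vec u_3)$, $Q_1=\emptyset$. - $w>0$,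 $c_{4,0}>0$, $c_{4,1}<0$: $Q_{1,3,4}=(\vec n_2,-\vec u_1,\vec n_4,\vec n_3)=Q_1$. -/

import Mathlib

open MeasureTheory Set
open scoped Pointwise LaurentPolynomial

noncomputable section

namespace OpenChain

/-! ## Knotoid diagrams on the sphere

An (oriented) knotoid diagram on the 2-sphere is recorded by its signed Gauss word: the sequence of
passages through crossings met when the diagram is traversed from tail to head. -/

/-- One passage through a crossing: the name of the crossing, whether the strand being traversed is
the over-strand, and whether the crossing is positive. -/
@[ext]
structure Passage where
  /-- name of the crossing -/
  label : ℕ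
  /-- the strand being traversed is the upper one -/
  upper : Bool
  /-- the crossing is positive -/
  positive : Bool
deriving DecidableEq

/-- Gauss words. -/
abbrev GaussWord := List Passage

/-- The crossings of a Gauss word. -/
def crossings (w : GaussWord) : Finset ℕ := (w.map Passage.label).toFinset

/-- `CrossingAt w c o u s`: crossing `c` is traversed on the over-strand at position `o`, on the
under-strand at position `u`, and its sign is `s` (`true` for positive).
The arcs of the diagram are numbered `0, …, w.length`, arc `k` preceding the passage number `k`;
the over-strand comes in along arc `o` and goes out along arc `o + 1`, likewise for `u`. -/
def CrossingAt (w : GaussWord) (c o u : ℕ) (s : Bool) : Prop :=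
  w[o]? = some ⟨c, true, s⟩ ∧ w[u]? = some ⟨c, false, s⟩

/-- Each crossing is passed exactly twice, once over and once under, with a well defined sign. -/
def IsGaussWord (w : GaussWord) : Prop :=
  w.Nodup ∧ ∀ x ∈ w,
    (⟨x.label, !x.upper, x.positive⟩ : Passage) ∈ w ∧
      (⟨x.label, x.upper, !x.positive⟩ : Passage) ∉ w ∧ (⟨x.label, !x.upper, !x.positive⟩ : Passage) ∉ w

/-- Two sides of arcs (`(k, true)` is the left and `(k, false)` the right side of arc `k`) that
meet in a corner of the diagram. Seen with the over-strand heading east, the under-strand heads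
north at a positive and south at a negative crossing. At the tail and at the head of the diagram
the two sides of the arc meet. -/
inductive Corner (w : GaussWord) : ℕ × Bool → ℕ × Bool → Prop
  | tail : Corner w (0, true) (0, false)
  | head : Corner w (w.length, true) (w.length, false)
  | posNE {c o u : ℕ} : CrossingAt w c o u true → Corner w (o + 1, true) (u + 1, false)
  | posNW {c o u : ℕ} : CrossingAt w c o u true → Corner w (u + 1, true) (o, true)
  | posSW {c o u : ℕ} : CrossingAt w c o u true → Corner w (o, false) (u, true)
  | posSE {c o u : ℕ} : CrossingAt w c o u true → Corner w (u, false) (o + 1, false)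
  | negNE {c o u : ℕ} : CrossingAt w c o u false → Corner w (o + 1, true) (u, true)
  | negNW {c o u : ℕ} : CrossingAt w c o u false → Corner w (u, false) (o, true)
  | negSW {c o u : ℕ} : CrossingAt w c o u false → Corner w (o, false) (u + 1, false)
  | negSE {c o u : ℕ} : CrossingAt w c o u false → Corner w (u + 1, true) (o + 1, false)

/-- The number of faces of the closed surface carrying the diagram. -/
def faceCount (w : GaussWord) : ℕ :=
  Nat.card (Quot fun a b : Fin (w.length + 1) × Bool =>
    Corner w ((a.1 : ℕ), a.2) ((b.1 : ℕ), b.2))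

/-- The word is the Gauss word of a knotoid diagram on the 2-sphere. With `n` crossings, a diagram
has `n + 2` vertices (tail and head included) and `2 n + 1` arcs, so that it lies on the sphere if
and only if it has `n + 1` faces. -/
def IsKnotoidDiagram (w : GaussWord) : Prop :=
  IsGaussWord w ∧ faceCount w = (crossings w).card + 1

/-- Two consecutive passages, in the order given by `t`. -/
def ordered (t : Bool) (x y : Passage) : List Passage := if t then [x, y] else [y, x]

/-- The elementary moves on Gauss words: renaming of crossings and the three Reidemeister moves.
No move involves the tail or the head of the diagram. -/
inductive Move : GaussWord → GaussWord → Prop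
  | rename (w : GaussWord) (f : ℕ → ℕ) (hf : Function.Injective f) :
      Move w (w.map fun x => ⟨f x.label, x.upper, x.positive⟩)
  | r1 (u v : GaussWord) (c : ℕ) (o s : Bool) :
      Move (u ++ v) (u ++ [⟨c, o, s⟩, ⟨c, !o, s⟩] ++ v)
  | r2 (u v z : GaussWord) (c d : ℕ) (o s t : Bool) :
      Move (u ++ v ++ z)
        (u ++ [⟨c, o, s⟩, ⟨d, o, !s⟩] ++ v ++ ordered t ⟨c, !o, s⟩ ⟨d, !o, !s⟩ ++ z)
  /- The top strand crosses the middle one at `a` and the bottom one at `b`; the middle strand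
  crosses the bottom one at `c`. The strands may be met in any order. The condition on the orders
  `tT, tM, tB` along the strands and the signs `sa, sb, sc` says that the three strands form a
  triangle. -/
  | r3 (u₀ u₁ u₂ u₃ x₁ x₂ x₃ y₁ y₂ y₃ : GaussWord) (a b c : ℕ) (sa sb sc tT tM tB : Bool)
      (h₁ : (tT ^^ sa ^^ sb) = (tM ^^ sa ^^ sc)) (h₂ : (tM ^^ sa ^^ sc) = (tB ^^ sb ^^ sc))
      (h : List.Perm [(x₁, y₁), (x₂, y₂), (x₃, y₃)]
        [(ordered tT ⟨a, true, sa⟩ ⟨b, true, sb⟩, ordered (!tT) ⟨a, true, sa⟩ ⟨b, true, sb⟩),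
         (ordered tM ⟨a, false, sa⟩ ⟨c, true, sc⟩, ordered (!tM) ⟨a, false, sa⟩ ⟨c, true, sc⟩),
         (ordered tB ⟨b, false, sb⟩ ⟨c, false, sc⟩,
            ordered (!tB) ⟨b, false, sb⟩ ⟨c, false, sc⟩)]) :
      Move (u₀ ++ x₁ ++ u₁ ++ x₂ ++ u₂ ++ x₃ ++ u₃) (u₀ ++ y₁ ++ u₁ ++ y₂ ++ u₂ ++ y₃ ++ u₃)

/-- Equivalence of knotoid diagrams on the sphere: the equivalence relation generated by the moves
between knotoid diagrams. -/
def KnotoidEquiv : GaussWord → GaussWord → Prop :=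
  Relation.EqvGen fun w w' => IsKnotoidDiagram w ∧ IsKnotoidDiagram w' ∧ Move w w'

/-- The diagram represents the trivial knotoid `k0`. -/
def IsK0 (w : GaussWord) : Prop := KnotoidEquiv w []

/-- The standard diagrams of the knotoid `k2.1`: both crossings have the sign `s`, and the first
passage is over if `o = true` and under if `o = false`. -/
def k21Word (s o : Bool) : GaussWord := [⟨1, o, s⟩, ⟨2, !o, s⟩, ⟨1, !o, s⟩, ⟨2, o, s⟩]

/-- The diagram represents the knotoid `k2.1`. As usual in tables of knotoids, `k2.1` is
understood up to mirror images. -/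
def IsK21 (w : GaussWord) : Prop := ∃ s o : Bool, KnotoidEquiv w (k21Word s o)

open Classical in
/-- The sign of the crossing `c` of the word. -/
def crossingSign (w : GaussWord) (c : ℕ) : ℤ :=
  if ∃ o u, CrossingAt w c o u true then 1 else -1

/-- The writhe of a diagram. -/
def writhe (w : GaussWord) : ℤ := ∑ c ∈ crossings w, crossingSign w c

/-- The arcs `k` and `l` are joined at some crossing in the state in which exactly the crossings in
`S` are smoothed by the A-smoothing. The A-smoothing respects the orientation at a positive
crossing, the B-smoothing does so at a negative crossing. -/
def Joined (w : GaussWord) (S : Finset ℕ) (k l : ℕ) : Prop :=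
  ∃ c o u s, CrossingAt w c o u s ∧
    (((c ∈ S ↔ s = true) ∧ ((k = o ∧ l = u + 1) ∨ (k = u ∧ l = o + 1))) ∨
      (¬ (c ∈ S ↔ s = true) ∧ ((k = o ∧ l = u) ∨ (k = o + 1 ∧ l = u + 1))))

/-- The number of components of a state. -/
def stateComponents (w : GaussWord) (S : Finset ℕ) : ℕ :=
  Nat.card (Quot fun k l : Fin (w.length + 1) => Joined w S k l)

/-- The Kauffman bracket `∑_S A^{σ(S)} d^{‖S‖ - 1}`, `d = -A² - A⁻²`, of a knotoid diagram; the
variable `A` is `LaurentPolynomial.T 1`. -/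
def bracket (w : GaussWord) : ℝ[T;T⁻¹] :=
  ∑ S ∈ (crossings w).powerset,
    LaurentPolynomial.T (2 * (S.card : ℤ) - ((crossings w).card : ℤ)) *
      (-LaurentPolynomial.T 2 - LaurentPolynomial.T (-2)) ^ (stateComponents w S - 1)

/-- `(-A³)^k`. -/
def curl (k : ℤ) : ℝ[T;T⁻¹] := LaurentPolynomial.C ((-1 : ℝ) ^ k) * LaurentPolynomial.T (3 * k)

/-- `⟨k2.1⟩ = A^{2ε} + 1 - A^{-4ε}`, where `ε` is the common sign of the two crossings. -/
def k21Bracket (ε : ℤ) : ℝ[T;T⁻¹] :=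
  LaurentPolynomial.T (2 * ε) + 1 - LaurentPolynomial.T (-4 * ε)

/-! ## Polygonal chains in 3-space and their projections -/

/-- Euclidean 3-space. -/
abbrev Space := EuclideanSpace ℝ (Fin 3)

/-- The unit sphere of directions. -/
abbrev Dir := Metric.sphere (0 : Space) 1

/-- The cross product. -/
def cross (a b : Space) : Space := WithLp.toLp 2 (crossProduct a.ofLp b.ofLp)

/-- The scalar triple product `(a × b) · c`. -/
def triple (a b c : Space) : ℝ := inner ℝ (cross a b) c

/-- The Gauss linking integral of two curves parametrized by `[0, 1]`. -/
def gaussLinking (γ₁ γ₂ : ℝ → Space) : ℝ :=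
  1 / (4 * Real.pi) * ∫ t in (0 : ℝ)..1, ∫ s in (0 : ℝ)..1,
    triple (deriv γ₁ t) (deriv γ₂ s) (γ₁ t - γ₂ s) / ‖γ₁ t - γ₂ s‖ ^ 3

/-- The `i`-th edge of the polygonal chain with the vertices `p 0, …, p n`; edges are counted from
`0` here. -/
def edge {n : ℕ} (p : Fin (n + 1) → Space) (i : Fin n) (t : ℝ) : Space :=
  p i.castSucc + t • (p i.succ - p i.castSucc)

/-- The chain with reversed orientation. -/
def rev {n : ℕ} (p : Fin (n + 1) → Space) : Fin (n + 1) → Space := fun k => p k.rev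

/-- The Gauss linking integral of two edges. -/
def L {n : ℕ} (p : Fin (n + 1) → Space) (i j : Fin n) : ℝ := gaussLinking (edge p i) (edge p j)

/-- The sign of the linking integral of two edges. -/
def eps {n : ℕ} (p : Fin (n + 1) → Space) (i j : Fin n) : ℤ := SignType.sign (L p i j)

/-- The interior points with parameters `t`, `s` of the edges `i`, `j` have the same projection to
the plane with normal vector `ξ`, and the first one is at signed height `h` above the second. -/
def Meets {n : ℕ} (p : Fin (n + 1) → Space) (ξ : Space) (i j : Fin n) (t s h : ℝ) : Prop :=
  t ∈ Ioo (0 : ℝ) 1 ∧ s ∈ Ioo (0 : ℝ) 1 ∧ edge p i t - edge p j s = h • ξ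

/-- The projections of the edges `i` and `j` along `ξ` cross. -/
def Cross {n : ℕ} (p : Fin (n + 1) → Space) (ξ : Space) (i j : Fin n) : Prop :=
  i ≠ j ∧ ∃ t s h, Meets p ξ i j t s h

open Classical in
/-- The parameter on the edge `i` of its crossing with the edge `j`. -/
def crossParam {n : ℕ} (p : Fin (n + 1) → Space) (ξ : Space) (i j : Fin n) : ℝ :=
  if H : ∃ t s h, Meets p ξ i j t s h then H.choose else 0

/-- The edge `i` passes over the edge `j`, seen from the side to which `ξ` points. -/
def Over {n : ℕ} (p : Fin (n + 1) → Space) (ξ : Space) (i j : Fin n) : Prop :=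
  ∃ t s h, Meets p ξ i j t s h ∧ 0 < h

/-- The direction vector of an edge. -/
def edgeVec {n : ℕ} (p : Fin (n + 1) → Space) (i : Fin n) : Space := p i.succ - p i.castSucc

open Classical in
/-- The passage along the edge `i` through its crossing with the edge `j`. A crossing is positive
if the upper direction, the lower direction and `ξ` form a right-handed triple. -/
def passage {n : ℕ} (p : Fin (n + 1) → Space) (ξ : Space) (i j : Fin n) : Passage where
  label := Nat.pair (min (i : ℕ) j) (max (i : ℕ) j)
  upper := decide (Over p ξ i j)
  positive := decide (if Over p ξ i j then 0 < triple (edgeVec p i) (edgeVec p j) ξ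
    else 0 < triple (edgeVec p j) (edgeVec p i) ξ)

open Classical in
/-- The Gauss word of the knotoid diagram obtained by projecting the chain to the plane with normal
vector `ξ`: the passages sorted by their position along the chain. -/
def gaussWord {n : ℕ} (p : Fin (n + 1) → Space) (ξ : Dir) : GaussWord :=
  ((Finset.univ.filter fun q : Fin n × Fin n => Cross p (ξ : Space) q.1 q.2).toList.mergeSort
    fun q r => decide
      ((q.1 : ℕ) + crossParam p (ξ : Space) q.1 q.2 ≤
        (r.1 : ℕ) + crossParam p (ξ : Space) r.1 r.2)).map
    fun q => passage p (ξ : Space) q.1 q.2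

/-- The surface measure on the unit sphere, of total mass `4π`. -/
def sphereMeasure : Measure Dir := (volume : Measure Space).toSphere

/-- The area of a subset of the unit sphere. -/
def area (X : Set Dir) : ℝ := sphereMeasure.real X

/-- The geometric probability of a set of projection directions. -/
def prob (X : Set Dir) : ℝ := area X / (4 * Real.pi)

/-- `f` is the bracket polynomial `1/(4π) ∫ ⟨K(E_ξ)⟩ dS` of the chain: the average, coefficient by
coefficient, of the brackets of its projections. -/
def HasBracket {n : ℕ} (p : Fin (n + 1) → Space) (f : ℝ[T;T⁻¹]) : Prop :=
  ∀ k : ℤ, Integrable (fun ξ : Dir => (bracket (gaussWord p ξ)).coeff k) sphereMeasure ∧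
    f.coeff k = 1 / (4 * Real.pi) * ∫ ξ, (bracket (gaussWord p ξ)).coeff k ∂sphereMeasure

/-! ## The spherical polygons -/

/-- The spherical quadrangle `Q_{i,j}` of the directions from points of the edge `j` to points of
the edge `i`. The projections of the two edges along `ξ` cross if `ξ` is in `Q_{i,j}` or in its
antipodal `-Q_{i,j}`. -/
def Q2 {n : ℕ} (p : Fin (n + 1) → Space) (i j : Fin n) : Set Dir :=
  {ξ | ∃ t s h, Meets p (ξ : Space) i j t s h ∧ 0 < h}

/-- `Q_{i,j,k} = (Q_{i,j} ∩ Q_{i,k}) ∪ (Q_{i,j}^A ∩ Q_{i,k})`. -/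
def Q3 {n : ℕ} (p : Fin (n + 1) → Space) (i j k : Fin n) : Set Dir :=
  (Q2 p i j ∩ Q2 p i k) ∪ (-(Q2 p i j) ∩ Q2 p i k)

/-- `Q_{1,3,4}`. -/
def Q134 (p : Fin 5 → Space) : Set Dir := Q3 p 0 2 3

/-- `Q_{4,2,1}`. -/
def Q421 (p : Fin 5 → Space) : Set Dir := Q3 p 3 1 0

/-- `Q_1 = Q_{1,3,4} \ Q_{2,4}`: directions in `Q_{1,3,4}` along which `e_2, e_4` do not cross. -/
def Qone (p : Fin 5 → Space) : Set Dir := Q134 p \ (Q2 p 1 3 ∪ -Q2 p 1 3)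

/-- `Q_2 = Q_{4,2,1} \ Q_{1,3}`: directions in `Q_{4,2,1}` along which `e_1, e_3` do not cross. -/
def Qtwo (p : Fin 5 → Space) : Set Dir := Q421 p \ (Q2 p 0 2 ∪ -Q2 p 0 2)

/-- `Q`: the directions in `Q_{1,4}` along which the projection is the knotoid `k2.1`. -/
def Qk21 (p : Fin 5 → Space) : Set Dir := {ξ ∈ Q2 p 0 3 | IsK21 (gaussWord p ξ)}

/-- The unit normal vectors to the faces of a quadrilateral. -/
structure Normals where
  /-- first normal vector -/
  v1 : Space
  /-- second normal vector -/
  v2 : Space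
  /-- third normal vector -/
  v3 : Space
  /-- fourth normal vector -/
  v4 : Space

/-- The normalized cross product. -/
def unitCross (a b : Space) : Space := ‖cross a b‖⁻¹ • cross a b

/-- The normal vectors of the quadrilateral `T_{i,j}` formed by the edges `i` and `j`. -/
def normals {n : ℕ} (p : Fin (n + 1) → Space) (i j : Fin n) : Normals where
  v1 := unitCross (p i.castSucc - p j.castSucc) (p i.castSucc - p j.succ)
  v2 := unitCross (p i.castSucc - p j.succ) (p i.succ - p j.succ)
  v3 := unitCross (p i.succ - p j.succ) (p i.succ - p j.castSucc)
  v4 := unitCross (p i.succ - p j.castSucc) (p i.castSucc - p j.castSucc)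

/-- The normal vectors of `T_{1,3}`. -/
def nn (p : Fin 5 → Space) : Normals := normals p 0 2

/-- The normal vectors of `T_{1,4}`. -/
def uu (p : Fin 5 → Space) : Normals := normals p 0 3

/-- The normal vectors of `T_{2,4}`. -/
def vv (p : Fin 5 → Space) : Normals := normals p 1 3

/-- The spherical polygon `(w_1, …, w_k)` cut out by the great circles with normal vectors `w_i`,
on the side of each of them to which the normal vector points. -/
def poly (l : List Space) : Set Dir := {ξ | ∀ w ∈ l, 0 < inner ℝ w (ξ : Space)}

/-- `w = (u_2 × (-n_2)) · (u_2 × n_4)`. -/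
def wSign (p : Fin 5 → Space) : ℝ :=
  inner ℝ (cross (uu p).v2 (-(nn p).v2)) (cross (uu p).v2 (nn p).v4)

/-- `w_0 = (v_3 × (-n_1)) · (v_3 × n_3)`. -/
def w0Sign (p : Fin 5 → Space) : ℝ :=
  inner ℝ (cross (vv p).v3 (-(nn p).v1)) (cross (vv p).v3 (nn p).v3)

/-- `(p_{i,j} · m) ε_{1,3}`, where `p_{i,j}` is the vector from vertex `i` to vertex `j`. -/
def cSign (p : Fin 5 → Space) (i j : Fin 5) (m : Space) : ℝ :=
  inner ℝ (p j - p i) m * (eps p 0 2 : ℝ)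

/-- The spherical polygon of the directions along which the projection is the `k2.1` diagram in
which the first edge crosses the third and the fourth one. -/
inductive K21Polygon (p : Fin 5 → Space) : Set Dir → Prop
  | empty : eps p 0 2 ≠ eps p 0 3 ∨ 0 < wSign p ∨ 0 < w0Sign p → K21Polygon p ∅
  | triangle : eps p 0 2 = eps p 0 3 → wSign p < 0 → w0Sign p < 0 →
      cSign p 4 1 (nn p).v1 < 0 →
      K21Polygon p (poly [(vv p).v3, -(vv p).v2, -(uu p).v2])
  | quadrangle : eps p 0 2 = eps p 0 3 → wSign p < 0 → w0Sign p < 0 →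
      0 < cSign p 4 1 (nn p).v1 →
      K21Polygon p (poly [(vv p).v3, -(vv p).v2, (nn p).v1, -(uu p).v2])

/-- The sides of `Q_{1,3,4}` between `n_4` and `-u_2`, in the case `ε_{1,3} = ε_{1,4}`; the signs
are those of `c_{3,1}` and `c_{4,1}`. -/
inductive FirstSides (p : Fin 5 → Space) : List Space → Prop
  | pp : 0 < cSign p 3 1 (nn p).v1 → 0 < cSign p 4 1 (nn p).v1 → FirstSides p [(nn p).v1]
  | mm : cSign p 3 1 (nn p).v1 < 0 → cSign p 4 1 (nn p).v1 < 0 → FirstSides p [-(uu p).v3]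
  | pm : 0 < cSign p 3 1 (nn p).v1 → cSign p 4 1 (nn p).v1 < 0 →
      FirstSides p [(nn p).v1, -(uu p).v3]
  | mp : cSign p 3 1 (nn p).v1 < 0 → 0 < cSign p 4 1 (nn p).v1 →
      FirstSides p [-(uu p).v3, (nn p).v1]

/-- The sides of `Q_{1,3,4}` after `-u_2`, in the case `ε_{1,3} = ε_{1,4}`; the signs are those of
`c_{3,0}` and `c_{4,0}`. -/
inductive LastSides (p : Fin 5 → Space) : List Space → Prop
  | pp : 0 < cSign p 3 0 (nn p).v3 → 0 < cSign p 4 0 (nn p).v3 → LastSides p [(nn p).v3]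
  | mm : cSign p 3 0 (nn p).v3 < 0 → cSign p 4 0 (nn p).v3 < 0 → LastSides p [-(uu p).v1]
  | pm : 0 < cSign p 3 0 (nn p).v3 → cSign p 4 0 (nn p).v3 < 0 →
      LastSides p [-(uu p).v1, (nn p).v3]
  | mp : cSign p 3 0 (nn p).v3 < 0 → 0 < cSign p 4 0 (nn p).v3 →
      LastSides p [(nn p).v3, -(uu p).v1]

/-- The table of spherical polygons: `Table p T T₁` says that the row of the table which applies to
the chain lists `T` as `Q_{1,3,4}` and `T₁` as `Q_1`. If `ε_{1,3} = -ε_{1,4}`, the signs that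
select the row are those of `c_{4,0} = (p_{4,0} · n_1) ε_{1,3}` and
`c_{4,1} = (p_{4,1} · n_3) ε_{1,3}`, and in the rows `posMMPos` and `posMMNeg` also that of
`c' = (p_{0,3} · (-v_2)) ε_{2,4}`. -/
inductive Table (p : Fin 5 → Space) : Set Dir → Set Dir → Prop
  | same (l r : List Space) (K : Set Dir) : eps p 0 2 = eps p 0 3 → wSign p < 0 → w0Sign p < 0 →
      FirstSides p l → LastSides p r → K21Polygon p K →
      Table p (poly ([(nn p).v4] ++ l ++ [-(uu p).v2] ++ r))
        (poly ([(nn p).v4, -(vv p).v3, -(uu p).v2] ++ r) ∪ K)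
  | sameEmpty : eps p 0 2 = eps p 0 3 → 0 < wSign p ∨ 0 < w0Sign p → Table p ∅ ∅
  | negPP : eps p 0 2 = -eps p 0 3 → wSign p < 0 →
      0 < cSign p 4 0 (nn p).v1 → 0 < cSign p 4 1 (nn p).v3 →
      Table p (poly [(nn p).v2, -(uu p).v1, -(uu p).v2, -(uu p).v3])
        (poly [(nn p).v2, -(uu p).v1, -(uu p).v2, -(uu p).v3] \
          poly [(vv p).v1, (vv p).v2, (vv p).v3, (nn p).v2])
  | negMM : eps p 0 2 = -eps p 0 3 → wSign p < 0 →
      cSign p 4 0 (nn p).v1 < 0 → cSign p 4 1 (nn p).v3 < 0 →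
      Table p (poly [(nn p).v2, (nn p).v1, -(uu p).v2, (nn p).v3])
        (poly [(nn p).v2, (nn p).v1, -(uu p).v2, (nn p).v3])
  | negMP : eps p 0 2 = -eps p 0 3 → wSign p < 0 →
      cSign p 4 0 (nn p).v1 < 0 → 0 < cSign p 4 1 (nn p).v3 →
      Table p (poly [(nn p).v2, (nn p).v1, -(uu p).v2, -(uu p).v3])
        (poly [(nn p).v2, (nn p).v1, -(uu p).v2, -(uu p).v3] \
          poly [(vv p).v1, (vv p).v2, (nn p).v1, (nn p).v2])
  | negPM : eps p 0 2 = -eps p 0 3 → wSign p < 0 →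
      0 < cSign p 4 0 (nn p).v1 → cSign p 4 1 (nn p).v3 < 0 →
      Table p (poly [(nn p).v2, -(uu p).v1, -(uu p).v2, (nn p).v3])
        (poly [(nn p).v2, -(uu p).v1, -(uu p).v2, (nn p).v3])
  | posPP : eps p 0 2 = -eps p 0 3 → 0 < wSign p →
      0 < cSign p 4 0 (nn p).v1 → 0 < cSign p 4 1 (nn p).v3 →
      Table p (poly [(nn p).v2, -(uu p).v1, (nn p).v4, -(uu p).v3])
        (poly [(nn p).v2, -(uu p).v1, (nn p).v4, -(uu p).v3] \
          poly [-(uu p).v3, (nn p).v4, (vv p).v3, (nn p).v2])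
  | posMMPos : eps p 0 2 = -eps p 0 3 → 0 < wSign p →
      cSign p 4 0 (nn p).v1 < 0 → cSign p 4 1 (nn p).v3 < 0 →
      0 < inner ℝ (p 3 - p 0) (-(vv p).v2) * (eps p 1 3 : ℝ) →
      Table p (poly [(nn p).v2, (nn p).v1, (nn p).v4, (nn p).v3])
        (poly [(nn p).v2, (nn p).v1, (nn p).v4, (nn p).v3] \
          poly [(vv p).v3, (vv p).v2, (nn p).v1, (nn p).v4])
  | posMMNeg : eps p 0 2 = -eps p 0 3 → 0 < wSign p →
      cSign p 4 0 (nn p).v1 < 0 → cSign p 4 1 (nn p).v3 < 0 →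
      inner ℝ (p 3 - p 0) (-(vv p).v2) * (eps p 1 3 : ℝ) < 0 →
      Table p (poly [(nn p).v2, (nn p).v1, (nn p).v4, (nn p).v3])
        (poly [(nn p).v2, (nn p).v1, (nn p).v4, (nn p).v3] \
          poly [(vv p).v3, (vv p).v2, (nn p).v2, (nn p).v1, (nn p).v4])
  | posMP : eps p 0 2 = -eps p 0 3 → 0 < wSign p →
      cSign p 4 0 (nn p).v1 < 0 → 0 < cSign p 4 1 (nn p).v3 →
      Table p (poly [(nn p).v2, (nn p).v1, (nn p).v4, -(uu p).v3]) ∅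
  | posPM : eps p 0 2 = -eps p 0 3 → 0 < wSign p →
      0 < cSign p 4 0 (nn p).v1 → cSign p 4 1 (nn p).v3 < 0 →
      Table p (poly [(nn p).v2, -(uu p).v1, (nn p).v4, (nn p).v3])
        (poly [(nn p).v2, -(uu p).v1, (nn p).v4, (nn p).v3])

/-- The sets `X` and `Y` are the same spherical polygon, up to null sets (such as the boundary) and
up to the antipodal map; in particular they have the same area. -/
def SamePolygon (X Y : Set Dir) : Prop :=
  (X =ᵐ[sphereMeasure] Y ∨ X =ᵐ[sphereMeasure] (-Y : Set Dir)) ∧ area X = area Y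

/-! ## The coefficients -/

/-- The coefficient of `⟨k2.1⟩`. -/
def pK21 (p : Fin 5 → Space) : ℝ :=
  if eps p 0 2 = eps p 0 3 ∨ eps p 0 3 = eps p 1 3 then 1 / (2 * Real.pi) * area (Qk21 p) else 0

/-- The coefficient of `(-A³)^{ε_{2,4}}`. -/
def pPlus (p : Fin 5 → Space) : ℝ :=
  if eps p 0 2 = eps p 0 3 ∧ eps p 0 3 = -eps p 1 3 then
    2 * |L p 1 3| - 1 / (2 * Real.pi) * area (Q421 p)
  else if eps p 1 3 = eps p 0 3 ∧ eps p 0 3 = -eps p 0 2 then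
    2 * |L p 1 3| + 2 * |L p 0 3| -
      1 / (2 * Real.pi) * (area (Q421 p) + area (Qtwo p) + area (Qone p))
  else if eps p 1 3 = eps p 0 2 ∧ eps p 0 2 = -eps p 0 3 then
    2 * |L p 1 3| + 2 * |L p 0 2| - 1 / (2 * Real.pi) * (area (Q421 p) + area (Qone p))
  else 2 * |L p 0 2| + 2 * |L p 0 3| + 2 * |L p 1 3|

/-- The coefficient of `(-A³)^{-ε_{2,4}}`. -/
def pMinus (p : Fin 5 → Space) : ℝ :=
  if eps p 0 2 = eps p 0 3 ∧ eps p 0 3 = -eps p 1 3 then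
    2 * |L p 0 2| + 2 * |L p 0 3| -
      1 / (2 * Real.pi) * (area (Q134 p) + area (Qtwo p) + area (Qone p))
  else if eps p 1 3 = eps p 0 3 ∧ eps p 0 3 = -eps p 0 2 then
    2 * |L p 0 2| - 1 / (2 * Real.pi) * area (Q134 p)
  else if eps p 1 3 = eps p 0 2 ∧ eps p 0 2 = -eps p 0 3 then
    2 * |L p 0 3| - 1 / (2 * Real.pi) * (area (Q134 p) + area (Qtwo p))
  else 0

/-- The coefficient of `(-A³)^{2ε_{2,4}}`. -/
def pPlusTwo (p : Fin 5 → Space) : ℝ :=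
  if eps p 1 3 = eps p 0 3 ∧ eps p 0 3 = -eps p 0 2 then
    1 / (2 * Real.pi) * (area (Qtwo p) - area (Qk21 p))
  else 0

/-- The coefficient of `(-A³)^{-2ε_{2,4}}`. -/
def pMinusTwo (p : Fin 5 → Space) : ℝ :=
  if eps p 0 2 = eps p 0 3 ∧ eps p 0 3 = -eps p 1 3 then
    1 / (2 * Real.pi) * (area (Qone p) - area (Qk21 p))
  else 0

/-- The constant coefficient. -/
def pZero (p : Fin 5 → Space) : ℝ :=
  1 - (pMinusTwo p + pPlusTwo p + pMinus p + pPlus p + pK21 p)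

/-- The probability that a projection is a diagram of the trivial knotoid with writhe `j`. -/
def probK0 (p : Fin 5 → Space) (j : ℤ) : ℝ :=
  prob {ξ | IsK0 (gaussWord p ξ) ∧ writhe (gaussWord p ξ) = j}

end OpenChain

end

open OpenChain

/-! For almost every direction adjacent edges do not cross in projection, so the only possible
crossings are those of the pairs e1e3, e1e4 and e2e4. The theorem therefore reduces to three
matters: which small diagrams occur, how often, and on which spherical regions.

Signs. Take vertex 3 as origin, write a_i for the position vectors of the other vertices, x_ij =
(a_i × a_j) · ξ, and t_k for the determinant of the three vectors other than a_k. The dependence t0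
a0 - t1 a1 + t2 a2 - t4 a4 = 0 makes the x_ij satisfy linear relations with coefficients t_k, and
being areas of plane vectors they also satisfy the Plücker relation (`chainRel`). Two edges cross
exactly when four expressions in the x_ij have a common sign (`over_iff`), while the sign of the
crossing is that of a determinant of the chain and does not depend on ξ (`passage_eq`). The Plücker
relation shows that crossings e1e3 and e2e4 force the crossing e1e4 (`crosses_middle`) and gives the
order of two crossings on one edge (`param_order₀`). The linear relations exclude two crossings on
e1, or on e4, when all three signs agree (`not_tauSign_eq_of_crosses`).

Diagrams. These facts leave a short list of Gauss words (`classification`). The diagram is k2.1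
exactly when e1 carries two interlaced crossings of equal sign and e2, e4 do not cross, or the same
holds for the reversed chain; all other diagrams are undone by first and second Reidemeister moves.
The odd writhe, invariant under all moves, separates k2.1 from k0 (`IsK0.not_isK21`). The brackets
come from explicit counts of state components.

Areas. The triple product of the two edge directions with a joining chord is constant. Hence both
the area of Q_{i,j} and 4π|L(e_i, e_j)| equal that constant, in absolute value, times the integral
of |chord|⁻³ over the parameter square (`area_Q2`). With the antipodal map this makes 2|L| the
probability of a crossing.

Probabilities. For fixed signs, the indicator of each event "k0 with writhe j" is an integer
combination of nine basic indicators: the whole sphere, the three crossings, their relevant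
intersections and differences, and k2.1. Such an identity is a finite Boolean check under the
constraints above (`Admissible`), and integrating it gives the coefficients. Since a k0 diagram on
the list has bracket (-A³)^writhe, averaging yields the formula (`hasBracket`).

Polygons. The conditions selecting a row of the table fix the signs of the t_k. The linear relations
then show that the few walls listed in that row imply all remaining inequalities of a double
crossing (`Table.mem_iff`). -/

namespace OpenChain

/-! ## Counting the classes of the equivalence relation generated by finitely many pairs -/

/-- Merge the class of `e.2` into the class of `e.1` in a list of class labels. -/
def mergeStep (L : List ℕ) (e : ℕ × ℕ) : List ℕ :=
  L.map fun x => if x = L.getD e.2 0 then L.getD e.1 0 else x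

/-- The class labels of `0, …, m - 1` after merging along all pairs. -/
def classLabels (m : ℕ) (E : List (ℕ × ℕ)) : List ℕ := E.foldl mergeStep (List.range m)

/-- The number of classes of `{0, …, m - 1}` modulo the pairs in `E`. -/
def classCount (m : ℕ) (E : List (ℕ × ℕ)) : ℕ := (classLabels m E).dedup.length

/-- The pair relation on `Fin m`. -/
def pairRel (m : ℕ) (E : List (ℕ × ℕ)) (a b : Fin m) : Prop := ((a : ℕ), (b : ℕ)) ∈ E

/-- Invariant of the merging loop: equal labels mean equivalence under the pairs processed so far.
The relation `r` records those pairs, so it is generalized together with the labels and grows by one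
pair at each step. -/
theorem foldl_mergeStep_spec {m : ℕ} (E : List (ℕ × ℕ)) (hE : ∀ e ∈ E, e.1 < m ∧ e.2 < m)
    (L : List ℕ) (hL : L.length = m) (r : Fin m → Fin m → Prop)
    (hr : ∀ a b : Fin m, L.getD a 0 = L.getD b 0 ↔ Relation.EqvGen r a b) :
    (E.foldl mergeStep L).length = m ∧ ∀ a b : Fin m,
      (E.foldl mergeStep L).getD a 0 = (E.foldl mergeStep L).getD b 0 ↔
        Relation.EqvGen (fun a b => r a b ∨ pairRel m E a b) a b := by
  induction E generalizing L r with
  | nil => simpa [pairRel] using ⟨hL, hr⟩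
  | cons e E ih =>
    obtain ⟨e1, e2⟩ := e
    have he := hE (e1, e2) (by simp)
    have := ih (fun e h => hE e (by simp [h])) (mergeStep L (e1, e2)) (by simp [mergeStep, hL])
      (fun a b => r a b ∨ ((a : ℕ), (b : ℕ)) = (e1, e2)) ?_
    · rw [List.foldl_cons]
      refine ⟨this.1, fun a b => ?_⟩
      rw [this.2 a b]
      simp only [pairRel, List.mem_cons, or_assoc]
    · intro a b
      have key : ∀ c : Fin m, (mergeStep L (e1, e2)).getD c 0 =
          if L.getD c 0 = L.getD e2 0 then L.getD e1 0 else L.getD c 0 := by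
        intro c
        have hc : (c : ℕ) < L.length := hL ▸ c.2
        simp [mergeStep, List.getD_eq_getElem?_getD, hc]
      rw [key, key]
      have mono : ∀ {a b : Fin m}, Relation.EqvGen r a b →
          Relation.EqvGen (fun a b => r a b ∨ ((a : ℕ), (b : ℕ)) = (e1, e2)) a b :=
        fun h => Relation.EqvGen.mono (fun _ _ => Or.inl) _ _ h
      have step : Relation.EqvGen (fun a b : Fin m => r a b ∨ ((a : ℕ), (b : ℕ)) = (e1, e2))
          ⟨e1, he.1⟩ ⟨e2, he.2⟩ := Relation.EqvGen.rel _ _ (Or.inr rfl)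
      have h1 : ∀ c : Fin m, L.getD c 0 = L.getD e1 0 ↔ Relation.EqvGen r c ⟨e1, he.1⟩ :=
        fun c => hr c ⟨e1, he.1⟩
      have h2 : ∀ c : Fin m, L.getD c 0 = L.getD e2 0 ↔ Relation.EqvGen r c ⟨e2, he.2⟩ :=
        fun c => hr c ⟨e2, he.2⟩
      constructor
      · split_ifs with ha hb hb
        · intro _
          exact mono ((hr a b).1 (ha.trans hb.symm))
        · intro h
          exact ((mono ((h2 a).1 ha)).trans _ _ _ (step.symm _ _)).trans _ _ _
            ((mono ((h1 b).1 h.symm)).symm _ _)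
        · intro h
          exact ((mono ((h1 a).1 h)).trans _ _ _ step).trans _ _ _
            ((mono ((h2 b).1 hb)).symm _ _)
        · intro h
          exact mono ((hr a b).1 h)
      · intro h
        induction h with
        | rel x y h =>
          rcases h with h | h
          · rw [(hr x y).2 (Relation.EqvGen.rel _ _ h)]
          · obtain ⟨hx, hy⟩ := Prod.mk.inj h
            rw [hx, hy]
            simp
        | refl => rfl
        | symm _ _ _ ih => exact ih.symm
        | trans _ _ _ _ _ ih1 ih2 => exact ih1.trans ih2

/-- The final label is a complete invariant of a class, so classes correspond to distinct labels.
This replaces the cardinality of a quotient by a number that `decide` can evaluate. -/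
theorem card_quot_pairRel (m : ℕ) (E : List (ℕ × ℕ)) (hE : ∀ e ∈ E, e.1 < m ∧ e.2 < m) :
    Nat.card (Quot (pairRel m E)) = classCount m E := by
  obtain ⟨hlen, hspec⟩ := foldl_mergeStep_spec E hE (List.range m) (by simp) (fun _ _ => False)
    (fun a b => by
      constructor
      · intro h
        have : a = b := by
          apply Fin.ext
          simpa [List.getD_eq_getElem?_getD] using h
        exact this ▸ Relation.EqvGen.refl _
      · intro h
        induction h with
        | rel x y h => exact h.elim
        | refl => rfl
        | symm _ _ _ ih => exact ih.symm
        | trans _ _ _ _ _ ih1 ih2 => exact ih1.trans ih2)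
  simp only [false_or] at hspec
  change (classLabels m E).length = m at hlen
  let g : Quot (pairRel m E) → {x // x ∈ (classLabels m E).toFinset} :=
    Quot.lift (fun a => ⟨(classLabels m E).getD a 0, by
        have ha : (a : ℕ) < (classLabels m E).length := by rw [hlen]; exact a.2
        simp [List.getD_eq_getElem?_getD, ha]⟩)
      (fun a b h => Subtype.ext ((hspec a b).2 (Relation.EqvGen.rel _ _ h)))
  have hg : Function.Bijective g := by
    constructor
    · rintro ⟨a⟩ ⟨b⟩ h
      exact Quot.eqvGen_sound ((hspec a b).1 (congrArg Subtype.val h))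
    · rintro ⟨x, hx⟩
      obtain ⟨i, hi, rfl⟩ := List.mem_iff_getElem.1 (List.mem_toFinset.1 hx)
      refine ⟨Quot.mk _ ⟨i, hlen ▸ hi⟩, Subtype.ext ?_⟩
      simp [g, List.getD_eq_getElem?_getD, hi]
  rw [Nat.card_congr (Equiv.ofBijective g hg), Nat.card_eq_fintype_card, Fintype.card_coe,
    List.card_toFinset]
  rfl

theorem card_quot_eq_classCount {α : Type*} {m : ℕ} (e : α ≃ Fin m) (r : α → α → Prop)
    (E : List (ℕ × ℕ)) (hE : ∀ e ∈ E, e.1 < m ∧ e.2 < m)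
    (hr : ∀ a b, r a b ↔ ((e a : ℕ), (e b : ℕ)) ∈ E) :
    Nat.card (Quot r) = classCount m E := by
  rw [← card_quot_pairRel m E hE]
  refine Nat.card_congr (Quot.congr e fun a b => ?_)
  exact hr a b

/-! ## Faces and state components as class counts -/

/-- Positions of the over- and the under-passage of the same crossing, with its sign. -/
def crossingList (w : GaussWord) : List (ℕ × ℕ × Passage) :=
  (List.range w.length).flatMap fun o => (List.range w.length).flatMap fun u =>
    match w[o]?, w[u]? with
    | some x, some y =>
      if x.upper = true ∧ y = ⟨x.label, false, x.positive⟩ then [(o, u, x)] else []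
    | _, _ => []

theorem mem_crossingList {w : GaussWord} {o u : ℕ} {x : Passage} :
    (o, u, x) ∈ crossingList w ↔ x.upper = true ∧ CrossingAt w x.label o u x.positive := by
  simp only [crossingList, List.mem_flatMap, List.mem_range, CrossingAt]
  constructor
  · rintro ⟨o', ho, u', hu, h⟩
    rw [List.getElem?_eq_getElem ho, List.getElem?_eq_getElem hu] at h
    simp only at h
    split_ifs at h with hc
    · simp only [List.mem_singleton, Prod.mk.injEq] at h
      obtain ⟨rfl, rfl, rfl⟩ := h
      refine ⟨hc.1, ?_, ?_⟩
      · rw [List.getElem?_eq_getElem ho]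
        congr 1
        ext1 <;> simp [hc.1]
      · rw [List.getElem?_eq_getElem hu, hc.2]
    · simp at h
  · rintro ⟨hx, h1, h2⟩
    have e : (⟨x.label, true, x.positive⟩ : Passage) = x := by rw [← hx]
    rw [e] at h1
    refine ⟨o, (List.getElem?_eq_some_iff.1 h1).1, u, (List.getElem?_eq_some_iff.1 h2).1, ?_⟩
    rw [h1, h2]
    simp [hx]

theorem crossingAt_iff {w : GaussWord} {c o u : ℕ} {s : Bool} :
    CrossingAt w c o u s ↔ (o, u, (⟨c, true, s⟩ : Passage)) ∈ crossingList w := by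
  rw [mem_crossingList]
  simp

theorem CrossingAt.lt {w : GaussWord} {c o u : ℕ} {s : Bool} (h : CrossingAt w c o u s) :
    o < w.length ∧ u < w.length :=
  ⟨(List.getElem?_eq_some_iff.1 h.1).1, (List.getElem?_eq_some_iff.1 h.2).1⟩

/-- Numbering of the sides of the arcs. -/
def sideCode (a : ℕ × Bool) : ℕ := 2 * a.1 + a.2.toNat

theorem sideCode_injective : Function.Injective sideCode := by
  rintro ⟨a, _ | _⟩ ⟨b, _ | _⟩ h <;> simp [sideCode] at h ⊢ <;> omega

/-- The pairs of sides at the corners of one crossing. -/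
def cornersAt (x : ℕ × ℕ × Passage) : List ((ℕ × Bool) × (ℕ × Bool)) :=
  let o := x.1
  let u := x.2.1
  if x.2.2.positive then
    [((o + 1, true), (u + 1, false)), ((u + 1, true), (o, true)),
      ((o, false), (u, true)), ((u, false), (o + 1, false))]
  else
    [((o + 1, true), (u, true)), ((u, false), (o, true)),
      ((o, false), (u + 1, false)), ((u + 1, true), (o + 1, false))]

/-- All corners. -/
def cornerList (w : GaussWord) : List ((ℕ × Bool) × (ℕ × Bool)) :=
  ((0, true), (0, false)) :: ((w.length, true), (w.length, false)) ::
    (crossingList w).flatMap cornersAt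

theorem corner_iff {w : GaussWord} {a b : ℕ × Bool} : Corner w a b ↔ (a, b) ∈ cornerList w := by
  simp only [cornerList, List.mem_cons, List.mem_flatMap]
  constructor
  · intro h
    cases h with
    | tail => simp
    | head => simp
    | posNE h => exact Or.inr (Or.inr ⟨_, crossingAt_iff.1 h, by simp [cornersAt]⟩)
    | posNW h => exact Or.inr (Or.inr ⟨_, crossingAt_iff.1 h, by simp [cornersAt]⟩)
    | posSW h => exact Or.inr (Or.inr ⟨_, crossingAt_iff.1 h, by simp [cornersAt]⟩)
    | posSE h => exact Or.inr (Or.inr ⟨_, crossingAt_iff.1 h, by simp [cornersAt]⟩)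
    | negNE h => exact Or.inr (Or.inr ⟨_, crossingAt_iff.1 h, by simp [cornersAt]⟩)
    | negNW h => exact Or.inr (Or.inr ⟨_, crossingAt_iff.1 h, by simp [cornersAt]⟩)
    | negSW h => exact Or.inr (Or.inr ⟨_, crossingAt_iff.1 h, by simp [cornersAt]⟩)
    | negSE h => exact Or.inr (Or.inr ⟨_, crossingAt_iff.1 h, by simp [cornersAt]⟩)
  · rintro (h | h | ⟨⟨o, u, c, t, s⟩, hx, h⟩)
    · cases h; exact Corner.tail
    · cases h; exact Corner.head
    · have hc := (mem_crossingList.1 hx).2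
      cases s <;> simp [cornersAt] at h <;> rcases h with h | h | h | h <;>
        obtain ⟨rfl, rfl⟩ := h
      · exact Corner.negNE hc
      · exact Corner.negNW hc
      · exact Corner.negSW hc
      · exact Corner.negSE hc
      · exact Corner.posNE hc
      · exact Corner.posNW hc
      · exact Corner.posSW hc
      · exact Corner.posSE hc

/-- Computable number of faces. -/
def faceCountComp (w : GaussWord) : ℕ :=
  classCount (2 * (w.length + 1)) ((cornerList w).map fun e => (sideCode e.1, sideCode e.2))

/-- Numbering of the sides of the arcs, as an equivalence. -/
def sideEquiv (n : ℕ) : Fin n × Bool ≃ Fin (2 * n) where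
  toFun a := ⟨sideCode (a.1, a.2), by
    obtain ⟨⟨a, ha⟩, _ | _⟩ := a <;> simp [sideCode] <;> omega⟩
  invFun k := (⟨(k : ℕ) / 2, by omega⟩, (k : ℕ) % 2 == 1)
  left_inv := by
    rintro ⟨⟨a, ha⟩, _ | _⟩ <;> simp [sideCode]
    omega
  right_inv := by
    rintro ⟨k, hk⟩
    apply Fin.ext
    rcases Nat.mod_two_eq_zero_or_one k with h | h <;> simp [sideCode, h] <;> omega

/-- Makes the Euler characteristic test for lying on the sphere, and with it `IsKnotoidDiagram`,
decidable. -/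
theorem faceCount_eq (w : GaussWord) : faceCount w = faceCountComp w := by
  refine card_quot_eq_classCount (sideEquiv (w.length + 1)) _ _ ?_ ?_
  · intro e he
    obtain ⟨⟨⟨a, s⟩, ⟨b, t⟩⟩, h, rfl⟩ := List.mem_map.1 he
    have : a ≤ w.length ∧ b ≤ w.length := by
      cases corner_iff.2 h with
      | tail => simp
      | head => simp
      | posNE hc => have := hc.lt; omega
      | posNW hc => have := hc.lt; omega
      | posSW hc => have := hc.lt; omega
      | posSE hc => have := hc.lt; omega
      | negNE hc => have := hc.lt; omega
      | negNW hc => have := hc.lt; omega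
      | negSW hc => have := hc.lt; omega
      | negSE hc => have := hc.lt; omega
    have hs := s.toNat_lt
    have ht := t.toNat_lt
    simp only [sideCode]
    omega
  · intro a b
    rw [corner_iff]
    simp only [sideEquiv, Equiv.coe_fn_mk, List.mem_map, Prod.mk.injEq, Prod.exists]
    constructor
    · intro h
      exact ⟨_, _, _, _, h, rfl, rfl⟩
    · rintro ⟨a1, a2, b1, b2, h, h1, h2⟩
      rw [sideCode_injective h1, sideCode_injective h2] at h
      exact h

/-- The pairs of arcs joined at one crossing, when the labels in `S` are smoothed by `A`. -/
def joinsAt (S : Finset ℕ) (x : ℕ × ℕ × Passage) : List (ℕ × ℕ) :=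
  if decide (x.2.2.label ∈ S) = x.2.2.positive then [(x.1, x.2.1 + 1), (x.2.1, x.1 + 1)]
  else [(x.1, x.2.1), (x.1 + 1, x.2.1 + 1)]

/-- Computable number of components of a state. -/
def stateComp (w : GaussWord) (S : Finset ℕ) : ℕ :=
  classCount (w.length + 1) ((crossingList w).flatMap (joinsAt S))

theorem joined_iff {w : GaussWord} {S : Finset ℕ} {k l : ℕ} :
    Joined w S k l ↔ (k, l) ∈ (crossingList w).flatMap (joinsAt S) := by
  simp only [Joined, List.mem_flatMap]
  constructor
  · rintro ⟨c, o, u, s, h, h'⟩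
    refine ⟨_, crossingAt_iff.1 h, ?_⟩
    cases s <;> by_cases hc : c ∈ S <;> simp_all [joinsAt]
  · rintro ⟨⟨o, u, c, t, s⟩, hx, h⟩
    refine ⟨c, o, u, s, (mem_crossingList.1 hx).2, ?_⟩
    cases s <;> by_cases hc : c ∈ S <;> simp_all [joinsAt]

theorem stateComponents_eq (w : GaussWord) (S : Finset ℕ) :
    stateComponents w S = stateComp w S := by
  refine card_quot_eq_classCount (Equiv.refl _) _ _ ?_ fun a b => joined_iff
  rintro ⟨k, l⟩ he
  obtain ⟨c, o, u, s, h, h'⟩ := joined_iff.2 he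
  have := h.lt
  simp only
  omega

end OpenChain

namespace OpenChain

/-! ## The odd writhe -/

/-- The sign `1` or `-1`. -/
def boolSign (s : Bool) : ℤ := if s then 1 else -1

/-- The sum of `(-1)^i` over the positions `i` of the passages through the crossing `l`. -/
def altSum (l : ℕ) : GaussWord → ℤ
  | [] => 0
  | x :: w => (if x.label = l then 1 else 0) - altSum l w

/-- The sum of the signs of all passages, weighted by the squares of `g`. -/
def weightedSign (g : ℕ → ℤ) (w : GaussWord) : ℤ :=
  (w.map fun x => boolSign x.positive * g x.label ^ 2).sum

/-- Eight times the odd writhe. -/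
def oddWrithe (w : GaussWord) : ℤ := weightedSign (fun l => altSum l w) w

theorem altSum_append (l : ℕ) (u v : GaussWord) :
    altSum l (u ++ v) = altSum l u + (-1) ^ u.length * altSum l v := by
  induction u with
  | nil => simp [altSum]
  | cons x u ih => simp only [List.cons_append, altSum, ih, List.length_cons, pow_succ]; ring

theorem altSum_eq_zero {l : ℕ} {w : GaussWord} (h : ∀ x ∈ w, x.label ≠ l) : altSum l w = 0 := by
  induction w with
  | nil => rfl
  | cons x w ih => simp [altSum, ih fun y hy => h y (by simp [hy]), h x (by simp)]

theorem weightedSign_append (g : ℕ → ℤ) (u v : GaussWord) :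
    weightedSign g (u ++ v) = weightedSign g u + weightedSign g v := by
  simp [weightedSign]

theorem weightedSign_congr {g g' : ℕ → ℤ} {w : GaussWord}
    (h : ∀ x ∈ w, g x.label ^ 2 = g' x.label ^ 2) : weightedSign g w = weightedSign g' w := by
  unfold weightedSign
  congr 1
  exact List.map_congr_left fun x hx => by rw [h x hx]

/-- Used to show that a crossing displayed in a Reidemeister move has no passage in the rest of the
word. -/
theorem IsGaussWord.eq_or {w : GaussWord} (hw : IsGaussWord w) {x y : Passage} (hx : x ∈ w)
    (hy : y ∈ w) (h : y.label = x.label) : y = x ∨ y = ⟨x.label, !x.upper, x.positive⟩ := by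
  obtain ⟨-, h2, h3⟩ := hw.2 x hx
  obtain ⟨l, o, s⟩ := x
  obtain ⟨l', o', s'⟩ := y
  simp only at h
  subst h
  cases o <;> cases s <;> cases o' <;> cases s' <;> simp_all

/-- The two adjacent passages of the new crossing cancel in its alternating sum, and inserting two
letters does not change the parity of any later position. -/
theorem oddWrithe_r1 {u v : GaussWord} {c : ℕ} {o s : Bool}
    (hw : IsGaussWord (u ++ [⟨c, o, s⟩, ⟨c, !o, s⟩] ++ v)) :
    oddWrithe (u ++ [⟨c, o, s⟩, ⟨c, !o, s⟩] ++ v) = oddWrithe (u ++ v) := by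
  have hl : ∀ x ∈ u ++ v, x.label ≠ c := by
    intro x hx h
    have hnd := hw.1
    have := hw.eq_or (x := ⟨c, o, s⟩) (y := x) (by simp)
      (by simp only [List.mem_append] at hx ⊢; tauto) h
    simp only [List.append_assoc, List.nodup_append, List.mem_append, List.mem_cons] at hnd
    rcases List.mem_append.1 hx with hx | hx <;> rcases this with rfl | rfl
    · exact (hnd.2.2 _ hx _ (by simp)) rfl
    · exact (hnd.2.2 _ hx _ (by simp)) rfl
    · exact (hnd.2.1.2.2 _ (by simp) _ hx) rfl
    · exact (hnd.2.1.2.2 _ (by simp) _ hx) rfl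
  have hsum : ∀ l, altSum l (u ++ [⟨c, o, s⟩, ⟨c, !o, s⟩] ++ v) = altSum l (u ++ v) := by
    intro l
    simp only [altSum_append, altSum, List.length_append, List.length_cons, List.length_nil]
    ring
  have hc : altSum c (u ++ v) = 0 := altSum_eq_zero hl
  unfold oddWrithe
  simp only [hsum]
  simp [weightedSign, hc]

/-- The two new crossings have opposite signs and alternating sums of equal square, so they cancel;
for all other labels both inserted blocks have even length and preserve parities. -/
theorem oddWrithe_r2 {u v z : GaussWord} {c d : ℕ} {o s t : Bool}
    (hw : IsGaussWord
      (u ++ [⟨c, o, s⟩, ⟨d, o, !s⟩] ++ v ++ ordered t ⟨c, !o, s⟩ ⟨d, !o, !s⟩ ++ z)) :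
    oddWrithe (u ++ [⟨c, o, s⟩, ⟨d, o, !s⟩] ++ v ++ ordered t ⟨c, !o, s⟩ ⟨d, !o, !s⟩ ++ z) =
      oddWrithe (u ++ v ++ z) := by
  set w' := u ++ [⟨c, o, s⟩, ⟨d, o, !s⟩] ++ v ++ ordered t ⟨c, !o, s⟩ ⟨d, !o, !s⟩ ++ z with hw'
  have hcm : (⟨c, o, s⟩ : Passage) ∈ w' := by simp [hw']
  have hdm : (⟨d, o, !s⟩ : Passage) ∈ w' := by simp [hw']
  have hcd : c ≠ d := by
    rintro rfl
    exact (hw.2 _ hcm).2.1 hdm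
  have hl : ∀ x ∈ u ++ v ++ z, x.label ≠ c ∧ x.label ≠ d := by
    intro x hx
    have hperm : w'.Perm ((u ++ v ++ z) ++
        [⟨c, o, s⟩, ⟨d, o, !s⟩, ⟨c, !o, s⟩, ⟨d, !o, !s⟩]) := by
      rw [List.perm_iff_count]
      intro a
      cases t <;> simp [hw', ordered, List.count_append, List.count_cons] <;> ring
    have hnd := (hperm.nodup_iff).1 hw.1
    have hx' : x ∈ w' := hperm.mem_iff.2 (List.mem_append_left _ hx)
    have hdis := (List.nodup_append.1 hnd).2.2 x hx
    constructor
    · intro h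
      rcases hw.eq_or hcm hx' h with h | h
      · exact hdis _ (by simp) h
      · exact hdis ⟨c, !o, s⟩ (by simp) h
    · intro h
      rcases hw.eq_or hdm hx' h with h | h
      · exact hdis _ (by simp) h
      · exact hdis ⟨d, !o, !s⟩ (by simp) h
  have hzero : ∀ l, (l = c ∨ l = d) → altSum l u = 0 ∧ altSum l v = 0 ∧ altSum l z = 0 := by
    intro l hlcd
    refine ⟨altSum_eq_zero fun x hx => ?_, altSum_eq_zero fun x hx => ?_,
      altSum_eq_zero fun x hx => ?_⟩ <;>
    · have := hl x (by simp [hx])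
      rcases hlcd with rfl | rfl
      · exact this.1
      · exact this.2
  have hsum : ∀ l, l ≠ c → l ≠ d → altSum l w' = altSum l (u ++ v ++ z) := by
    intro l h1 h2
    cases t <;> simp [hw', ordered, altSum_append, altSum, h1.symm, h2.symm]
  -- In both blocks c and d are neighbours, so at each of its passages d has the opposite parity to
  -- c: the two sums are negatives of each other, whichever way the second block is traversed.
  have hneg : altSum c w' ^ 2 = altSum d w' ^ 2 := by
    obtain ⟨c1, c2, c3⟩ := hzero c (Or.inl rfl)
    obtain ⟨d1, d2, d3⟩ := hzero d (Or.inr rfl)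
    cases t <;>
      simp [hw', ordered, altSum_append, altSum, hcd, hcd.symm, c1, c2, c3, d1, d2, d3] <;> ring
  have hpart : ∀ y : GaussWord, (∀ x ∈ y, x ∈ u ++ v ++ z) →
      weightedSign (fun l => altSum l w') y = weightedSign (fun l => altSum l (u ++ v ++ z)) y :=
    fun y hy => weightedSign_congr fun x hx => by
      rw [hsum _ (hl x (hy x hx)).1 (hl x (hy x hx)).2]
  unfold oddWrithe
  generalize hg : (fun l => altSum l w') = g at hpart ⊢
  have hgc : g c ^ 2 = g d ^ 2 := by rw [← hg]; exact hneg
  rw [hw']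
  simp only [weightedSign_append]
  rw [hpart u (by simp +contextual), hpart v (by simp +contextual), hpart z (by simp +contextual)]
  have : weightedSign g [⟨c, o, s⟩, ⟨d, o, !s⟩] = 0 := by
    cases s <;> simp [weightedSign, boolSign, hgc]
  have : weightedSign g (ordered t ⟨c, !o, s⟩ ⟨d, !o, !s⟩) = 0 := by
    cases s <;> cases t <;> simp [weightedSign, boolSign, hgc, ordered]
  linarith

theorem ordered_altSum (t : Bool) (x y : Passage) (l : ℕ) :
    altSum l (ordered (!t) x y) = -altSum l (ordered t x y) := by
  cases t <;> simp [ordered, altSum]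

theorem ordered_perm (t : Bool) (x y : Passage) :
    (ordered t x y).Perm [x, y] := by
  cases t
  · exact List.Perm.swap _ _ _
  · exact List.Perm.refl _

/-- The move swaps each of three adjacent pairs, which negates the alternating sum of the pair. Both
passages of a moved crossing lie in these pairs, so its total is negated and the square is
unchanged; other crossings do not see the pairs. -/
theorem oddWrithe_r3 {u₀ u₁ u₂ u₃ x₁ x₂ x₃ y₁ y₂ y₃ : GaussWord} {a b c : ℕ}
    {sa sb sc tT tM tB : Bool}
    (hw : IsGaussWord (u₀ ++ x₁ ++ u₁ ++ x₂ ++ u₂ ++ x₃ ++ u₃))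
    (h : List.Perm [(x₁, y₁), (x₂, y₂), (x₃, y₃)]
        [(ordered tT ⟨a, true, sa⟩ ⟨b, true, sb⟩, ordered (!tT) ⟨a, true, sa⟩ ⟨b, true, sb⟩),
         (ordered tM ⟨a, false, sa⟩ ⟨c, true, sc⟩, ordered (!tM) ⟨a, false, sa⟩ ⟨c, true, sc⟩),
         (ordered tB ⟨b, false, sb⟩ ⟨c, false, sc⟩,
            ordered (!tB) ⟨b, false, sb⟩ ⟨c, false, sc⟩)]) :
    oddWrithe (u₀ ++ y₁ ++ u₁ ++ y₂ ++ u₂ ++ y₃ ++ u₃) =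
      oddWrithe (u₀ ++ x₁ ++ u₁ ++ x₂ ++ u₂ ++ x₃ ++ u₃) := by
  -- Facts valid for each pair separately, so that the order in which the three strands are met
  -- becomes irrelevant.
  have hP : ∀ q ∈ [(x₁, y₁), (x₂, y₂), (x₃, y₃)],
      (∀ l, altSum l q.2 = -altSum l q.1) ∧ q.1.length = 2 ∧ q.2.length = 2 ∧ q.2.Perm q.1 ∧
        ∀ l, l ≠ a → l ≠ b → l ≠ c → altSum l q.1 = 0 := by
    intro q hq
    have key : ∀ (t : Bool) (x y : Passage), (x.label = a ∨ x.label = b ∨ x.label = c) →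
        (y.label = a ∨ y.label = b ∨ y.label = c) →
        (∀ l, altSum l (ordered (!t) x y) = -altSum l (ordered t x y)) ∧
        (ordered t x y).length = 2 ∧ (ordered (!t) x y).length = 2 ∧
        (ordered (!t) x y).Perm (ordered t x y) ∧
        ∀ l, l ≠ a → l ≠ b → l ≠ c → altSum l (ordered t x y) = 0 := by
      intro t x y hx hy
      refine ⟨ordered_altSum t x y, by cases t <;> rfl, by cases t <;> rfl,
        (ordered_perm _ x y).trans (ordered_perm _ x y).symm, fun l h1 h2 h3 => ?_⟩
      apply altSum_eq_zero
      intro z hz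
      rcases (by simpa using (ordered_perm t x y).mem_iff.1 hz : z = x ∨ z = y) with rfl | rfl
      · rcases hx with h | h | h <;> rw [h] <;> exact fun h => by simp_all
      · rcases hy with h | h | h <;> rw [h] <;> exact fun h => by simp_all
    rw [h.mem_iff] at hq
    simp only [List.mem_cons, List.not_mem_nil, or_false] at hq
    rcases hq with rfl | rfl | rfl
    · exact key _ _ _ (by simp) (by simp)
    · exact key _ _ _ (by simp) (by simp)
    · exact key _ _ _ (by simp) (by simp)
  obtain ⟨n1, l1, m1, p1, z1⟩ := hP (x₁, y₁) (by simp)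
  obtain ⟨n2, l2, m2, p2, z2⟩ := hP (x₂, y₂) (by simp)
  obtain ⟨n3, l3, m3, p3, z3⟩ := hP (x₃, y₃) (by simp)
  simp only at n1 l1 m1 p1 z1 n2 l2 m2 p2 z2 n3 l3 m3 p3 z3
  have hx : (x₁ ++ x₂ ++ x₃).Perm [⟨a, true, sa⟩, ⟨b, true, sb⟩, ⟨a, false, sa⟩, ⟨c, true, sc⟩,
      ⟨b, false, sb⟩, ⟨c, false, sc⟩] := by
    have := (h.map Prod.fst).flatten
    simp only [List.map_cons, List.map_nil, List.flatten_cons, List.flatten_nil,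
      List.append_nil] at this
    rw [List.append_assoc]
    exact this.trans ((ordered_perm _ _ _).append ((ordered_perm _ _ _).append
      (ordered_perm _ _ _)))
  set w := u₀ ++ x₁ ++ u₁ ++ x₂ ++ u₂ ++ x₃ ++ u₃ with hwdef
  set w' := u₀ ++ y₁ ++ u₁ ++ y₂ ++ u₂ ++ y₃ ++ u₃ with hw'def
  have hperm : w.Perm ((u₀ ++ u₁ ++ u₂ ++ u₃) ++ [⟨a, true, sa⟩, ⟨b, true, sb⟩, ⟨a, false, sa⟩,
      ⟨c, true, sc⟩, ⟨b, false, sb⟩, ⟨c, false, sc⟩]) := by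
    refine List.Perm.trans ?_ (List.Perm.append_left _ hx)
    rw [List.perm_iff_count]
    intro e
    simp only [hwdef, List.count_append]
    ring
  have hww : w'.Perm w := by
    rw [List.perm_iff_count]
    intro e
    simp only [hwdef, hw'def, List.count_append, p1.count_eq, p2.count_eq, p3.count_eq]
  have hl : ∀ x ∈ u₀ ++ u₁ ++ u₂ ++ u₃, x.label ≠ a ∧ x.label ≠ b ∧ x.label ≠ c := by
    intro x hx
    have hdis := (List.nodup_append.1 ((hperm.nodup_iff).1 hw.1)).2.2 x hx
    have hx' : x ∈ w := hperm.mem_iff.2 (List.mem_append_left _ hx)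
    refine ⟨fun h => ?_, fun h => ?_, fun h => ?_⟩
    · rcases hw.eq_or (x := ⟨a, true, sa⟩) (hperm.mem_iff.2 (by simp)) hx' h with h | h <;>
        exact hdis _ (by simp) h
    · rcases hw.eq_or (x := ⟨b, true, sb⟩) (hperm.mem_iff.2 (by simp)) hx' h with h | h <;>
        exact hdis _ (by simp) h
    · rcases hw.eq_or (x := ⟨c, true, sc⟩) (hperm.mem_iff.2 (by simp)) hx' h with h | h <;>
        exact hdis _ (by simp) h
  have hsq : ∀ l, altSum l w' ^ 2 = altSum l w ^ 2 := by
    intro l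
    by_cases hlabc : l = a ∨ l = b ∨ l = c
    · have hz : ∀ u : GaussWord, (∀ x ∈ u, x ∈ u₀ ++ u₁ ++ u₂ ++ u₃) → altSum l u = 0 := by
        intro u hu
        apply altSum_eq_zero
        intro x hx
        obtain ⟨h1, h2, h3⟩ := hl x (hu x hx)
        rcases hlabc with rfl | rfl | rfl
        · exact h1
        · exact h2
        · exact h3
      simp only [hwdef, hw'def, altSum_append, List.length_append, n1, n2, n3, l1, l2, l3, m1, m2,
        m3, hz u₀ (by simp +contextual), hz u₁ (by simp +contextual),
        hz u₂ (by simp +contextual), hz u₃ (by simp +contextual)]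
      ring
    · push Not at hlabc
      obtain ⟨h1, h2, h3⟩ := hlabc
      simp only [hwdef, hw'def, altSum_append, List.length_append, n1, n2, n3, l1, l2, l3, m1, m2,
        m3, z1 l h1 h2 h3, z2 l h1 h2 h3, z3 l h1 h2 h3, neg_zero]
  unfold oddWrithe
  rw [weightedSign_congr (g' := fun l => altSum l w) fun x _ => hsq x.label]
  exact ((hww.map _).sum_eq)

theorem altSum_rename {f : ℕ → ℕ} (hf : Function.Injective f) (l : ℕ) (w : GaussWord) :
    altSum (f l) (w.map fun x => ⟨f x.label, x.upper, x.positive⟩) = altSum l w := by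
  induction w with
  | nil => rfl
  | cons x w ih => simp [altSum, ih, hf.eq_iff]

theorem Move.oddWrithe_eq {w w' : GaussWord} (h : Move w w') (hw : IsGaussWord w)
    (hw' : IsGaussWord w') : oddWrithe w = oddWrithe w' := by
  cases h with
  | rename w f hf =>
    simp [oddWrithe, weightedSign, List.map_map, Function.comp_def, altSum_rename hf]
  | r1 u v c o s => exact (oddWrithe_r1 hw').symm
  | r2 u v z c d o s t => exact (oddWrithe_r2 hw').symm
  | r3 u₀ u₁ u₂ u₃ x₁ x₂ x₃ y₁ y₂ y₃ a b c sa sb sc tT tM tB h₁ h₂ h =>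
    exact (oddWrithe_r3 hw h).symm

theorem KnotoidEquiv.oddWrithe_eq {w w' : GaussWord} (h : KnotoidEquiv w w') :
    oddWrithe w = oddWrithe w' := by
  induction h with
  | rel x y h => exact h.2.2.oddWrithe_eq h.1.1 h.2.1.1
  | refl => rfl
  | symm _ _ _ ih => exact ih.symm
  | trans _ _ _ _ _ ih1 ih2 => exact ih1.trans ih2

/-- The trivial knotoid and `k2.1` are different. -/
theorem IsK0.not_isK21 {w : GaussWord} (h : IsK0 w) : ¬ IsK21 w := by
  rintro ⟨s, o, h'⟩
  have h1 := KnotoidEquiv.oddWrithe_eq h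
  rw [KnotoidEquiv.oddWrithe_eq h'] at h1
  clear h h'
  -- In the standard diagram exactly one passage separates the two passages of either crossing, so
  -- both are odd and the invariant is ±16, against 0 for the empty word.
  revert s o
  decide

end OpenChain

namespace OpenChain

/-! ## Diagrams with at most three crossings -/

open LaurentPolynomial in
/-- The contribution of a state with `k` components. -/
noncomputable def loopFactor (k : ℕ) : ℝ[T;T⁻¹] := (-T 2 - T (-2)) ^ (k - 1)

open LaurentPolynomial in
theorem bracket_of_zero {w : GaussWord} (h : crossings w = ∅) :
    bracket w = loopFactor (stateComp w ∅) := by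
  simp [bracket, h, stateComponents_eq, loopFactor]

open LaurentPolynomial in
theorem bracket_of_one {w : GaussWord} {a : ℕ} (h : crossings w = {a}) :
    bracket w = T (-1) * loopFactor (stateComp w ∅) + T 1 * loopFactor (stateComp w {a}) := by
  unfold bracket
  rw [h, ← insert_empty_eq a, Finset.sum_powerset_insert (by simp)]
  simp [stateComponents_eq, loopFactor]

open LaurentPolynomial in
theorem bracket_of_two {w : GaussWord} {a b : ℕ} (hab : a ≠ b) (h : crossings w = {a, b}) :
    bracket w = T (-2) * loopFactor (stateComp w ∅) + loopFactor (stateComp w {a})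
      + loopFactor (stateComp w {b}) + T 2 * loopFactor (stateComp w {a, b}) := by
  unfold bracket
  rw [h, Finset.sum_powerset_insert (by simpa using hab), ← insert_empty_eq b,
    Finset.sum_powerset_insert (by simp), Finset.sum_powerset_insert (by simp)]
  simp [stateComponents_eq, loopFactor, hab]
  ring

open LaurentPolynomial in
theorem bracket_of_three {w : GaussWord} {a b c : ℕ} (hab : a ≠ b) (hac : a ≠ c) (hbc : b ≠ c)
    (h : crossings w = {a, b, c}) :
    bracket w = T (-3) * loopFactor (stateComp w ∅) + T (-1) * loopFactor (stateComp w {a})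
      + T (-1) * loopFactor (stateComp w {b}) + T (-1) * loopFactor (stateComp w {c})
      + T 1 * loopFactor (stateComp w {a, b}) + T 1 * loopFactor (stateComp w {a, c})
      + T 1 * loopFactor (stateComp w {b, c}) + T 3 * loopFactor (stateComp w {a, b, c}) := by
  unfold bracket
  rw [h, Finset.sum_powerset_insert (by simp [hab, hac]), Finset.sum_powerset_insert
    (by simpa using hbc), ← insert_empty_eq c, Finset.sum_powerset_insert (by simp),
    Finset.sum_powerset_insert (by simp), Finset.sum_powerset_insert (by simpa using hbc),
    Finset.sum_powerset_insert (by simp), Finset.sum_powerset_insert (by simp)]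
  simp [stateComponents_eq, loopFactor, hab, hac, hbc]
  ring

/-- Computable sign of a crossing. -/
def signComp (w : GaussWord) (c : ℕ) : ℤ :=
  if (crossingList w).any fun x => decide (x.2.2.label = c) && x.2.2.positive then 1 else -1

theorem crossingSign_eq (w : GaussWord) (c : ℕ) : crossingSign w c = signComp w c := by
  unfold crossingSign signComp
  congr 1
  simp only [List.any_eq_true, Bool.and_eq_true, decide_eq_true_eq, eq_iff_iff]
  constructor
  · rintro ⟨o, u, h⟩
    exact ⟨_, crossingAt_iff.1 h, rfl, rfl⟩
  · rintro ⟨⟨o, u, c', t, s⟩, hx, rfl, hs⟩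
    simp only at hs
    subst hs
    exact ⟨o, u, (mem_crossingList.1 hx).2⟩

theorem writhe_eq (w : GaussWord) : writhe w = ∑ c ∈ crossings w, signComp w c :=
  Finset.sum_congr rfl fun c _ => crossingSign_eq w c

instance (w : GaussWord) : Decidable (IsGaussWord w) := by
  unfold IsGaussWord
  infer_instance

theorem isKnotoidDiagram_iff {w : GaussWord} :
    IsKnotoidDiagram w ↔ IsGaussWord w ∧ faceCountComp w = (crossings w).card + 1 := by
  rw [IsKnotoidDiagram, faceCount_eq]

instance (w : GaussWord) : Decidable (IsKnotoidDiagram w) :=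
  decidable_of_iff' _ isKnotoidDiagram_iff


/-- The states of a diagram with two crossings. -/
def stateList₂ (w : GaussWord) (a b : ℕ) : List ℕ :=
  [stateComp w ∅, stateComp w {a}, stateComp w {b}, stateComp w {a, b}]

/-- The states of a diagram with three crossings. -/
def stateList₃ (w : GaussWord) (a b c : ℕ) : List ℕ :=
  [stateComp w ∅, stateComp w {a}, stateComp w {b}, stateComp w {c}, stateComp w {a, b},
    stateComp w {a, c}, stateComp w {b, c}, stateComp w {a, b, c}]

open LaurentPolynomial in
theorem bracket_of_stateList₂ {w : GaussWord} {a b k₀ k₁ k₂ k₃ : ℕ} (hab : a ≠ b)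
    (h : crossings w = {a, b}) (hk : stateList₂ w a b = [k₀, k₁, k₂, k₃]) :
    bracket w = T (-2) * loopFactor k₀ + loopFactor k₁ + loopFactor k₂ + T 2 * loopFactor k₃ := by
  simp only [stateList₂, List.cons.injEq, and_true] at hk
  obtain ⟨h0, h1, h2, h3⟩ := hk
  rw [bracket_of_two hab h, h0, h1, h2, h3]

open LaurentPolynomial in
theorem bracket_of_stateList₃ {w : GaussWord} {a b c k₀ k₁ k₂ k₃ k₄ k₅ k₆ k₇ : ℕ} (hab : a ≠ b)
    (hac : a ≠ c) (hbc : b ≠ c) (h : crossings w = {a, b, c})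
    (hk : stateList₃ w a b c = [k₀, k₁, k₂, k₃, k₄, k₅, k₆, k₇]) :
    bracket w = T (-3) * loopFactor k₀
      + T (-1) * (loopFactor k₁ + loopFactor k₂ + loopFactor k₃)
      + T 1 * (loopFactor k₄ + loopFactor k₅ + loopFactor k₆) + T 3 * loopFactor k₇ := by
  simp only [stateList₃, List.cons.injEq, and_true] at hk
  obtain ⟨h0, h1, h2, h3, h4, h5, h6, h7⟩ := hk
  rw [bracket_of_three hab hac hbc h, h0, h1, h2, h3, h4, h5, h6, h7]
  ring

open LaurentPolynomial in
theorem loopFactor_values : loopFactor 1 = 1 ∧ loopFactor 2 = -T 2 - T (-2) ∧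
    loopFactor 3 = T 4 + 2 + T (-4) := by
  refine ⟨by simp [loopFactor], by simp [loopFactor], ?_⟩
  have h : (T 2 * T (-2) : ℝ[T;T⁻¹]) = 1 := by rw [← T_add]; simp
  have h1 : (T 4 : ℝ[T;T⁻¹]) = T 2 * T 2 := by rw [← T_add]; norm_num
  have h2 : (T (-4) : ℝ[T;T⁻¹]) = T (-2) * T (-2) := by rw [← T_add]; norm_num
  simp only [loopFactor, h1, h2]
  linear_combination 2 * h

open LaurentPolynomial in
theorem curl_values : curl 0 = 1 ∧ curl 1 = -T 3 ∧ curl (-1) = -T (-3) ∧ curl 2 = T 6 ∧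
    curl (-2) = T (-6) := by
  refine ⟨?_, ?_, ?_, ?_, ?_⟩ <;> simp [curl]

/-- A diagram of the trivial knotoid with writhe `m`. -/
structure TrivialDiagram (w : GaussWord) (m : ℤ) : Prop where
  isK0 : IsK0 w
  writhe_eq : writhe w = m
  bracket_eq : bracket w = curl m

/-- A diagram of `k2.1` with two crossings of sign `s`. -/
structure K21Diagram (w : GaussWord) (s : ℤ) : Prop where
  isK21 : IsK21 w
  writhe_eq : writhe w = 2 * s
  bracket_eq : bracket w = k21Bracket s

theorem isK0_of_move {w w' : GaussWord} (h : Move w w') (hw : IsKnotoidDiagram w)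
    (hw' : IsKnotoidDiagram w') (h0 : IsK0 w) : IsK0 w' :=
  ((Relation.EqvGen.rel _ _ ⟨hw, hw', h⟩).symm _ _).trans _ _ _ h0

theorem trivialDiagram_nil : TrivialDiagram [] 0 := by
  refine ⟨Relation.EqvGen.refl _, by rw [writhe_eq]; decide, ?_⟩
  rw [bracket_of_zero (by decide), curl_values.1, show stateComp [] ∅ = 1 by decide,
    loopFactor_values.1]

/-- The labels 4, 9, 10 are the values of `Nat.pair` at (0, 2), (0, 3), (1, 3), the names of the
three possible crossings of a projected chain. Fixing them keeps every check on words decidable. -/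
theorem isK0_loop (a : ℕ) (ha : a = 4 ∨ a = 9 ∨ a = 10) (o s : Bool) :
    IsK0 [⟨a, o, s⟩, ⟨a, !o, s⟩] := by
  refine isK0_of_move (Move.r1 [] [] a o s) (by decide) ?_ (Relation.EqvGen.refl _)
  rcases ha with rfl | rfl | rfl <;> revert o s <;> decide

open LaurentPolynomial in
theorem trivialDiagram_loop (a : ℕ) (ha : a = 4 ∨ a = 9 ∨ a = 10) (o s : Bool) :
    TrivialDiagram [⟨a, o, s⟩, ⟨a, !o, s⟩] (boolSign s) := by
  refine ⟨isK0_loop a ha o s, ?_, ?_⟩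
  · rw [writhe_eq]
    rcases ha with rfl | rfl | rfl <;> revert o s <;> decide
  · have h : ∀ o s : Bool, crossings [⟨a, o, s⟩, ⟨a, !o, s⟩] = {a} ∧
        stateComp [⟨a, o, s⟩, ⟨a, !o, s⟩] ∅ = (if s then 1 else 2) ∧
        stateComp [⟨a, o, s⟩, ⟨a, !o, s⟩] {a} = (if s then 2 else 1) := by
      rcases ha with rfl | rfl | rfl <;> decide
    obtain ⟨h1, h2, h3⟩ := h o s
    rw [bracket_of_one h1, h2, h3]
    cases s <;> simp only [loopFactor_values, boolSign, curl_values, mul_sub, mul_neg, mul_one, ← T_add,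
      if_true, if_false, Bool.false_eq_true] <;>
      (norm_num; try ring)

theorem isKnotoidDiagram_nested (a b : ℕ) (hab : (a = 4 ∧ b = 9) ∨ (a = 10 ∧ b = 9))
    (o s o' s' : Bool) :
    IsKnotoidDiagram [⟨b, o, s⟩, ⟨a, o', s'⟩, ⟨a, !o', s'⟩, ⟨b, !o, s⟩] := by
  rcases hab with ⟨rfl, rfl⟩ | ⟨rfl, rfl⟩ <;> revert o s o' s' <;> decide +kernel

-- The inner curl goes away by a first Reidemeister move, leaving a single loop. The bracket is
-- computed from the component counts of the four states, which depend only on the signs.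
open LaurentPolynomial in
theorem trivialDiagram_nested (a b : ℕ) (hab : (a = 4 ∧ b = 9) ∨ (a = 10 ∧ b = 9))
    (o s o' s' : Bool) :
    TrivialDiagram [⟨b, o, s⟩, ⟨a, o', s'⟩, ⟨a, !o', s'⟩, ⟨b, !o, s⟩]
      (boolSign s + boolSign s') := by
  refine ⟨isK0_of_move (Move.r1 [⟨b, o, s⟩] [⟨b, !o, s⟩] a o' s') ?_
    (isKnotoidDiagram_nested a b hab o s o' s') (isK0_loop b (by omega) o s), ?_, ?_⟩
  · rcases hab with ⟨rfl, rfl⟩ | ⟨rfl, rfl⟩ <;> revert o s <;> decide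
  · rw [writhe_eq]
    rcases hab with ⟨rfl, rfl⟩ | ⟨rfl, rfl⟩ <;> revert o s o' s' <;> decide +kernel
  · have h : ∀ o s o' s' : Bool,
        crossings [⟨b, o, s⟩, ⟨a, o', s'⟩, ⟨a, !o', s'⟩, ⟨b, !o, s⟩] = {b, a} ∧
        stateList₂ [⟨b, o, s⟩, ⟨a, o', s'⟩, ⟨a, !o', s'⟩, ⟨b, !o, s⟩] b a =
          if s then (if s' then [1, 2, 2, 3] else [2, 3, 1, 2])
          else (if s' then [2, 1, 3, 2] else [3, 2, 2, 1]) := by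
      rcases hab with ⟨rfl, rfl⟩ | ⟨rfl, rfl⟩ <;> decide +kernel
    have hne : b ≠ a := by omega
    obtain ⟨h1, h2⟩ := h o s o' s'
    cases s <;> cases s' <;> rw [bracket_of_stateList₂ hne h1 h2] <;>
      simp only [loopFactor_values, boolSign, if_true, if_false, Bool.false_eq_true, Int.reduceAdd,
        Int.reduceNeg, curl_values, mul_add, mul_sub, mul_neg, mul_one, ← T_add] <;>
      ring_nf <;> rw [T_zero] <;> ring

end OpenChain

/-! ### Interlaced crossings: bigons, k2.1 and the three-crossing diagram -/

namespace OpenChain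

open LaurentPolynomial in
theorem trivialDiagram_bigon (a b : ℕ) (hab : (a = 4 ∧ b = 9) ∨ (a = 9 ∧ b = 10)) (o s : Bool) :
    TrivialDiagram [⟨a, o, s⟩, ⟨b, o, !s⟩, ⟨a, !o, s⟩, ⟨b, !o, !s⟩] 0 := by
  refine ⟨isK0_of_move (Move.r2 [] [] [] a b o s true) (by decide) ?_ (Relation.EqvGen.refl _),
    ?_, ?_⟩
  · rcases hab with ⟨rfl, rfl⟩ | ⟨rfl, rfl⟩ <;> revert o s <;> decide +kernel
  · rw [writhe_eq]
    rcases hab with ⟨rfl, rfl⟩ | ⟨rfl, rfl⟩ <;> revert o s <;> decide +kernel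
  · have h : ∀ o s : Bool,
        crossings [⟨a, o, s⟩, ⟨b, o, !s⟩, ⟨a, !o, s⟩, ⟨b, !o, !s⟩] = {a, b} ∧
        stateList₂ [⟨a, o, s⟩, ⟨b, o, !s⟩, ⟨a, !o, s⟩, ⟨b, !o, !s⟩] a b =
          if s then [1, 1, 2, 1] else [1, 2, 1, 1] := by
      rcases hab with ⟨rfl, rfl⟩ | ⟨rfl, rfl⟩ <;> decide +kernel
    have hne : a ≠ b := by omega
    obtain ⟨h1, h2⟩ := h o s
    cases s <;> rw [bracket_of_stateList₂ hne h1 h2] <;>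
      simp only [loopFactor_values, curl_values, mul_one] <;> ring

/-- Alternating heights with equal signs already give the standard diagram; only the names of the
crossings differ. -/
theorem isK21_interlaced (a b : ℕ) (hab : (a = 4 ∧ b = 9) ∨ (a = 9 ∧ b = 10)) (o s : Bool) :
    IsK21 [⟨a, o, s⟩, ⟨b, !o, s⟩, ⟨a, !o, s⟩, ⟨b, o, s⟩] := by
  refine ⟨s, o, (Relation.EqvGen.rel _ _ ⟨?_, ?_, ?_⟩).symm _ _⟩
  · revert o s; decide +kernel
  · rcases hab with ⟨rfl, rfl⟩ | ⟨rfl, rfl⟩ <;> revert o s <;> decide +kernel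
  · have := Move.rename (k21Word s o) (Equiv.swap 2 b * Equiv.swap 1 a : Equiv.Perm ℕ)
      (Equiv.injective _)
    rcases hab with ⟨rfl, rfl⟩ | ⟨rfl, rfl⟩ <;> exact this

open LaurentPolynomial in
theorem bracket_interlaced (a b : ℕ)
    (hab : (a = 1 ∧ b = 2) ∨ (a = 4 ∧ b = 9) ∨ (a = 9 ∧ b = 10)) (o s : Bool) :
    bracket [⟨a, o, s⟩, ⟨b, !o, s⟩, ⟨a, !o, s⟩, ⟨b, o, s⟩] = k21Bracket (boolSign s) := by
  have h : ∀ o s : Bool,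
      crossings [⟨a, o, s⟩, ⟨b, !o, s⟩, ⟨a, !o, s⟩, ⟨b, o, s⟩] = {a, b} ∧
      stateList₂ [⟨a, o, s⟩, ⟨b, !o, s⟩, ⟨a, !o, s⟩, ⟨b, o, s⟩] a b =
        if s then [2, 1, 1, 1] else [1, 1, 1, 2] := by
    rcases hab with ⟨rfl, rfl⟩ | ⟨rfl, rfl⟩ | ⟨rfl, rfl⟩ <;> decide +kernel
  have hne : a ≠ b := by omega
  obtain ⟨h1, h2⟩ := h o s
  cases s <;> rw [bracket_of_stateList₂ hne h1 h2] <;>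
    simp only [loopFactor_values, k21Bracket, boolSign, if_true, if_false, Bool.false_eq_true,
      mul_sub, mul_neg, mul_one, ← T_add] <;> norm_num <;> ring

theorem k21Diagram_interlaced (a b : ℕ) (hab : (a = 4 ∧ b = 9) ∨ (a = 9 ∧ b = 10)) (o s : Bool) :
    K21Diagram [⟨a, o, s⟩, ⟨b, !o, s⟩, ⟨a, !o, s⟩, ⟨b, o, s⟩] (boolSign s) := by
  refine ⟨isK21_interlaced a b hab o s, ?_, bracket_interlaced a b (Or.inr hab) o s⟩
  rw [writhe_eq]
  rcases hab with ⟨rfl, rfl⟩ | ⟨rfl, rfl⟩ <;> revert o s <;> decide +kernel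

/-- The diagram of a chain whose edges cross in all possible ways. -/
def threeWord (oa ob oc sa sb sc : Bool) : GaussWord :=
  [⟨4, oa, sa⟩, ⟨9, ob, sb⟩, ⟨10, oc, sc⟩, ⟨4, !oa, sa⟩, ⟨9, !ob, sb⟩, ⟨10, !oc, sc⟩]

-- Since the signs are not all equal, either the first two or the last two crossings have opposite
-- signs. By the hypotheses on heights that pair is then passed on the same level, so a second
-- Reidemeister move removes it and leaves one loop.
open LaurentPolynomial in
theorem trivialDiagram_threeWord {oa ob oc sa sb sc : Bool} (h₁ : (oa = ob) ↔ (sa ≠ sb))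
    (h₂ : (ob = oc) ↔ (sb ≠ sc)) (h : ¬ (sa = sb ∧ sb = sc)) :
    TrivialDiagram (threeWord oa ob oc sa sb sc) (boolSign sa + boolSign sb + boolSign sc) := by
  -- The two equivalences determine all heights from `oa` and the signs, which leaves few enough
  -- cases for evaluation.
  have hb : ob = (oa == (sa != sb)) := by
    revert h₁; clear h h₂; revert oa ob sa sb; decide
  have hc : oc = (ob == (sb != sc)) := by
    revert h₂; clear hb h h₁; revert oc ob sc sb; decide
  subst hc hb
  clear h₁ h₂
  refine ⟨?_, ?_, ?_⟩
  · have hd : ∀ oa sa sb sc, ¬ (sa = sb ∧ sb = sc) → IsKnotoidDiagram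
        (threeWord oa (oa == (sa != sb)) ((oa == (sa != sb)) == (sb != sc)) sa sb sc) := by
      decide +kernel
    specialize hd oa sa sb sc h
    by_cases hab : sa = sb
    · obtain rfl := hab
      obtain rfl : sc = !sa := by cases sa <;> cases sc <;> simp_all
      have e : ((oa == (sa != sa)) == (sa != !sa)) = !oa := by cases oa <;> cases sa <;> rfl
      have e' : (oa == (sa != sa)) = !oa := by cases oa <;> cases sa <;> rfl
      rw [e, e'] at hd ⊢
      exact isK0_of_move
        (Move.r2 [⟨4, oa, sa⟩] [⟨4, !oa, sa⟩] [] 9 10 (!oa) sa true)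
        (by clear hd e e'; revert oa sa; decide) hd (isK0_loop 4 (by simp) oa sa)
    · obtain rfl : sb = !sa := by cases sa <;> cases sb <;> simp_all
      have e' : (oa == (sa != !sa)) = oa := by cases oa <;> cases sa <;> rfl
      rw [e'] at hd ⊢
      exact isK0_of_move
        (Move.r2 [] [⟨10, (oa == ((!sa) != sc)), sc⟩] [⟨10, !(oa == ((!sa) != sc)), sc⟩]
          4 9 oa sa true)
        (by clear hd e'; revert oa sa sc; decide) hd (isK0_loop 10 (by simp) _ sc)
  · rw [writhe_eq]
    clear h
    revert oa sa sb sc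
    decide +kernel
  · have hk : ∀ oa sa sb sc : Bool, crossings (threeWord oa (oa == (sa != sb))
          ((oa == (sa != sb)) == (sb != sc)) sa sb sc) = {4, 9, 10} ∧
        stateList₃ (threeWord oa (oa == (sa != sb))
          ((oa == (sa != sb)) == (sb != sc)) sa sb sc) 4 9 10 =
          if sa = sb then
            if sa then (if sc then [3, 2, 2, 2, 1, 1, 1, 2] else [2, 1, 1, 3, 2, 2, 2, 1])
            else (if sc then [1, 2, 2, 2, 3, 1, 1, 2] else [2, 1, 1, 1, 2, 2, 2, 3])
          else if sa then (if sc then [2, 1, 3, 1, 2, 2, 2, 1] else [1, 2, 2, 2, 1, 1, 3, 2])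
            else (if sc then [2, 3, 1, 1, 2, 2, 2, 1] else [1, 2, 2, 2, 1, 3, 1, 2]) := by
      decide +kernel
    obtain ⟨h1, h2⟩ := hk oa sa sb sc
    cases sa <;> cases sb <;> cases sc <;> first
      | exact absurd ⟨rfl, rfl⟩ h
      | (rw [bracket_of_stateList₃ (by decide) (by decide) (by decide) h1 h2]
         simp only [loopFactor_values, boolSign, if_true, if_false, Bool.false_eq_true,
           Int.reduceAdd, Int.reduceNeg, curl_values, mul_add, mul_sub, mul_neg, mul_one, ← T_add]
         ring_nf)

end OpenChain

namespace OpenChain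

/-! ## Sign algebra of the projected chain -/

/-- The relations between the triple products `x i j = (a_i × a_j) · ξ` and the determinants
`t k` of four vectors `a_0, a_1, a_2, a_4` of 3-space, the vector `a_k` being omitted in `t k`
(with `3` for the origin). -/
structure ChainRel (t0 t1 t2 t4 x01 x02 x04 x12 x14 x24 : ℝ) : Prop where
  r0 : t1 * x01 - t2 * x02 + t4 * x04 = 0
  r1 : t0 * x01 - t2 * x12 + t4 * x14 = 0
  r2 : t0 * x02 - t1 * x12 + t4 * x24 = 0
  r4 : t0 * x04 - t1 * x14 + t2 * x24 = 0
  plucker : x01 * x24 - x02 * x14 + x04 * x12 = 0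

/-- The signs in the direction `ξ` when the first edge crosses both the third and the fourth one,
normalized by the antipodal map. -/
structure DoubleCross (x01 x02 x04 x12 x14 : ℝ) : Prop where
  n1 : 0 < x02
  n2 : 0 < x01
  n3 : 0 < -x12
  n4 : 0 < -(x01 + x12 - x02)
  u1 : 0 < x04
  u2 : 0 < -(x01 + x14 - x04)
  u3 : 0 < -x14

variable {t0 t1 t2 t4 x01 x02 x04 x12 x14 x24 : ℝ}

theorem ChainRel.scale (R : ChainRel t0 t1 t2 t4 x01 x02 x04 x12 x14 x24) (a b : ℝ) :
    ChainRel (a * t0) (a * t1) (a * t2) (a * t4) (b * x01) (b * x02) (b * x04) (b * x12)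
      (b * x14) (b * x24) where
  r0 := by linear_combination a * b * R.r0
  r1 := by linear_combination a * b * R.r1
  r2 := by linear_combination a * b * R.r2
  r4 := by linear_combination a * b * R.r4
  plucker := by linear_combination b ^ 2 * R.plucker

/-- If the first edge crosses the third and the second one crosses the fourth, then the first one
crosses the fourth. -/
theorem ChainRel.doubleCross (R : ChainRel t0 t1 t2 t4 x01 x02 x04 x12 x14 x24)
    (h1 : 0 < x02) (h2 : 0 < x01) (h3 : 0 < -x12) (h4 : 0 < -(x01 + x12 - x02))
    (h5 : 0 < -x14) (h6 : 0 < x12 + x24 - x14) (h7 : 0 < x24) :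
    DoubleCross x01 x02 x04 x12 x14 := by
  have hp := R.plucker
  have h04 : 0 < x04 := by
    by_contra! f
    nlinarith [mul_pos h2 h7, mul_pos h1 h5, mul_nonneg h3.le (neg_nonneg.2 f)]
  refine ⟨h1, h2, h3, h4, h04, ?_, h5⟩
  -- By the Plücker relation the left side equals x01 (x12 + x24 - x14) + (-x14) (-(x01 + x12 -
  -- x02)), a sum of two positive terms. The lemma is a fact of plane geometry: the determinants
  -- play no role.
  have : 0 < -(x01 + x14 - x04) * -x12 := by nlinarith [mul_pos h2 h6, mul_pos h5 h4]
  exact pos_of_mul_pos_left this h3.le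

section same

/-- If the crossings of the first edge have the same sign, then the other signs are determined. -/
theorem ChainRel.same_signs (R : ChainRel t0 t1 t2 t4 x01 x02 x04 x12 x14 x24)
    (S : DoubleCross x01 x02 x04 x12 x14) (h4 : t4 < 0) (h2 : 0 < t2) :
    t0 < 0 ∧ 0 < t1 ∧ t0 - t1 + t2 - t4 < 0 := by
  obtain ⟨n1, n2, n3, n4, u1, u2, u3⟩ := S
  obtain ⟨r0, r1, r2, r4, -⟩ := R
  have h0 : t0 < 0 := by by_contra! f; nlinarith
  have h1 : 0 < t1 := by by_contra! f; nlinarith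
  refine ⟨h0, h1, ?_⟩
  -- Contradicts (t0 - t1 + t2 - t4) x01 = t2 (x01 + x12 - x02) - t4 (x01 + x14 - x04), a
  -- consequence of `r0` and `r1`.
  by_contra! f
  nlinarith

variable (R : ChainRel t0 t1 t2 t4 x01 x02 x04 x12 x14 x24) (h4 : t4 < 0) (h2 : 0 < t2)
  (hq : t0 - t1 + t2 - t4 < 0)
include R h4 h2 hq

/-- This and the following lemmas say that the walls listed in a row suffice. With the determinant
signs known, negating an omitted inequality contradicts the relations, because each product of a
determinant with an x_ij then has a definite sign. The letters p and m stand for the signs of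
c_{4,1} and c_{4,0}, up to positive factors -t4 - t1 and t0 - t4. -/
theorem doubleCross_same_pp (h1 : 0 < t1) (c1 : 0 < -t4 - t1) (c0 : 0 < t0 - t4)
    (n4 : 0 < -(x01 + x12 - x02)) (n1 : 0 < x02) (u2 : 0 < -(x01 + x14 - x04)) (n3 : 0 < -x12) :
    DoubleCross x01 x02 x04 x12 x14 := by
  obtain ⟨r0, r1, r2, r4, -⟩ := R
  have n2 : 0 < x01 := by by_contra! f; nlinarith
  have u1 : 0 < x04 := by by_contra! f; nlinarith
  have u3 : 0 < -x14 := by by_contra! f; nlinarith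
  exact ⟨n1, n2, n3, n4, u1, u2, u3⟩

theorem doubleCross_same_pm (h1 : 0 < t1) (c1 : 0 < -t4 - t1)
    (n4 : 0 < -(x01 + x12 - x02)) (n1 : 0 < x02) (u2 : 0 < -(x01 + x14 - x04)) (u1 : 0 < x04)
    (n3 : 0 < -x12) : DoubleCross x01 x02 x04 x12 x14 := by
  obtain ⟨r0, r1, r2, r4, -⟩ := R
  have n2 : 0 < x01 := by by_contra! f; nlinarith
  have u3 : 0 < -x14 := by by_contra! f; nlinarith
  exact ⟨n1, n2, n3, n4, u1, u2, u3⟩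

theorem doubleCross_same_mp (h0 : t0 < 0) (c0 : 0 < t0 - t4)
    (n4 : 0 < -(x01 + x12 - x02)) (n1 : 0 < x02) (u3 : 0 < -x14) (u2 : 0 < -(x01 + x14 - x04))
    (n3 : 0 < -x12) : DoubleCross x01 x02 x04 x12 x14 := by
  obtain ⟨r0, r1, r2, r4, -⟩ := R
  have n2 : 0 < x01 := by by_contra! f; nlinarith
  have u1 : 0 < x04 := by by_contra! f; nlinarith
  exact ⟨n1, n2, n3, n4, u1, u2, u3⟩

theorem doubleCross_same_mm
    (n4 : 0 < -(x01 + x12 - x02)) (n1 : 0 < x02) (u3 : 0 < -x14) (u2 : 0 < -(x01 + x14 - x04))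
    (u1 : 0 < x04) (n3 : 0 < -x12) : DoubleCross x01 x02 x04 x12 x14 := by
  obtain ⟨r0, r1, r2, r4, -⟩ := R
  have n2 : 0 < x01 := by by_contra! f; nlinarith
  exact ⟨n1, n2, n3, n4, u1, u2, u3⟩

theorem doubleCross_single_p (h0 : t0 < 0) (h1 : 0 < t1) (c0 : 0 < t0 - t4)
    (n4 : 0 < -(x01 + x12 - x02)) (v3 : 0 < -x24) (u2 : 0 < -(x01 + x14 - x04)) (n3 : 0 < -x12) :
    DoubleCross x01 x02 x04 x12 x14 := by
  obtain ⟨r0, r1, r2, r4, -⟩ := R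
  have n2 : 0 < x01 := by by_contra! f; nlinarith
  have n1 : 0 < x02 := by by_contra! f; nlinarith
  have u1 : 0 < x04 := by by_contra! f; nlinarith
  have u3 : 0 < -x14 := by by_contra! f; nlinarith
  exact ⟨n1, n2, n3, n4, u1, u2, u3⟩

theorem doubleCross_single_m (h0 : t0 < 0) (h1 : 0 < t1) (n4 : 0 < -(x01 + x12 - x02))
    (v3 : 0 < -x24) (u2 : 0 < -(x01 + x14 - x04)) (u1 : 0 < x04) (n3 : 0 < -x12) :
    DoubleCross x01 x02 x04 x12 x14 := by
  obtain ⟨r0, r1, r2, r4, -⟩ := R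
  have n2 : 0 < x01 := by by_contra! f; nlinarith
  have n1 : 0 < x02 := by by_contra! f; nlinarith
  have u3 : 0 < -x14 := by by_contra! f; nlinarith
  exact ⟨n1, n2, n3, n4, u1, u2, u3⟩

theorem doubleCross_quadrangle (h0 : t0 < 0) (h1 : 0 < t1) (v3 : 0 < x24)
    (v2 : 0 < -(x12 + x24 - x14)) (n1 : 0 < x02) (u2 : 0 < -(x01 + x14 - x04)) :
    DoubleCross x01 x02 x04 x12 x14 := by
  obtain ⟨r0, r1, r2, r4, -⟩ := R
  have u1 : 0 < x04 := by by_contra! f; nlinarith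
  have u3 : 0 < -x14 := by by_contra! f; nlinarith
  have n3 : 0 < -x12 := by by_contra! f; nlinarith
  have n4 : 0 < -(x01 + x12 - x02) := by by_contra! f; nlinarith
  have n2 : 0 < x01 := by by_contra! f; nlinarith
  exact ⟨n1, n2, n3, n4, u1, u2, u3⟩

theorem doubleCross_triangle (h0 : t0 < 0) (h1 : 0 < t1) (c1 : -t4 - t1 < 0) (v3 : 0 < x24)
    (v2 : 0 < -(x12 + x24 - x14)) (u2 : 0 < -(x01 + x14 - x04)) :
    DoubleCross x01 x02 x04 x12 x14 := by
  obtain ⟨r0, r1, r2, r4, -⟩ := R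
  have n3 : 0 < -x12 := by by_contra! f; nlinarith
  have u3 : 0 < -x14 := by by_contra! f; nlinarith
  have u1 : 0 < x04 := by by_contra! f; nlinarith
  have n1 : 0 < x02 := by by_contra! f; nlinarith
  have n4 : 0 < -(x01 + x12 - x02) := by by_contra! f; nlinarith
  have n2 : 0 < x01 := by by_contra! f; nlinarith
  exact ⟨n1, n2, n3, n4, u1, u2, u3⟩

end same

section opposite

variable (R : ChainRel t0 t1 t2 t4 x01 x02 x04 x12 x14 x24) (h4 : t4 < 0) (h2 : t2 < 0)
include R h4 h2

/-- The same for crossings of opposite sign, where t2 < 0. In the names, neg and pos give the sign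
of w, hence of t2 (t0 - t1 + t2 - t4), and the two letters give the signs of -t1 and t0. -/
theorem doubleCross_negPP (hq : 0 < t0 - t1 + t2 - t4) (c1 : 0 < -t1) (c0 : 0 < t0)
    (n2 : 0 < x01) (u1 : 0 < x04) (u2 : 0 < -(x01 + x14 - x04)) (u3 : 0 < -x14) :
    DoubleCross x01 x02 x04 x12 x14 := by
  obtain ⟨r0, r1, r2, r4, -⟩ := R
  have n1 : 0 < x02 := by by_contra! f; nlinarith
  have n3 : 0 < -x12 := by by_contra! f; nlinarith
  have n4 : 0 < -(x01 + x12 - x02) := by by_contra! f; nlinarith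
  exact ⟨n1, n2, n3, n4, u1, u2, u3⟩

theorem doubleCross_negMM (hq : 0 < t0 - t1 + t2 - t4) (c1 : -t1 < 0) (c0 : t0 < 0)
    (n2 : 0 < x01) (n1 : 0 < x02) (u2 : 0 < -(x01 + x14 - x04)) (n3 : 0 < -x12) :
    DoubleCross x01 x02 x04 x12 x14 := by
  obtain ⟨r0, r1, r2, r4, -⟩ := R
  have u1 : 0 < x04 := by by_contra! f; nlinarith
  have u3 : 0 < -x14 := by by_contra! f; nlinarith
  have n4 : 0 < -(x01 + x12 - x02) := by by_contra! f; nlinarith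
  exact ⟨n1, n2, n3, n4, u1, u2, u3⟩

theorem doubleCross_negMP (hq : 0 < t0 - t1 + t2 - t4) (c1 : -t1 < 0) (c0 : 0 < t0)
    (n2 : 0 < x01) (n1 : 0 < x02) (u2 : 0 < -(x01 + x14 - x04)) (u3 : 0 < -x14) :
    DoubleCross x01 x02 x04 x12 x14 := by
  obtain ⟨r0, r1, r2, r4, -⟩ := R
  have u1 : 0 < x04 := by by_contra! f; nlinarith
  have n3 : 0 < -x12 := by by_contra! f; nlinarith
  have n4 : 0 < -(x01 + x12 - x02) := by by_contra! f; nlinarith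
  exact ⟨n1, n2, n3, n4, u1, u2, u3⟩

theorem doubleCross_negPM (hq : 0 < t0 - t1 + t2 - t4) (c1 : 0 < -t1) (c0 : t0 < 0)
    (n2 : 0 < x01) (u1 : 0 < x04) (u2 : 0 < -(x01 + x14 - x04)) (n3 : 0 < -x12) :
    DoubleCross x01 x02 x04 x12 x14 := by
  obtain ⟨r0, r1, r2, r4, -⟩ := R
  have n1 : 0 < x02 := by by_contra! f; nlinarith
  have u3 : 0 < -x14 := by by_contra! f; nlinarith
  have n4 : 0 < -(x01 + x12 - x02) := by by_contra! f; nlinarith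
  exact ⟨n1, n2, n3, n4, u1, u2, u3⟩

theorem doubleCross_posPP (hq : t0 - t1 + t2 - t4 < 0) (c1 : 0 < -t1) (c0 : 0 < t0)
    (n2 : 0 < x01) (u1 : 0 < x04) (n4 : 0 < -(x01 + x12 - x02)) (u3 : 0 < -x14) :
    DoubleCross x01 x02 x04 x12 x14 := by
  obtain ⟨r0, r1, r2, r4, -⟩ := R
  have n1 : 0 < x02 := by by_contra! f; nlinarith
  have n3 : 0 < -x12 := by by_contra! f; nlinarith
  have u2 : 0 < -(x01 + x14 - x04) := by by_contra! f; nlinarith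
  exact ⟨n1, n2, n3, n4, u1, u2, u3⟩

theorem doubleCross_posMM (hq : t0 - t1 + t2 - t4 < 0) (c1 : -t1 < 0) (c0 : t0 < 0)
    (n2 : 0 < x01) (n1 : 0 < x02) (n4 : 0 < -(x01 + x12 - x02)) (n3 : 0 < -x12) :
    DoubleCross x01 x02 x04 x12 x14 := by
  obtain ⟨r0, r1, r2, r4, -⟩ := R
  have u1 : 0 < x04 := by by_contra! f; nlinarith
  have u3 : 0 < -x14 := by by_contra! f; nlinarith
  have u2 : 0 < -(x01 + x14 - x04) := by by_contra! f; nlinarith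
  exact ⟨n1, n2, n3, n4, u1, u2, u3⟩

theorem doubleCross_posMP (hq : t0 - t1 + t2 - t4 < 0) (c1 : -t1 < 0) (c0 : 0 < t0)
    (n2 : 0 < x01) (n1 : 0 < x02) (n4 : 0 < -(x01 + x12 - x02)) (u3 : 0 < -x14) :
    DoubleCross x01 x02 x04 x12 x14 := by
  obtain ⟨r0, r1, r2, r4, -⟩ := R
  have u1 : 0 < x04 := by by_contra! f; nlinarith
  have n3 : 0 < -x12 := by by_contra! f; nlinarith
  have u2 : 0 < -(x01 + x14 - x04) := by by_contra! f; nlinarith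
  exact ⟨n1, n2, n3, n4, u1, u2, u3⟩

theorem doubleCross_posPM (hq : t0 - t1 + t2 - t4 < 0) (c1 : 0 < -t1) (c0 : t0 < 0)
    (n2 : 0 < x01) (u1 : 0 < x04) (n4 : 0 < -(x01 + x12 - x02)) (n3 : 0 < -x12) :
    DoubleCross x01 x02 x04 x12 x14 := by
  obtain ⟨r0, r1, r2, r4, -⟩ := R
  have n1 : 0 < x02 := by by_contra! f; nlinarith
  have u3 : 0 < -x14 := by by_contra! f; nlinarith
  have u2 : 0 < -(x01 + x14 - x04) := by by_contra! f; nlinarith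
  exact ⟨n1, n2, n3, n4, u1, u2, u3⟩

end opposite

section opposite

variable (R : ChainRel t0 t1 t2 t4 x01 x02 x04 x12 x14 x24) (h4 : t4 < 0)
include R h4

/-- Subtracting `r2` from `r1` gives t4 (x12 + x24 - x14) = t0 (x01 + x12 - x02) - (t0 - t1 + t2 -
t4) x12, whose right side is positive here while t4 < 0. In the rows concerned e2 and e4 cannot
cross, so Q_1 is all of Q_{1,3,4}. -/
theorem DoubleCross.not_cross_of_pos (S : DoubleCross x01 x02 x04 x12 x14)
    (hq : 0 < t0 - t1 + t2 - t4) (c0 : t0 < 0)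
    (v2 : 0 < x12 + x24 - x14) : False := by
  obtain ⟨n1, n2, n3, n4, u1, u2, u3⟩ := S
  obtain ⟨r0, r1, r2, r4, -⟩ := R
  nlinarith

/-- Read off from `r2`, that is t4 x24 = t1 x12 - t0 x02; the next lemma uses it with the sign of
t1, t0 reversed. -/
theorem DoubleCross.not_cross_of_neg (S : DoubleCross x01 x02 x04 x12 x14)
    (c1 : 0 < -t1) (c0 : t0 < 0)
    (v3 : 0 < x24) : False := by
  obtain ⟨n1, n2, n3, n4, u1, u2, u3⟩ := S
  obtain ⟨r0, r1, r2, r4, -⟩ := R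
  nlinarith

theorem DoubleCross.v3_pos (S : DoubleCross x01 x02 x04 x12 x14)
    (c1 : -t1 < 0) (c0 : 0 < t0) : 0 < x24 := by
  obtain ⟨n1, n2, n3, n4, u1, u2, u3⟩ := S
  obtain ⟨r0, r1, r2, r4, -⟩ := R
  by_contra! f
  nlinarith

/-- The identity behind `DoubleCross.not_cross_of_pos`, now with the opposite signs of its
coefficients. -/
theorem DoubleCross.v2_pos (S : DoubleCross x01 x02 x04 x12 x14)
    (hq : t0 - t1 + t2 - t4 < 0) (c0 : 0 < t0) (v3 : 0 < x24) :
    0 < x12 + x24 - x14 := by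
  obtain ⟨n1, n2, n3, n4, u1, u2, u3⟩ := S
  obtain ⟨r0, r1, r2, r4, -⟩ := R
  by_contra! f
  nlinarith

theorem DoubleCross.v_pos (S : DoubleCross x01 x02 x04 x12 x14)
    (hq : t0 - t1 + t2 - t4 < 0) (c1 : -t1 < 0) (c0 : 0 < t0) :
    0 < x12 + x24 - x14 ∧ 0 < x24 := by
  obtain ⟨n1, n2, n3, n4, u1, u2, u3⟩ := S
  obtain ⟨r0, r1, r2, r4, -⟩ := R
  constructor
  · by_contra! f
    nlinarith
  · by_contra! f
    nlinarith

end opposite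

end OpenChain

namespace OpenChain

/-! ## Crossings of two edges -/

theorem triple_apply (a b c : Space) : triple a b c =
    (a 1 * b 2 - a 2 * b 1) * c 0 + (a 2 * b 0 - a 0 * b 2) * c 1
      + (a 0 * b 1 - a 1 * b 0) * c 2 := by
  simp [triple, cross, cross_apply, PiLp.inner_apply, Fin.sum_univ_three]
  ring

theorem triple_smul_right (a b c : Space) (r : ℝ) : triple a b (r • c) = r * triple a b c := by
  simp [triple, inner_smul_right]

/-- The determinant of two edges and a vector joining them. -/
noncomputable def tau {n : ℕ} (p : Fin (n + 1) → Space) (i j : Fin n) : ℝ :=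
  triple (edgeVec p i) (edgeVec p j) (p i.castSucc - p j.castSucc)

/-- The positions of `ξ` relative to the four planes spanned by two segments `ab` and `cd`. -/
noncomputable def side (a b c d ξ : Space) : Fin 4 → ℝ :=
  ![triple (a - c) (a - d) ξ, triple (a - d) (b - d) ξ, triple (b - d) (b - c) ξ,
    triple (b - c) (a - c) ξ]

/-- Each face normal of the tetrahedron abcd kills the part of the chord lying in that face. What
remains is the volume of the tetrahedron times one of the weights t, 1 - s, 1 - t, s. -/
theorem side_of_eq {a b c d ξ : Space} {t s h : ℝ}
    (H : a + t • (b - a) - (c + s • (d - c)) = h • ξ) :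
    h * side a b c d ξ 0 = t * triple (b - a) (d - c) (a - c) ∧
    h * side a b c d ξ 1 = (1 - s) * triple (b - a) (d - c) (a - c) ∧
    h * side a b c d ξ 2 = (1 - t) * triple (b - a) (d - c) (a - c) ∧
    h * side a b c d ξ 3 = s * triple (b - a) (d - c) (a - c) := by
  simp only [side, Matrix.cons_val_zero, Matrix.cons_val_one, Matrix.cons_val, ←
    triple_smul_right, ← H]
  refine ⟨?_, ?_, ?_, ?_⟩ <;> simp [triple_apply] <;> ring

theorem side_add (a b c d ξ : Space) :
    side a b c d ξ 0 + side a b c d ξ 2 = side a b c d ξ 1 + side a b c d ξ 3 := by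
  simp [side, triple_apply]
  ring

/-- Converse of `side_of_eq`: the parameters are recovered as t = side 0 / r and s = side 3 / r,
where r is the common value of the two sums of opposite sides in `side_add`. -/
theorem eq_of_side {a b c d ξ : Space} {r : ℝ}
    (hr : r = side a b c d ξ 0 + side a b c d ξ 2) (h0 : r ≠ 0) :
    a + (side a b c d ξ 0 / r) • (b - a) - (c + (side a b c d ξ 3 / r) • (d - c)) =
      (triple (b - a) (d - c) (a - c) / r) • ξ := by
  have : r • (a + (side a b c d ξ 0 / r) • (b - a) - (c + (side a b c d ξ 3 / r) • (d - c))) =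
      r • ((triple (b - a) (d - c) (a - c) / r) • ξ) := by
    simp only [smul_sub, smul_add, smul_smul, mul_div_cancel₀ _ h0]
    ext k
    rw [hr]
    fin_cases k <;> simp [side, triple_apply] <;> ring
  exact smul_right_injective _ h0 this

variable {n : ℕ} {p : Fin (n + 1) → Space}

theorem Meets.side_eq {ξ : Space} {i j : Fin n} {t s h : ℝ} (H : Meets p ξ i j t s h) :
    h * side (p i.castSucc) (p i.succ) (p j.castSucc) (p j.succ) ξ 0 = t * tau p i j ∧
    h * side (p i.castSucc) (p i.succ) (p j.castSucc) (p j.succ) ξ 1 = (1 - s) * tau p i j ∧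
    h * side (p i.castSucc) (p i.succ) (p j.castSucc) (p j.succ) ξ 2 = (1 - t) * tau p i j ∧
    h * side (p i.castSucc) (p i.succ) (p j.castSucc) (p j.succ) ξ 3 = s * tau p i j :=
  side_of_eq H.2.2

/-- The four sides are τ / h times t, 1 - s, 1 - t, s. They share the sign of τ h exactly when both
parameters lie in the open unit interval, so the common sign also tells which edge is on top. -/
theorem over_iff {ξ : Space} {i j : Fin n} (hτ : tau p i j ≠ 0) :
    Over p ξ i j ↔ ∀ k, 0 < tau p i j *
      side (p i.castSucc) (p i.succ) (p j.castSucc) (p j.succ) ξ k := by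
  constructor
  · rintro ⟨t, s, h, H, hh⟩
    obtain ⟨h0, h1, h2, h3⟩ := H.side_eq
    obtain ⟨⟨ht0, ht1⟩, ⟨hs0, hs1⟩, -⟩ := H
    have hsq : 0 < tau p i j * tau p i j := mul_self_pos.2 hτ
    have key : ∀ x y : ℝ, h * x = y * tau p i j → 0 < y → 0 < tau p i j * x := by
      intro x y hx hy
      have : 0 < h * (tau p i j * x) := by
        have := mul_pos hy hsq
        linear_combination this - tau p i j * hx
      exact pos_of_mul_pos_right this hh.le
    intro k
    fin_cases k
    · exact key _ _ h0 ht0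
    · exact key _ _ h1 (by linarith)
    · exact key _ _ h2 (by linarith)
    · exact key _ _ h3 hs0
  · intro H
    set x := side (p i.castSucc) (p i.succ) (p j.castSucc) (p j.succ) ξ with hx
    have hadd := side_add (p i.castSucc) (p i.succ) (p j.castSucc) (p j.succ) ξ
    rw [← hx] at hadd
    set τ := tau p i j with hτdef
    have hr : 0 < τ * (x 0 + x 2) := by have := H 0; have := H 2; linarith
    have hr0 : x 0 + x 2 ≠ 0 := fun h => by simp [h] at hr
    have hdiv : ∀ y z : ℝ, 0 < τ * y → 0 < τ * z → 0 < τ * (y + z) →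
        y / (y + z) ∈ Ioo (0 : ℝ) 1 := by
      intro y z hy hz hyz
      rcases lt_or_gt_of_ne hτ with h | h
      · have hy : y < 0 := by nlinarith
        have hz : z < 0 := by nlinarith
        have : y + z < 0 := by linarith
        exact ⟨div_pos_of_neg_of_neg hy this, (div_lt_one_of_neg this).2 (by linarith)⟩
      · have hy : 0 < y := pos_of_mul_pos_right hy h.le
        have hz : 0 < z := pos_of_mul_pos_right hz h.le
        exact ⟨by positivity, (div_lt_one (by linarith)).2 (by linarith)⟩
    refine ⟨x 0 / (x 0 + x 2), x 3 / (x 0 + x 2), τ / (x 0 + x 2),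
      ⟨hdiv _ _ (H 0) (H 2) hr, ?_, ?_⟩, ?_⟩
    · rw [hadd, add_comm]
      exact hdiv _ _ (H 3) (H 1) (by rw [add_comm, ← hadd]; exact hr)
    · exact eq_of_side rfl hr0
    · rcases lt_or_gt_of_ne hτ with h | h
      · exact div_pos_of_neg_of_neg h (by nlinarith)
      · exact div_pos h (pos_of_mul_pos_right hr h.le)

theorem mem_Q2_iff {ξ : Dir} {i j : Fin n} : ξ ∈ Q2 p i j ↔ Over p (ξ : Space) i j := Iff.rfl

theorem Meets.neg {ξ : Space} {i j : Fin n} {t s h : ℝ} (H : Meets p ξ i j t s h) :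
    Meets p (-ξ) i j t s (-h) :=
  ⟨H.1, H.2.1, by rw [H.2.2]; simp⟩

theorem Meets.symm {ξ : Space} {i j : Fin n} {t s h : ℝ} (H : Meets p ξ i j t s h) :
    Meets p ξ j i s t (-h) :=
  ⟨H.2.1, H.1, by rw [neg_smul, ← H.2.2]; abel⟩

theorem Meets.h_ne_zero {ξ : Space} {i j : Fin n} {t s h : ℝ} (hτ : tau p i j ≠ 0)
    (H : Meets p ξ i j t s h) : h ≠ 0 := by
  rintro rfl
  have := H.side_eq.1
  rw [zero_mul] at this
  exact mul_ne_zero H.1.1.ne' hτ this.symm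

theorem over_neg {ξ : Space} {i j : Fin n} : Over p (-ξ) i j ↔ Over p ξ j i := by
  constructor
  · rintro ⟨t, s, h, H, hh⟩
    have := H.neg.symm
    simp only [neg_neg] at this
    exact ⟨_, _, _, this, hh⟩
  · rintro ⟨t, s, h, H, hh⟩
    have := H.neg.symm
    simp only [neg_neg] at this
    exact ⟨_, _, _, this, hh⟩

theorem neg_Q2 (i j : Fin n) : -Q2 p i j = Q2 p j i := by
  ext ξ
  exact over_neg

theorem tau_symm (i j : Fin n) : tau p j i = tau p i j := by
  simp [tau, triple_apply]
  ring

theorem exists_meets_iff {ξ : Space} {i j : Fin n} (hτ : tau p i j ≠ 0) :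
    (∃ t s h, Meets p ξ i j t s h) ↔ Over p ξ i j ∨ Over p ξ j i := by
  constructor
  · rintro ⟨t, s, h, H⟩
    rcases lt_or_gt_of_ne (H.h_ne_zero hτ) with hh | hh
    · exact Or.inr ⟨_, _, _, H.symm, neg_pos.2 hh⟩
    · exact Or.inl ⟨_, _, _, H, hh⟩
  · rintro (⟨t, s, h, H, -⟩ | ⟨t, s, h, H, -⟩)
    · exact ⟨_, _, _, H⟩
    · exact ⟨_, _, _, H.symm⟩

theorem over_symm_iff {ξ : Space} {i j : Fin n} (hτ : tau p i j ≠ 0) :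
    Over p ξ j i ↔ ∀ k, tau p i j *
      side (p i.castSucc) (p i.succ) (p j.castSucc) (p j.succ) ξ k < 0 := by
  rw [← over_neg, over_iff hτ]
  have : ∀ k, side (p i.castSucc) (p i.succ) (p j.castSucc) (p j.succ) (-ξ) k =
      -side (p i.castSucc) (p i.succ) (p j.castSucc) (p j.succ) ξ k := by
    intro k
    fin_cases k <;> simp [side, triple]
  simp only [this, mul_neg, neg_pos]

theorem Over.not_over {ξ : Space} {i j : Fin n} (hτ : tau p i j ≠ 0) (h : Over p ξ i j) :
    ¬ Over p ξ j i := by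
  rw [over_iff hτ] at h
  rw [over_symm_iff hτ]
  exact fun h' => lt_asymm (h 0) (h' 0)

theorem Meets.param_eq {ξ : Space} {i j : Fin n} {t s h : ℝ} (hτ : tau p i j ≠ 0)
    (H : Meets p ξ i j t s h) :
    t * (side (p i.castSucc) (p i.succ) (p j.castSucc) (p j.succ) ξ 0 +
      side (p i.castSucc) (p i.succ) (p j.castSucc) (p j.succ) ξ 2) =
      side (p i.castSucc) (p i.succ) (p j.castSucc) (p j.succ) ξ 0 := by
  obtain ⟨h0, -, h2, -⟩ := H.side_eq
  have hh := H.h_ne_zero hτ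
  apply mul_left_cancel₀ hh
  linear_combination (t - 1) * h0 + t * h2

theorem crossParam_spec {ξ : Space} {i j : Fin n} (H : ∃ t s h, Meets p ξ i j t s h) :
    ∃ s h, Meets p ξ i j (crossParam p ξ i j) s h := by
  rw [crossParam, dif_pos H]
  exact H.choose_spec

/-- The sign of a crossing does not depend on the direction of projection. -/
theorem passage_eq {ξ : Space} {i j : Fin n} (hτ : tau p i j ≠ 0)
    (H : ∃ t s h, Meets p ξ i j t s h) : passage p ξ i j =
      ⟨Nat.pair (min (i : ℕ) j) (max (i : ℕ) j), open Classical in decide (Over p ξ i j),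
        open Classical in decide (0 < tau p i j)⟩ := by
  have key : ∀ {i j : Fin n}, Over p ξ i j →
      (0 < triple (edgeVec p i) (edgeVec p j) ξ ↔ 0 < tau p i j) := by
    rintro i j ⟨t, s, h, H, hh⟩
    -- The chord h ξ differs from the one defining τ by a combination of the two edge vectors, which
    -- does not affect the triple product.
    have : h * triple (edgeVec p i) (edgeVec p j) ξ = tau p i j := by
      rw [← triple_smul_right, ← H.2.2]
      simp [triple_apply, edge, edgeVec, tau]
      ring
    rw [← this]
    exact ⟨fun h' => mul_pos hh h', fun h' => pos_of_mul_pos_right h' hh.le⟩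
  ext1
  · rfl
  · simp [passage]
  · simp only [passage, decide_eq_decide]
    split_ifs with ho
    · exact key ho
    · rw [exists_meets_iff hτ] at H
      rw [key (H.resolve_left ho), tau_symm]

end OpenChain

namespace OpenChain

/-! ## The Gauss word of a projection -/

section sort

variable {n : ℕ} {p : Fin (n + 1) → Space} {ξ : Dir}

/-- The position of a passage along the chain. -/
noncomputable def passageKey (p : Fin (n + 1) → Space) (ξ : Space) (q : Fin n × Fin n) : ℝ :=
  (q.1 : ℕ) + crossParam p ξ q.1 q.2

/-- Strictly increasing positions make the sorted arrangement unique, so any list with the right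
members in the right order gives the Gauss word, and the arbitrary order of `Finset.toList` drops
out. -/
theorem gaussWord_eq_map (l : List (Fin n × Fin n))
    (hl : ∀ i j, (i, j) ∈ l ↔ Cross p (ξ : Space) i j)
    (hs : l.Pairwise fun q r => passageKey p ξ q < passageKey p ξ r) :
    gaussWord p ξ = l.map fun q => passage p (ξ : Space) q.1 q.2 := by
  classical
  unfold gaussWord
  congr 1
  set F := Finset.univ.filter fun q : Fin n × Fin n => Cross p (ξ : Space) q.1 q.2 with hF
  have hnd : l.Nodup := hs.imp fun h => by rintro rfl; exact lt_irrefl _ h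
  have hperm : F.toList.Perm l := by
    refine (List.perm_ext_iff_of_nodup F.nodup_toList hnd).2 fun q => ?_
    rw [Finset.mem_toList, hF, Finset.mem_filter]
    simpa using (hl q.1 q.2).symm
  refine List.Perm.eq_of_pairwise (le := fun q r => passageKey p ξ q ≤ passageKey p ξ r) ?_ ?_
    (hs.imp fun h => h.le) ((List.mergeSort_perm _ _).trans hperm)
  · intro q r hq hr h1 h2
    have hq' : q ∈ l := ((List.mergeSort_perm _ _).trans hperm).mem_iff.1 hq
    exact (List.Pairwise.forall_of_forall_of_flip
      (R := fun q r => passageKey p ξ q = passageKey p ξ r → q = r) (fun _ _ _ => rfl)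
      (hs.imp fun h h' => absurd h' h.ne) (hs.imp fun h h' => absurd h'.symm h.ne)
      hq' hr (le_antisymm h1 h2))
  · have := List.pairwise_mergeSort (le := fun q r : Fin n × Fin n => decide
      ((q.1 : ℕ) + crossParam p (ξ : Space) q.1 q.2 ≤
        (r.1 : ℕ) + crossParam p (ξ : Space) r.1 r.2))
      (by simp only [decide_eq_true_eq]; exact fun _ _ _ => le_trans)
      (by simp only [Bool.or_eq_true, decide_eq_true_eq]; exact fun _ _ => le_total _ _) F.toList
    exact this.imp fun h => by simpa [passageKey] using h

/-- A chord between two edges with a common vertex lies in their plane, and ξ does not. Hence a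
meeting would be a genuine intersection, which is impossible away from the common vertex. -/
theorem not_cross_of_edgeVec {i j : Fin n} (hij : (j : ℕ) = i + 1) {ξ : Space}
    (h : triple (edgeVec p i) (edgeVec p j) ξ ≠ 0) :
    ¬ Cross p ξ i j ∧ ¬ Cross p ξ j i := by
  have hv : p i.succ = p j.castSucc := by
    congr 1
    exact Fin.ext hij.symm
  have key : ¬ ∃ t s r, Meets p ξ i j t s r := by
    rintro ⟨t, s, r, ht, hs, H⟩
    have e0 : r = 0 := by
      have : r * triple (edgeVec p i) (edgeVec p j) ξ = 0 := by
        rw [← triple_smul_right, ← H]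
        simp only [edge, edgeVec, hv]
        simp [triple_apply]
        ring
      exact (mul_eq_zero.1 this).resolve_right h
    rw [e0, zero_smul] at H
    apply h
    have h0 : s • edgeVec p j = -((1 - t) • edgeVec p i) := by
      rw [eq_neg_iff_add_eq_zero, ← neg_eq_zero, ← H]
      simp only [edge, edgeVec, hv]
      module
    have h1 : s * triple (edgeVec p i) (edgeVec p j) ξ = 0 := by
      have : s * triple (edgeVec p i) (edgeVec p j) ξ =
          triple (edgeVec p i) (s • edgeVec p j) ξ := by simp [triple_apply]; ring
      rw [this, h0]
      simp [triple_apply]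
      ring
    exact (mul_eq_zero.1 h1).resolve_left hs.1.ne'
  exact ⟨fun h => key h.2, fun h => by
    obtain ⟨-, t, s, r, H⟩ := h
    exact key ⟨_, _, _, H.symm⟩⟩

theorem cross_iff {i j : Fin n} {ξ : Space} (hij : i ≠ j) (hτ : tau p i j ≠ 0) :
    Cross p ξ i j ↔ Over p ξ i j ∨ Over p ξ j i := by
  rw [Cross, exists_meets_iff hτ]
  exact and_iff_right hij

theorem passageKey_mem {i j : Fin n} {ξ : Space} (H : Cross p ξ i j) :
    passageKey p ξ (i, j) ∈ Ioo ((i : ℕ) : ℝ) ((i : ℕ) + 1) := by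
  obtain ⟨s, h, H⟩ := crossParam_spec H.2
  have := H.1
  simp only [passageKey, mem_Ioo] at this ⊢
  constructor <;> linarith [this.1, this.2]

end sort

end OpenChain

namespace OpenChain

/-! ## Chains with four edges -/

/-- No two non-adjacent edges are coplanar. -/
structure NonCoplanar (p : Fin 5 → Space) : Prop where
  t02 : tau p 0 2 ≠ 0
  t03 : tau p 0 3 ≠ 0
  t13 : tau p 1 3 ≠ 0

/-- The orientation of the projection of a triangle. -/
noncomputable def orient (p : Fin 5 → Space) (ξ : Space) (i j k : Fin 5) : ℝ :=
  triple (p j - p i) (p k - p i) ξ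

/-- The direction is not parallel to a relevant plane through three vertices. -/
structure Generic (p : Fin 5 → Space) (ξ : Space) : Prop where
  o012 : orient p ξ 0 1 2 ≠ 0
  o123 : orient p ξ 1 2 3 ≠ 0
  o324 : orient p ξ 3 2 4 ≠ 0
  o134 : orient p ξ 1 3 4 ≠ 0
  o013 : orient p ξ 0 1 3 ≠ 0
  o124 : orient p ξ 1 2 4 ≠ 0
  o023 : orient p ξ 0 2 3 ≠ 0

/-- The edges with numbers `i` and `j` have crossing projections. -/
def Crosses (p : Fin 5 → Space) (ξ : Space) (i j : Fin 4) : Prop := Over p ξ i j ∨ Over p ξ j i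

open Classical in
/-- The sign of `tau`. -/
noncomputable def tauSign (p : Fin 5 → Space) (i j : Fin 4) : Bool := decide (0 < tau p i j)

/-- The product whose sign decides in which order the first edge crosses the last two. -/
noncomputable def orderForm (p : Fin 5 → Space) (ξ : Space) : ℝ :=
  orient p ξ 0 1 3 * orient p ξ 3 2 4

/-- The projection is a diagram of `k2.1` in which the first edge crosses the last two. -/
def FirstK21 (p : Fin 5 → Space) (ξ : Space) : Prop :=
  Crosses p ξ 0 2 ∧ Crosses p ξ 0 3 ∧ ¬ Crosses p ξ 1 3 ∧ tauSign p 0 2 = tauSign p 0 3 ∧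
    0 < orderForm p ξ

/-- The triple products of the vectors from the vertex `3`. -/
noncomputable def wedge (p : Fin 5 → Space) (ξ : Space) (i j : Fin 5) : ℝ :=
  triple (p i - p 3) (p j - p 3) ξ

/-- The determinants of the vectors from the vertex `3`. -/
noncomputable def vol (p : Fin 5 → Space) (i j k : Fin 5) : ℝ :=
  triple (p i - p 3) (p j - p 3) (p k - p 3)

/-- The linear relations arise by crossing the dependence of four vectors in 3-space with each of
them and pairing with ξ. The last one is the Plücker relation of the four projected vectors. -/
theorem chainRel (p : Fin 5 → Space) (ξ : Space) :
    ChainRel (vol p 1 2 4) (vol p 0 2 4) (vol p 0 1 4) (vol p 0 1 2) (wedge p ξ 0 1)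
      (wedge p ξ 0 2) (wedge p ξ 0 4) (wedge p ξ 1 2) (wedge p ξ 1 4) (wedge p ξ 2 4) := by
  constructor <;> simp [vol, wedge, triple_apply] <;> ring

section

variable (p : Fin 5 → Space) (ξ : Space)

theorem tau_eq : tau p 0 2 = -vol p 0 1 2 ∧ tau p 0 3 = vol p 0 1 4 ∧ tau p 1 3 = vol p 1 2 4 := by
  refine ⟨?_, ?_, ?_⟩ <;> simp [tau, vol, edgeVec, triple_apply] <;> ring

theorem orient_eq :
    orient p ξ 0 1 2 = wedge p ξ 0 1 + wedge p ξ 1 2 - wedge p ξ 0 2 ∧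
    orient p ξ 0 1 4 = wedge p ξ 0 1 + wedge p ξ 1 4 - wedge p ξ 0 4 ∧
    orient p ξ 1 2 4 = wedge p ξ 1 2 + wedge p ξ 2 4 - wedge p ξ 1 4 ∧
    orient p ξ 0 1 3 = wedge p ξ 0 1 ∧ orient p ξ 0 2 3 = wedge p ξ 0 2 ∧
    orient p ξ 1 2 3 = wedge p ξ 1 2 ∧ orient p ξ 0 3 4 = -wedge p ξ 0 4 ∧
    orient p ξ 1 3 4 = -wedge p ξ 1 4 ∧ orient p ξ 3 2 4 = wedge p ξ 2 4 := by
  refine ⟨?_, ?_, ?_, ?_, ?_, ?_, ?_, ?_, ?_⟩ <;> simp [orient, wedge, triple_apply] <;> ring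

theorem side_eq₀₂ : side (p 0) (p 1) (p 2) (p 3) ξ =
    ![wedge p ξ 0 2, wedge p ξ 0 1, -wedge p ξ 1 2,
      -(wedge p ξ 0 1 + wedge p ξ 1 2 - wedge p ξ 0 2)] := by
  ext k
  fin_cases k <;> simp [side, wedge, triple_apply] <;> ring

theorem side_eq₀₃ : side (p 0) (p 1) (p 3) (p 4) ξ =
    ![-wedge p ξ 0 4, wedge p ξ 0 1 + wedge p ξ 1 4 - wedge p ξ 0 4, wedge p ξ 1 4,
      -wedge p ξ 0 1] := by
  ext k
  fin_cases k <;> simp [side, wedge, triple_apply] <;> ring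

theorem side_eq₁₃ : side (p 1) (p 2) (p 3) (p 4) ξ =
    ![-wedge p ξ 1 4, wedge p ξ 1 2 + wedge p ξ 2 4 - wedge p ξ 1 4, wedge p ξ 2 4,
      -wedge p ξ 1 2] := by
  ext k
  fin_cases k <;> simp [side, wedge, triple_apply] <;> ring

end

/-- All components have the same sign. -/
def SameSign (f : Fin 4 → ℝ) : Prop := (∀ k, 0 < f k) ∨ ∀ k, f k < 0

theorem over_iff_of_pos {n : ℕ} {p : Fin (n + 1) → Space} {ξ : Space} {i j : Fin n}
    (hτ : 0 < tau p i j) : Over p ξ i j ↔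
      ∀ k, 0 < side (p i.castSucc) (p i.succ) (p j.castSucc) (p j.succ) ξ k := by
  rw [over_iff hτ.ne']
  simp only [mul_pos_iff_of_pos_left hτ]

theorem over_iff_of_neg {n : ℕ} {p : Fin (n + 1) → Space} {ξ : Space} {i j : Fin n}
    (hτ : tau p i j < 0) : Over p ξ i j ↔
      ∀ k, side (p i.castSucc) (p i.succ) (p j.castSucc) (p j.succ) ξ k < 0 := by
  rw [over_iff hτ.ne]
  simp only [mul_pos_iff, hτ, not_lt_of_gt hτ, true_and, false_and, false_or]

theorem over_symm_iff_of_pos {n : ℕ} {p : Fin (n + 1) → Space} {ξ : Space} {i j : Fin n}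
    (hτ : 0 < tau p i j) : Over p ξ j i ↔
      ∀ k, side (p i.castSucc) (p i.succ) (p j.castSucc) (p j.succ) ξ k < 0 := by
  rw [over_symm_iff hτ.ne']
  simp only [mul_neg_iff, hτ, not_lt_of_gt hτ, true_and, false_and, or_false]

theorem over_symm_iff_of_neg {n : ℕ} {p : Fin (n + 1) → Space} {ξ : Space} {i j : Fin n}
    (hτ : tau p i j < 0) : Over p ξ j i ↔
      ∀ k, 0 < side (p i.castSucc) (p i.succ) (p j.castSucc) (p j.succ) ξ k := by
  rw [over_symm_iff hτ.ne]
  simp only [mul_neg_iff, hτ, not_lt_of_gt hτ, true_and, false_and, false_or]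

theorem over_or_over_iff {n : ℕ} {p : Fin (n + 1) → Space} {ξ : Space} {i j : Fin n}
    (hτ : tau p i j ≠ 0) : Over p ξ i j ∨ Over p ξ j i ↔
      SameSign (side (p i.castSucc) (p i.succ) (p j.castSucc) (p j.succ) ξ) := by
  rcases lt_or_gt_of_ne hτ with h | h
  · rw [over_iff_of_neg h, over_symm_iff_of_neg h, SameSign, or_comm]
  · rw [over_iff_of_pos h, over_symm_iff_of_pos h, SameSign]

section

variable {p : Fin 5 → Space} {ξ : Space}

theorem crosses₀₂_iff (hp : NonCoplanar p) :
    Crosses p ξ 0 2 ↔ SameSign (side (p 0) (p 1) (p 2) (p 3) ξ) := over_or_over_iff hp.t02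

theorem crosses₀₃_iff (hp : NonCoplanar p) :
    Crosses p ξ 0 3 ↔ SameSign (side (p 0) (p 1) (p 3) (p 4) ξ) := over_or_over_iff hp.t03

theorem crosses₁₃_iff (hp : NonCoplanar p) :
    Crosses p ξ 1 3 ↔ SameSign (side (p 1) (p 2) (p 3) (p 4) ξ) := over_or_over_iff hp.t13

/-- The signs of the projection, up to the factor `s`, when the first edge crosses the third
and the fourth one. -/
def ChainDoubleCross (p : Fin 5 → Space) (ξ : Space) (s : ℝ) : Prop :=
  DoubleCross (s * wedge p ξ 0 1) (s * wedge p ξ 0 2) (s * wedge p ξ 0 4) (s * wedge p ξ 1 2)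
    (s * wedge p ξ 1 4)

theorem chainDoubleCross_one : ChainDoubleCross p ξ 1 ↔
    (∀ k, 0 < side (p 0) (p 1) (p 2) (p 3) ξ k) ∧ ∀ k, side (p 0) (p 1) (p 3) (p 4) ξ k < 0 := by
  rw [side_eq₀₂, side_eq₀₃]
  simp only [Fin.forall_fin_succ, ChainDoubleCross]
  simp
  constructor
  · rintro ⟨n1, n2, n3, n4, u1, u2, u3⟩
    refine ⟨⟨?_, ?_, ?_, ?_⟩, ?_, ?_, ?_, ?_⟩ <;> linarith
  · rintro ⟨⟨h1, h2, h3, h4⟩, h5, h6, h7, h8⟩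
    constructor <;> linarith

theorem chainDoubleCross_neg_one : ChainDoubleCross p ξ (-1) ↔
    (∀ k, side (p 0) (p 1) (p 2) (p 3) ξ k < 0) ∧ ∀ k, 0 < side (p 0) (p 1) (p 3) (p 4) ξ k := by
  rw [side_eq₀₂, side_eq₀₃]
  simp only [Fin.forall_fin_succ, ChainDoubleCross]
  simp
  constructor
  · rintro ⟨n1, n2, n3, n4, u1, u2, u3⟩
    refine ⟨⟨?_, ?_, ?_, ?_⟩, ?_, ?_, ?_, ?_⟩ <;> linarith
  · rintro ⟨⟨h1, h2, h3, h4⟩, h5, h6, h7, h8⟩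
    constructor <;> linarith

/-- The two quadrilaterals share a face: the product `wedge p ξ 0 1` is a side of T_{1,3} and minus
it is a side of T_{1,4}. So a double crossing always has opposite sign patterns, as in
`DoubleCross`. -/
theorem not_both_pos : ¬ ((∀ k, 0 < side (p 0) (p 1) (p 2) (p 3) ξ k) ∧
    ∀ k, 0 < side (p 0) (p 1) (p 3) (p 4) ξ k) := by
  rintro ⟨h1, h2⟩
  have h1 := h1 1
  have h2 := h2 3
  rw [side_eq₀₂] at h1
  rw [side_eq₀₃] at h2
  simp at h1 h2
  linarith

theorem not_both_neg : ¬ ((∀ k, side (p 0) (p 1) (p 2) (p 3) ξ k < 0) ∧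
    ∀ k, side (p 0) (p 1) (p 3) (p 4) ξ k < 0) := by
  rintro ⟨h1, h2⟩
  have h1 := h1 1
  have h2 := h2 3
  rw [side_eq₀₂] at h1
  rw [side_eq₀₃] at h2
  simp at h1 h2
  linarith

theorem crosses_and_crosses_iff (hp : NonCoplanar p) :
    Crosses p ξ 0 2 ∧ Crosses p ξ 0 3 ↔ ChainDoubleCross p ξ 1 ∨ ChainDoubleCross p ξ (-1) := by
  have h1 := not_both_pos (p := p) (ξ := ξ)
  have h2 := not_both_neg (p := p) (ξ := ξ)
  rw [crosses₀₂_iff hp, crosses₀₃_iff hp, chainDoubleCross_one, chainDoubleCross_neg_one,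
    SameSign, SameSign]
  tauto

/-- Given a double crossing, the second and the fourth edge cross according to two signs. -/
theorem ChainDoubleCross.crosses_iff (hp : NonCoplanar p) {s : ℝ} (hs : s = 1 ∨ s = -1)
    (h : ChainDoubleCross p ξ s) : Crosses p ξ 1 3 ↔
      0 < s * wedge p ξ 1 2 + s * wedge p ξ 2 4 - s * wedge p ξ 1 4 ∧ 0 < s * wedge p ξ 2 4 := by
  obtain ⟨n1, n2, n3, n4, u1, u2, u3⟩ := h
  rw [crosses₁₃_iff hp, SameSign, side_eq₁₃]
  simp only [Fin.forall_fin_succ]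
  simp
  -- The other two sides of T_{2,4} are -x14 and -x12, whose signs are known from the double
  -- crossing; they select one of the two sign patterns and are then automatic.
  rcases hs with rfl | rfl
  · simp only [one_mul] at *
    constructor
    · rintro (⟨h1, h2, h3, h4⟩ | ⟨h1, h2, h3, h4⟩)
      · constructor <;> linarith
      · linarith
    · rintro ⟨h1, h2⟩
      left
      refine ⟨?_, ?_, ?_, ?_⟩ <;> linarith
  · simp only [neg_mul, one_mul] at *
    constructor
    · rintro (⟨h1, h2, h3, h4⟩ | ⟨h1, h2, h3, h4⟩)
      · linarith
      · constructor <;> linarith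
    · rintro ⟨h1, h2⟩
      right
      refine ⟨?_, ?_, ?_, ?_⟩ <;> linarith

/-- T_{1,3} and T_{2,4} share the side -x12, so their sign patterns agree and the planar lemma
`ChainRel.doubleCross` applies after normalizing by s. -/
theorem crosses_both_of_outer (hp : NonCoplanar p) (h1 : Crosses p ξ 0 2)
    (h2 : Crosses p ξ 1 3) : ∃ s : ℝ, (s = 1 ∨ s = -1) ∧ ChainDoubleCross p ξ s ∧
      0 < s * wedge p ξ 2 4 := by
  rw [crosses₀₂_iff hp, SameSign, side_eq₀₂] at h1
  rw [crosses₁₃_iff hp, SameSign, side_eq₁₃] at h2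
  simp only [Fin.forall_fin_succ] at h1 h2
  simp at h1 h2
  have R := (chainRel p ξ)
  rcases h1 with ⟨a1, a2, a3, a4⟩ | ⟨a1, a2, a3, a4⟩ <;>
    rcases h2 with ⟨b1, b2, b3, b4⟩ | ⟨b1, b2, b3, b4⟩
  · refine ⟨1, Or.inl rfl, (R.scale 1 1).doubleCross ?_ ?_ ?_ ?_ ?_ ?_ ?_, ?_⟩ <;> linarith
  · linarith
  · linarith
  · refine ⟨-1, Or.inr rfl, (R.scale 1 (-1)).doubleCross ?_ ?_ ?_ ?_ ?_ ?_ ?_, ?_⟩ <;> linarith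

theorem crosses_middle (hp : NonCoplanar p) (h1 : Crosses p ξ 0 2)
    (h2 : Crosses p ξ 1 3) : Crosses p ξ 0 3 := by
  obtain ⟨s, hs, h, -⟩ := crosses_both_of_outer hp h1 h2
  refine ((crosses_and_crosses_iff hp).2 ?_).2
  rcases hs with rfl | rfl
  · exact Or.inl h
  · exact Or.inr h

theorem orderForm_eq : orderForm p ξ = wedge p ξ 0 1 * wedge p ξ 2 4 := by
  obtain ⟨-, -, -, h, -, -, -, -, h'⟩ := orient_eq p ξ
  rw [orderForm, h, h']

end

end OpenChain

namespace OpenChain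

/-! ## Reversal of the orientation -/

section rev

variable {n : ℕ} {p : Fin (n + 1) → Space}

theorem edge_rev (i : Fin n) (t : ℝ) : edge (rev p) i t = edge p i.rev (1 - t) := by
  simp only [edge, rev, Fin.rev_castSucc, Fin.rev_succ]
  module

theorem Meets.rev {ξ : Space} {i j : Fin n} {t s h : ℝ} (H : Meets p ξ i j t s h) :
    Meets (rev p) ξ i.rev j.rev (1 - t) (1 - s) h := by
  obtain ⟨⟨h1, h2⟩, ⟨h3, h4⟩, H⟩ := H
  refine ⟨⟨by linarith, by linarith⟩, ⟨by linarith, by linarith⟩, ?_⟩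
  rw [edge_rev, edge_rev]
  simpa using H

theorem rev_rev : rev (rev p) = p := by
  funext k
  simp [rev]

theorem over_rev {ξ : Space} {i j : Fin n} : Over (rev p) ξ i j ↔ Over p ξ i.rev j.rev := by
  constructor
  · rintro ⟨t, s, h, H, hh⟩
    have := H.rev
    rw [rev_rev] at this
    exact ⟨_, _, _, this, hh⟩
  · rintro ⟨t, s, h, H, hh⟩
    have := H.rev
    rw [Fin.rev_rev, Fin.rev_rev] at this
    exact ⟨_, _, _, this, hh⟩

theorem Q2_rev (i j : Fin n) : Q2 (rev p) i j = Q2 p i.rev j.rev := by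
  ext ξ
  exact over_rev

theorem tau_rev (i j : Fin n) : tau (rev p) i j = tau p i.rev j.rev := by
  simp only [tau, edgeVec, rev, Fin.rev_castSucc, Fin.rev_succ, triple_apply, PiLp.sub_apply]
  ring

end rev

section

variable {p : Fin 5 → Space} {ξ : Space}

theorem tau_rev_eq : tau (rev p) 0 2 = tau p 1 3 ∧ tau (rev p) 0 3 = tau p 0 3 ∧
    tau (rev p) 1 3 = tau p 0 2 := by
  simp only [tau_rev]
  exact ⟨tau_symm _ _, tau_symm _ _, tau_symm _ _⟩

theorem tauSign_rev_eq : tauSign (rev p) 0 2 = tauSign p 1 3 ∧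
    tauSign (rev p) 0 3 = tauSign p 0 3 ∧ tauSign (rev p) 1 3 = tauSign p 0 2 := by
  simp only [tauSign, tau_rev_eq, and_self]

theorem crosses_rev_eq : (Crosses (rev p) ξ 0 2 ↔ Crosses p ξ 1 3) ∧
    (Crosses (rev p) ξ 0 3 ↔ Crosses p ξ 0 3) ∧ (Crosses (rev p) ξ 1 3 ↔ Crosses p ξ 0 2) := by
  simp only [Crosses, over_rev]
  exact ⟨Or.comm, Or.comm, Or.comm⟩

theorem NonCoplanar.rev (hp : NonCoplanar p) : NonCoplanar (rev p) := by
  obtain ⟨h1, h2, h3⟩ := tau_rev_eq (p := p)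
  exact ⟨by rw [h1]; exact hp.t13, by rw [h2]; exact hp.t03, by rw [h3]; exact hp.t02⟩

theorem orient_perm (i j k : Fin 5) : orient p ξ k j i = -orient p ξ i j k ∧
    orient p ξ j i k = -orient p ξ i j k ∧ orient p ξ j k i = orient p ξ i j k := by
  refine ⟨?_, ?_, ?_⟩ <;> simp [orient, triple_apply] <;> ring

theorem Generic.rev (hg : Generic p ξ) : Generic (rev p) ξ where
  o012 := by
    change orient p ξ 4 3 2 ≠ 0
    rw [(orient_perm 2 3 4).1, (orient_perm 3 2 4).2.1, neg_neg]
    exact hg.o324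
  o123 := by
    change orient p ξ 3 2 1 ≠ 0
    rw [(orient_perm 1 2 3).1]
    exact neg_ne_zero.2 hg.o123
  o324 := by
    change orient p ξ 1 2 0 ≠ 0
    rw [(orient_perm 0 1 2).2.2]
    exact hg.o012
  o134 := by
    change orient p ξ 3 1 0 ≠ 0
    rw [(orient_perm 0 1 3).1]
    exact neg_ne_zero.2 hg.o013
  o013 := by
    change orient p ξ 4 3 1 ≠ 0
    rw [(orient_perm 1 3 4).1]
    exact neg_ne_zero.2 hg.o134
  o124 := by
    change orient p ξ 3 2 0 ≠ 0
    rw [(orient_perm 0 2 3).1]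
    exact neg_ne_zero.2 hg.o023
  o023 := by
    change orient p ξ 4 2 1 ≠ 0
    rw [(orient_perm 1 2 4).1]
    exact neg_ne_zero.2 hg.o124

theorem orderForm_rev : orderForm (rev p) ξ = -(orient p ξ 1 3 4 * orient p ξ 0 1 2) := by
  change orient p ξ 4 3 1 * orient p ξ 1 2 0 = _
  rw [(orient_perm 1 3 4).1, (orient_perm 0 1 2).2.2]
  ring

/-! ## The order of the crossings on an edge -/

/-- The parameters are x02 / (x02 - x12) and x04 / (x04 - x14). Their difference has numerator x02
x14 - x04 x12, which is x01 x24 by the Plücker relation, and the product of the denominators is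
positive. -/
theorem param_order₀ (hp : NonCoplanar p) (hA : Crosses p ξ 0 2)
    (hB : Crosses p ξ 0 3) :
    (0 < orderForm p ξ → crossParam p ξ 0 2 < crossParam p ξ 0 3) ∧
    (orderForm p ξ < 0 → crossParam p ξ 0 3 < crossParam p ξ 0 2) := by
  obtain ⟨_, _, H⟩ := crossParam_spec ((exists_meets_iff hp.t02).2 hA)
  obtain ⟨_, _, H'⟩ := crossParam_spec ((exists_meets_iff hp.t03).2 hB)
  have e := H.param_eq hp.t02
  have e' := H'.param_eq hp.t03
  change _ * (side (p 0) (p 1) (p 2) (p 3) ξ 0 + side (p 0) (p 1) (p 2) (p 3) ξ 2) =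
    side (p 0) (p 1) (p 2) (p 3) ξ 0 at e
  change _ * (side (p 0) (p 1) (p 3) (p 4) ξ 0 + side (p 0) (p 1) (p 3) (p 4) ξ 2) =
    side (p 0) (p 1) (p 3) (p 4) ξ 0 at e'
  rw [side_eq₀₂] at e
  rw [side_eq₀₃] at e'
  simp only [Matrix.cons_val_zero, Matrix.cons_val] at e e'
  set t := crossParam p ξ 0 2
  set t' := crossParam p ξ 0 3
  have hpos : 0 < (wedge p ξ 0 2 - wedge p ξ 1 2) * (wedge p ξ 0 4 - wedge p ξ 1 4) := by
    rcases (crosses_and_crosses_iff hp).1 ⟨hA, hB⟩ with h | h <;>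
      obtain ⟨n1, n2, n3, n4, u1, u2, u3⟩ := h
    · exact mul_pos (by linarith) (by linarith)
    · exact mul_pos_of_neg_of_neg (by linarith) (by linarith)
  have key : (t' - t) * ((wedge p ξ 0 2 - wedge p ξ 1 2) * (wedge p ξ 0 4 - wedge p ξ 1 4)) =
      orderForm p ξ := by
    have hpl := (chainRel p ξ).plucker
    rw [orderForm_eq]
    linear_combination -(wedge p ξ 0 2 - wedge p ξ 1 2) * e' -
      (wedge p ξ 0 4 - wedge p ξ 1 4) * e - hpl
  rw [← key]
  constructor
  · intro h
    linarith [pos_of_mul_pos_left h hpos.le]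
  · intro h
    linarith [neg_of_mul_neg_left h hpos.le]

/-- `crossParam` is a choice, but `Meets.param_eq` determines its value, so the chosen parameter of
the reversed chain must be the reflected one. -/
theorem crossParam_rev {n : ℕ} {p : Fin (n + 1) → Space} {i j : Fin n} (hτ : tau p i j ≠ 0)
    (H : Over p ξ i j ∨ Over p ξ j i) :
    crossParam (rev p) ξ i.rev j.rev = 1 - crossParam p ξ i j := by
  obtain ⟨_, _, H1⟩ := crossParam_spec ((exists_meets_iff hτ).2 H)
  have hτ' : tau (OpenChain.rev p) i.rev j.rev ≠ 0 := by
    rw [tau_rev, Fin.rev_rev, Fin.rev_rev]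
    exact hτ
  obtain ⟨_, _, H2⟩ := crossParam_spec ⟨_, _, _, H1.rev⟩
  have e1 := H1.rev.param_eq hτ'
  have e2 := H2.param_eq hτ'
  have hne : side (OpenChain.rev p i.rev.castSucc) (OpenChain.rev p i.rev.succ)
      (OpenChain.rev p j.rev.castSucc) (OpenChain.rev p j.rev.succ) ξ 0 ≠ 0 := by
    have := H1.rev.side_eq.1
    intro h0
    rw [h0, mul_zero] at this
    exact mul_ne_zero H1.rev.1.1.ne' hτ' this.symm
  have hs : side (OpenChain.rev p i.rev.castSucc) (OpenChain.rev p i.rev.succ)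
      (OpenChain.rev p j.rev.castSucc) (OpenChain.rev p j.rev.succ) ξ 0 +
      side (OpenChain.rev p i.rev.castSucc) (OpenChain.rev p i.rev.succ)
      (OpenChain.rev p j.rev.castSucc) (OpenChain.rev p j.rev.succ) ξ 2 ≠ 0 := by
    intro h0
    rw [h0, mul_zero] at e1
    exact hne e1.symm
  exact mul_right_cancel₀ hs (e2.trans e1.symm)

theorem param_order₃ (hp : NonCoplanar p) (hC : Crosses p ξ 1 3) (hB : Crosses p ξ 0 3) :
    (0 < orderForm (rev p) ξ → crossParam p ξ 3 0 < crossParam p ξ 3 1) ∧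
    (orderForm (rev p) ξ < 0 → crossParam p ξ 3 1 < crossParam p ξ 3 0) := by
  obtain ⟨h1, h2⟩ := param_order₀ hp.rev (crosses_rev_eq.1.2 hC) (crosses_rev_eq.2.1.2 hB)
  have e1 := crossParam_rev (p := p) (ξ := ξ) (i := 3) (j := 1)
    (by rw [tau_symm]; exact hp.t13) hC.symm
  have e2 := crossParam_rev (p := p) (ξ := ξ) (i := 3) (j := 0)
    (by rw [tau_symm]; exact hp.t03) hB.symm
  change crossParam (rev p) ξ 0 2 = _ at e1
  change crossParam (rev p) ξ 0 3 = _ at e2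
  rw [e1, e2] at h1 h2
  exact ⟨fun h => by linarith [h1 h], fun h => by linarith [h2 h]⟩

/-- With three crossings the order on e1 is forced; applied to the reversed chain this also forces
the order on e4, so only one Gauss pattern remains. -/
theorem orderForm_pos_of_outer (hp : NonCoplanar p) (h1 : Crosses p ξ 0 2)
    (h2 : Crosses p ξ 1 3) : 0 < orderForm p ξ := by
  obtain ⟨s, hs, h, h'⟩ := crosses_both_of_outer hp h1 h2
  have := mul_pos h.n2 h'
  rw [orderForm_eq]
  rcases hs with rfl | rfl <;> linarith

end

end OpenChain

namespace OpenChain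

/-! ## Classification of the projections -/

section

variable {p : Fin 5 → Space}

/-- If the two crossings of e1 have equal sign, `ChainRel.same_signs` makes t0 negative after
normalization, and t0 is the determinant whose sign belongs to e2 and e4. -/
theorem not_tauSign_eq_of_crosses {ξ : Space} (hp : NonCoplanar p) (hA : Crosses p ξ 0 2)
    (hB : Crosses p ξ 0 3) : ¬ (tauSign p 0 2 = tauSign p 0 3 ∧ tauSign p 0 3 = tauSign p 1 3) := by
  rintro ⟨h1, h2⟩
  obtain ⟨e1, e2, e3⟩ := tau_eq p
  have t1 := hp.t02
  have t2 := hp.t03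
  have t3 := hp.t13
  simp only [tauSign, decide_eq_decide] at h1 h2
  rw [e1] at t1 h1
  rw [e2] at t2 h1 h2
  rw [e3] at t3 h2
  have : ∃ s : ℝ, ChainDoubleCross p ξ s := by
    rcases (crosses_and_crosses_iff hp).1 ⟨hA, hB⟩ with h | h
    exacts [⟨_, h⟩, ⟨_, h⟩]
  obtain ⟨s, h⟩ := this
  rcases lt_or_gt_of_ne t2 with h | h'
  · have h0 : ¬ 0 < -vol p 0 1 2 := fun h' => by linarith [h1.1 h']
    have h3 : ¬ 0 < vol p 1 2 4 := fun h' => by linarith [h2.2 h']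
    have h4 : 0 < vol p 0 1 2 := lt_of_le_of_ne (by linarith) (neg_ne_zero.1 t1).symm
    have := ((chainRel p ξ).scale (-1) s).same_signs ‹_› (by linarith) (by linarith)
    have h5 : vol p 1 2 4 < 0 := lt_of_le_of_ne (by linarith) t3
    linarith [this.1]
  · have := ((chainRel p ξ).scale 1 s).same_signs h (by linarith [h1.2 h']) (by linarith)
    linarith [this.1, h2.1 h']

theorem not_tauSign_eq_of_crosses' {ξ : Space} (hp : NonCoplanar p) (hC : Crosses p ξ 1 3)
    (hB : Crosses p ξ 0 3) : ¬ (tauSign p 0 2 = tauSign p 0 3 ∧ tauSign p 0 3 = tauSign p 1 3) := by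
  have h := not_tauSign_eq_of_crosses hp.rev (crosses_rev_eq.1.2 hC) (crosses_rev_eq.2.1.2 hB)
  rw [tauSign_rev_eq.1, tauSign_rev_eq.2.1, tauSign_rev_eq.2.2] at h
  exact fun h' => h ⟨h'.2.symm, h'.1.symm⟩

open Classical in
/-- The edge `i` is above the edge `j`. -/
noncomputable def overBool (p : Fin 5 → Space) (ξ : Space) (i j : Fin 4) : Bool :=
  decide (Over p ξ i j)

/-- Heights are signs of τ times the sign pattern, and the patterns of the two crossings are
opposite. Equal crossing signs therefore mean that e1 alternates between over and under. -/
theorem overBool_eq_iff {ξ : Space} (hp : NonCoplanar p) (hA : Crosses p ξ 0 2)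
    (hB : Crosses p ξ 0 3) :
    overBool p ξ 0 2 = overBool p ξ 0 3 ↔ tauSign p 0 2 ≠ tauSign p 0 3 := by
  have key : ∀ {i j : Fin 4}, tau p i j ≠ 0 → (∀ k, 0 < side (p i.castSucc) (p i.succ)
      (p j.castSucc) (p j.succ) ξ k) → overBool p ξ i j = tauSign p i j := by
    intro i j hτ h
    rcases lt_or_gt_of_ne hτ with h' | h'
    · simp only [overBool, tauSign, decide_eq_decide, over_iff_of_neg h', not_lt_of_gt h', iff_false]
      exact fun h'' => lt_asymm (h'' 0) (h 0)
    · simp only [overBool, tauSign, decide_eq_decide, over_iff_of_pos h', h', iff_true]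
      exact h
  have key' : ∀ {i j : Fin 4}, tau p i j ≠ 0 → (∀ k, side (p i.castSucc) (p i.succ)
      (p j.castSucc) (p j.succ) ξ k < 0) → overBool p ξ i j = !tauSign p i j := by
    intro i j hτ h
    rcases lt_or_gt_of_ne hτ with h' | h'
    · simp only [overBool, tauSign, over_iff_of_neg h', not_lt_of_gt h']
      simpa using h
    · simp only [overBool, tauSign, over_iff_of_pos h', h']
      simpa using ⟨0, (h 0).le⟩
  rcases (crosses_and_crosses_iff hp).1 ⟨hA, hB⟩ with h | h
  · rw [chainDoubleCross_one] at h
    rw [key hp.t02 h.1, key' hp.t03 h.2]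
    cases tauSign p 0 2 <;> cases tauSign p 0 3 <;> simp
  · rw [chainDoubleCross_neg_one] at h
    rw [key' hp.t02 h.1, key hp.t03 h.2]
    cases tauSign p 0 2 <;> cases tauSign p 0 3 <;> simp

theorem overBool_rev {ξ : Space} {i j : Fin 4} (hτ : tau p i j ≠ 0)
    (h : Over p ξ i j ∨ Over p ξ j i) : overBool p ξ j i = !overBool p ξ i j := by
  simp only [overBool]
  have := fun h => Over.not_over (ξ := ξ) hτ h
  by_cases h1 : Over p ξ i j
  · simp [h1, this h1]
  · simp [h1, h.resolve_left h1]

theorem overBool_eq_iff' {ξ : Space} (hp : NonCoplanar p) (hC : Crosses p ξ 1 3)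
    (hB : Crosses p ξ 0 3) :
    overBool p ξ 0 3 = overBool p ξ 1 3 ↔ tauSign p 0 3 ≠ tauSign p 1 3 := by
  have h := overBool_eq_iff hp.rev (crosses_rev_eq.1.2 hC) (crosses_rev_eq.2.1.2 hB)
  rw [tauSign_rev_eq.1, tauSign_rev_eq.2.1] at h
  have e1 : overBool (rev p) ξ 0 2 = overBool p ξ 3 1 := by
    unfold overBool
    exact decide_eq_decide.2 over_rev
  have e2 : overBool (rev p) ξ 0 3 = overBool p ξ 3 0 := by
    unfold overBool
    exact decide_eq_decide.2 over_rev
  rw [e1, e2, overBool_rev hp.t13 hC, overBool_rev hp.t03 hB] at h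
  rw [eq_comm, ne_comm, ← h]
  cases overBool p ξ 0 3 <;> cases overBool p ξ 1 3 <;> decide

theorem passage_eq_overBool {ξ : Space} {i j : Fin 4} (hτ : tau p i j ≠ 0)
    (h : Over p ξ i j ∨ Over p ξ j i) :
    passage p ξ i j = ⟨Nat.pair (min (i : ℕ) j) (max (i : ℕ) j), overBool p ξ i j, tauSign p i j⟩ ∧
    passage p ξ j i =
      ⟨Nat.pair (min (i : ℕ) j) (max (i : ℕ) j), !overBool p ξ i j, tauSign p i j⟩ := by
  constructor
  · exact passage_eq hτ ((exists_meets_iff hτ).2 h)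
  · have hτ' : tau p j i ≠ 0 := by rwa [tau_symm]
    rw [passage_eq hτ' ((exists_meets_iff hτ').2 h.symm), min_comm, max_comm, tau_symm,
      ← overBool_rev hτ h]
    rfl

theorem cross_iff_crosses {ξ : Space} (hp : NonCoplanar p) (hg : Generic p ξ) (i j : Fin 4) :
    Cross p ξ i j ↔ ((i, j) = (0, 2) ∨ (i, j) = (2, 0)) ∧ Crosses p ξ 0 2 ∨
      ((i, j) = (0, 3) ∨ (i, j) = (3, 0)) ∧ Crosses p ξ 0 3 ∨
      ((i, j) = (1, 3) ∨ (i, j) = (3, 1)) ∧ Crosses p ξ 1 3 := by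
  have a01 := not_cross_of_edgeVec (p := p) (i := 0) (j := 1) rfl (ξ := ξ) (by
    have := hg.o012
    convert this using 1
    simp [orient, edgeVec, triple_apply]
    ring)
  have a12 := not_cross_of_edgeVec (p := p) (i := 1) (j := 2) rfl (ξ := ξ) (by
    have := hg.o123
    convert this using 1
    simp [orient, edgeVec, triple_apply]
    ring)
  have a23 := not_cross_of_edgeVec (p := p) (i := 2) (j := 3) rfl (ξ := ξ) (by
    have := hg.o324
    convert neg_ne_zero.2 this using 1
    simp [orient, edgeVec, triple_apply]
    ring)
  have s02 : tau p 2 0 ≠ 0 := by rw [tau_symm]; exact hp.t02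
  have s03 : tau p 3 0 ≠ 0 := by rw [tau_symm]; exact hp.t03
  have s13 : tau p 3 1 ≠ 0 := by rw [tau_symm]; exact hp.t13
  have c02 := cross_iff (p := p) (ξ := ξ) (i := 0) (j := 2) (by decide) hp.t02
  have c03 := cross_iff (p := p) (ξ := ξ) (i := 0) (j := 3) (by decide) hp.t03
  have c13 := cross_iff (p := p) (ξ := ξ) (i := 1) (j := 3) (by decide) hp.t13
  have c20 := cross_iff (p := p) (ξ := ξ) (i := 2) (j := 0) (by decide) s02
  have c30 := cross_iff (p := p) (ξ := ξ) (i := 3) (j := 0) (by decide) s03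
  have c31 := cross_iff (p := p) (ξ := ξ) (i := 3) (j := 1) (by decide) s13
  have self : ∀ i, ¬ Cross p ξ i i := fun i h => h.1 rfl
  fin_cases i <;> fin_cases j <;>
    simp [Crosses, a01, a12, a23, c02, c03, c13, c20, c30, c31, self, or_comm]

/-- The contribution of a crossing to the writhe. -/
noncomputable def signIf (P : Prop) (s : Bool) : ℤ := open Classical in if P then boolSign s else 0

/-- The writhe of the projection. -/
noncomputable def projWrithe (p : Fin 5 → Space) (ξ : Space) : ℤ :=
  signIf (Crosses p ξ 0 2) (tauSign p 0 2) + signIf (Crosses p ξ 0 3) (tauSign p 0 3)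
    + signIf (Crosses p ξ 1 3) (tauSign p 1 3)

/-- The projection is a diagram of `k2.1`. -/
def IsK21Projection (p : Fin 5 → Space) (ξ : Space) : Prop := FirstK21 p ξ ∨ FirstK21 (rev p) ξ

theorem firstK21_rev_iff {ξ : Space} : FirstK21 (rev p) ξ ↔ Crosses p ξ 1 3 ∧ Crosses p ξ 0 3 ∧
    ¬ Crosses p ξ 0 2 ∧ tauSign p 1 3 = tauSign p 0 3 ∧ 0 < orderForm (rev p) ξ := by
  rw [FirstK21, crosses_rev_eq.1, crosses_rev_eq.2.1, crosses_rev_eq.2.2, tauSign_rev_eq.1,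
    tauSign_rev_eq.2.1]

theorem passageKey_mem_of_crosses {ξ : Space} {i j : Fin 4} (hij : i ≠ j) (hτ : tau p i j ≠ 0)
    (h : Crosses p ξ i j) : passageKey p ξ (i, j) ∈ Ioo ((i : ℕ) : ℝ) ((i : ℕ) + 1) ∧
      passageKey p ξ (j, i) ∈ Ioo ((j : ℕ) : ℝ) ((j : ℕ) + 1) :=
  ⟨passageKey_mem ((cross_iff hij hτ).2 h), passageKey_mem
    ((cross_iff hij.symm (by rwa [tau_symm])).2 h.symm)⟩

section words

variable {ξ : Dir} (hp : NonCoplanar p) (hg : Generic p (ξ : Space))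
include hp hg

/-- Here and below passages on different edges are ordered by the edge number, since the position is
that number plus a parameter in (0, 1). A comparison of parameters is needed only when e1 or e4
carries two crossings. -/
theorem gaussWord_first (hA : Crosses p (ξ : Space) 0 2)
    (hB : ¬ Crosses p (ξ : Space) 0 3)
    (hC : ¬ Crosses p (ξ : Space) 1 3) :
    gaussWord p ξ = [⟨4, overBool p ξ 0 2, tauSign p 0 2⟩,
      ⟨4, !overBool p ξ 0 2, tauSign p 0 2⟩] := by
  have hX := cross_iff_crosses hp hg
  obtain ⟨pA, pA'⟩ := passage_eq_overBool hp.t02 hA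
  obtain ⟨kA, kA'⟩ := passageKey_mem_of_crosses (by decide) hp.t02 hA
  rw [gaussWord_eq_map [(0, 2), (2, 0)]]
  · simp only [List.map_cons, List.map_nil, pA, pA']
    rfl
  · intro i j
    rw [hX]
    simp only [hA, hB, hC, List.mem_cons, List.not_mem_nil, and_true, and_false]
    tauto
  · norm_num at kA kA'
    simp only [List.pairwise_cons, List.mem_cons, List.not_mem_nil, or_false,
      forall_eq, List.Pairwise.nil, IsEmpty.forall_iff, implies_true, and_true]
    linarith [kA.2, kA'.1]

theorem gaussWord_middle (hA : ¬ Crosses p (ξ : Space) 0 2)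
    (hB : Crosses p (ξ : Space) 0 3)
    (hC : ¬ Crosses p (ξ : Space) 1 3) :
    gaussWord p ξ = [⟨9, overBool p ξ 0 3, tauSign p 0 3⟩,
      ⟨9, !overBool p ξ 0 3, tauSign p 0 3⟩] := by
  have hX := cross_iff_crosses hp hg
  obtain ⟨pB, pB'⟩ := passage_eq_overBool hp.t03 hB
  obtain ⟨kB, kB'⟩ := passageKey_mem_of_crosses (by decide) hp.t03 hB
  rw [gaussWord_eq_map [(0, 3), (3, 0)]]
  · simp only [List.map_cons, List.map_nil, pB, pB']
    rfl
  · intro i j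
    rw [hX]
    simp only [hA, hB, hC, List.mem_cons, List.not_mem_nil, and_true, and_false]
    tauto
  · norm_num at kB kB'
    simp only [List.pairwise_cons, List.mem_cons, List.not_mem_nil, or_false,
      forall_eq, List.Pairwise.nil, IsEmpty.forall_iff, implies_true, and_true]
    linarith [kB.2, kB'.1]

theorem gaussWord_last (hA : ¬ Crosses p (ξ : Space) 0 2)
    (hB : ¬ Crosses p (ξ : Space) 0 3)
    (hC : Crosses p (ξ : Space) 1 3) :
    gaussWord p ξ = [⟨10, overBool p ξ 1 3, tauSign p 1 3⟩,
      ⟨10, !overBool p ξ 1 3, tauSign p 1 3⟩] := by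
  have hX := cross_iff_crosses hp hg
  obtain ⟨pC, pC'⟩ := passage_eq_overBool hp.t13 hC
  obtain ⟨kC, kC'⟩ := passageKey_mem_of_crosses (by decide) hp.t13 hC
  rw [gaussWord_eq_map [(1, 3), (3, 1)]]
  · simp only [List.map_cons, List.map_nil, pC, pC']
    rfl
  · intro i j
    rw [hX]
    simp only [hA, hB, hC, List.mem_cons, List.not_mem_nil, and_true, and_false]
    tauto
  · norm_num at kC kC'
    simp only [List.pairwise_cons, List.mem_cons, List.not_mem_nil, or_false,
      forall_eq, List.Pairwise.nil, IsEmpty.forall_iff, implies_true, and_true]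
    linarith [kC.2, kC'.1]

theorem gaussWord_first_interlaced (hA : Crosses p (ξ : Space) 0 2)
    (hB : Crosses p (ξ : Space) 0 3)
    (hC : ¬ Crosses p (ξ : Space) 1 3)
    (hA3 : crossParam p (ξ : Space) 0 2 < crossParam p (ξ : Space) 0 3) :
    gaussWord p ξ = [⟨4, overBool p ξ 0 2, tauSign p 0 2⟩,
      ⟨9, overBool p ξ 0 3, tauSign p 0 3⟩,
      ⟨4, !overBool p ξ 0 2, tauSign p 0 2⟩,
      ⟨9, !overBool p ξ 0 3, tauSign p 0 3⟩] := by
  have hX := cross_iff_crosses hp hg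
  obtain ⟨pA, pA'⟩ := passage_eq_overBool hp.t02 hA
  obtain ⟨kA, kA'⟩ := passageKey_mem_of_crosses (by decide) hp.t02 hA
  obtain ⟨pB, pB'⟩ := passage_eq_overBool hp.t03 hB
  obtain ⟨kB, kB'⟩ := passageKey_mem_of_crosses (by decide) hp.t03 hB
  rw [gaussWord_eq_map [(0, 2), (0, 3), (2, 0), (3, 0)]]
  · simp only [List.map_cons, List.map_nil, pA, pA', pB, pB']
    rfl
  · intro i j
    rw [hX]
    simp only [hA, hB, hC, List.mem_cons, List.not_mem_nil, and_true, and_false]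
    tauto
  · have hA3' : passageKey p (ξ : Space) (0, 2) < passageKey p (ξ : Space) (0, 3) :=
      add_lt_add_right hA3 _
    norm_num at kA kA' kB kB'
    simp only [List.pairwise_cons, List.mem_cons, List.not_mem_nil, or_false, forall_eq_or_imp,
      forall_eq, List.Pairwise.nil, IsEmpty.forall_iff, implies_true, and_true]
    refine ⟨⟨?_, ?_, ?_⟩, ⟨?_, ?_⟩, ?_⟩ <;> linarith

theorem gaussWord_first_nested (hA : Crosses p (ξ : Space) 0 2)
    (hB : Crosses p (ξ : Space) 0 3)
    (hC : ¬ Crosses p (ξ : Space) 1 3)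
    (hA3 : crossParam p (ξ : Space) 0 3 < crossParam p (ξ : Space) 0 2) :
    gaussWord p ξ = [⟨9, overBool p ξ 0 3, tauSign p 0 3⟩,
      ⟨4, overBool p ξ 0 2, tauSign p 0 2⟩,
      ⟨4, !overBool p ξ 0 2, tauSign p 0 2⟩,
      ⟨9, !overBool p ξ 0 3, tauSign p 0 3⟩] := by
  have hX := cross_iff_crosses hp hg
  obtain ⟨pA, pA'⟩ := passage_eq_overBool hp.t02 hA
  obtain ⟨kA, kA'⟩ := passageKey_mem_of_crosses (by decide) hp.t02 hA
  obtain ⟨pB, pB'⟩ := passage_eq_overBool hp.t03 hB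
  obtain ⟨kB, kB'⟩ := passageKey_mem_of_crosses (by decide) hp.t03 hB
  rw [gaussWord_eq_map [(0, 3), (0, 2), (2, 0), (3, 0)]]
  · simp only [List.map_cons, List.map_nil, pA, pA', pB, pB']
    rfl
  · intro i j
    rw [hX]
    simp only [hA, hB, hC, List.mem_cons, List.not_mem_nil, and_true, and_false]
    tauto
  · have hA3' : passageKey p (ξ : Space) (0, 3) < passageKey p (ξ : Space) (0, 2) :=
      add_lt_add_right hA3 _
    norm_num at kA kA' kB kB'
    simp only [List.pairwise_cons, List.mem_cons, List.not_mem_nil, or_false, forall_eq_or_imp,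
      forall_eq, List.Pairwise.nil, IsEmpty.forall_iff, implies_true, and_true]
    refine ⟨⟨?_, ?_, ?_⟩, ⟨?_, ?_⟩, ?_⟩ <;> linarith

theorem gaussWord_last_interlaced (hA : ¬ Crosses p (ξ : Space) 0 2)
    (hB : Crosses p (ξ : Space) 0 3)
    (hC : Crosses p (ξ : Space) 1 3)
    (hC3 : crossParam p (ξ : Space) 3 0 < crossParam p (ξ : Space) 3 1) :
    gaussWord p ξ = [⟨9, overBool p ξ 0 3, tauSign p 0 3⟩,
      ⟨10, overBool p ξ 1 3, tauSign p 1 3⟩,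
      ⟨9, !overBool p ξ 0 3, tauSign p 0 3⟩,
      ⟨10, !overBool p ξ 1 3, tauSign p 1 3⟩] := by
  have hX := cross_iff_crosses hp hg
  obtain ⟨pB, pB'⟩ := passage_eq_overBool hp.t03 hB
  obtain ⟨kB, kB'⟩ := passageKey_mem_of_crosses (by decide) hp.t03 hB
  obtain ⟨pC, pC'⟩ := passage_eq_overBool hp.t13 hC
  obtain ⟨kC, kC'⟩ := passageKey_mem_of_crosses (by decide) hp.t13 hC
  rw [gaussWord_eq_map [(0, 3), (1, 3), (3, 0), (3, 1)]]
  · simp only [List.map_cons, List.map_nil, pB, pB', pC, pC']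
    rfl
  · intro i j
    rw [hX]
    simp only [hA, hB, hC, List.mem_cons, List.not_mem_nil, and_true, and_false]
    tauto
  · have hC3' : passageKey p (ξ : Space) (3, 0) < passageKey p (ξ : Space) (3, 1) :=
      add_lt_add_right hC3 _
    norm_num at kB kB' kC kC'
    simp only [List.pairwise_cons, List.mem_cons, List.not_mem_nil, or_false, forall_eq_or_imp,
      forall_eq, List.Pairwise.nil, IsEmpty.forall_iff, implies_true, and_true]
    refine ⟨⟨?_, ?_, ?_⟩, ⟨?_, ?_⟩, ?_⟩ <;> linarith

theorem gaussWord_last_nested (hA : ¬ Crosses p (ξ : Space) 0 2)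
    (hB : Crosses p (ξ : Space) 0 3)
    (hC : Crosses p (ξ : Space) 1 3)
    (hC3 : crossParam p (ξ : Space) 3 1 < crossParam p (ξ : Space) 3 0) :
    gaussWord p ξ = [⟨9, overBool p ξ 0 3, tauSign p 0 3⟩,
      ⟨10, overBool p ξ 1 3, tauSign p 1 3⟩,
      ⟨10, !overBool p ξ 1 3, tauSign p 1 3⟩,
      ⟨9, !overBool p ξ 0 3, tauSign p 0 3⟩] := by
  have hX := cross_iff_crosses hp hg
  obtain ⟨pB, pB'⟩ := passage_eq_overBool hp.t03 hB
  obtain ⟨kB, kB'⟩ := passageKey_mem_of_crosses (by decide) hp.t03 hB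
  obtain ⟨pC, pC'⟩ := passage_eq_overBool hp.t13 hC
  obtain ⟨kC, kC'⟩ := passageKey_mem_of_crosses (by decide) hp.t13 hC
  rw [gaussWord_eq_map [(0, 3), (1, 3), (3, 1), (3, 0)]]
  · simp only [List.map_cons, List.map_nil, pB, pB', pC, pC']
    rfl
  · intro i j
    rw [hX]
    simp only [hA, hB, hC, List.mem_cons, List.not_mem_nil, and_true, and_false]
    tauto
  · have hC3' : passageKey p (ξ : Space) (3, 1) < passageKey p (ξ : Space) (3, 0) :=
      add_lt_add_right hC3 _
    norm_num at kB kB' kC kC'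
    simp only [List.pairwise_cons, List.mem_cons, List.not_mem_nil, or_false, forall_eq_or_imp,
      forall_eq, List.Pairwise.nil, IsEmpty.forall_iff, implies_true, and_true]
    refine ⟨⟨?_, ?_, ?_⟩, ⟨?_, ?_⟩, ?_⟩ <;> linarith

theorem gaussWord_three (hA : Crosses p (ξ : Space) 0 2)
    (hB : Crosses p (ξ : Space) 0 3)
    (hC : Crosses p (ξ : Space) 1 3)
    (hA3 : crossParam p (ξ : Space) 0 2 < crossParam p (ξ : Space) 0 3)
    (hC3 : crossParam p (ξ : Space) 3 0 < crossParam p (ξ : Space) 3 1) :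
    gaussWord p ξ = [⟨4, overBool p ξ 0 2, tauSign p 0 2⟩,
      ⟨9, overBool p ξ 0 3, tauSign p 0 3⟩,
      ⟨10, overBool p ξ 1 3, tauSign p 1 3⟩,
      ⟨4, !overBool p ξ 0 2, tauSign p 0 2⟩,
      ⟨9, !overBool p ξ 0 3, tauSign p 0 3⟩,
      ⟨10, !overBool p ξ 1 3, tauSign p 1 3⟩] := by
  have hX := cross_iff_crosses hp hg
  obtain ⟨pA, pA'⟩ := passage_eq_overBool hp.t02 hA
  obtain ⟨kA, kA'⟩ := passageKey_mem_of_crosses (by decide) hp.t02 hA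
  obtain ⟨pB, pB'⟩ := passage_eq_overBool hp.t03 hB
  obtain ⟨kB, kB'⟩ := passageKey_mem_of_crosses (by decide) hp.t03 hB
  obtain ⟨pC, pC'⟩ := passage_eq_overBool hp.t13 hC
  obtain ⟨kC, kC'⟩ := passageKey_mem_of_crosses (by decide) hp.t13 hC
  rw [gaussWord_eq_map [(0, 2), (0, 3), (1, 3), (2, 0), (3, 0), (3, 1)]]
  · simp only [List.map_cons, List.map_nil, pA, pA', pB, pB', pC, pC']
    rfl
  · intro i j
    rw [hX]
    simp only [hA, hB, hC, List.mem_cons, List.not_mem_nil, and_true]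
    tauto
  · have hA3' : passageKey p (ξ : Space) (0, 2) < passageKey p (ξ : Space) (0, 3) :=
      add_lt_add_right hA3 _
    have hC3' : passageKey p (ξ : Space) (3, 0) < passageKey p (ξ : Space) (3, 1) :=
      add_lt_add_right hC3 _
    norm_num at kA kA' kB kB' kC kC'
    simp only [List.pairwise_cons, List.mem_cons, List.not_mem_nil, or_false, forall_eq_or_imp,
      forall_eq, List.Pairwise.nil, IsEmpty.forall_iff, implies_true, and_true]
    refine ⟨⟨?_, ?_, ?_, ?_, ?_⟩, ⟨?_, ?_, ?_, ?_⟩, ⟨?_, ?_, ?_⟩, ⟨?_, ?_⟩, ?_⟩ <;> linarith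

end words

/-- Case distinction on the three crossings. Two crossings on e1 or e4 are nested (two curls),
interlaced with opposite signs (a bigon) or interlaced with equal signs (k2.1); three crossings
always reduce to a loop because the signs are not all equal. -/
theorem classification {ξ : Dir} (hp : NonCoplanar p) (hg : Generic p (ξ : Space)) :
    (IsK21Projection p ξ → K21Diagram (gaussWord p ξ) (boolSign (tauSign p 0 3))) ∧
    (¬ IsK21Projection p ξ → TrivialDiagram (gaussWord p ξ) (projWrithe p ξ)) := by
  have hAC := crosses_middle (p := p) (ξ := (ξ : Space)) hp
  have ho : orderForm p (ξ : Space) ≠ 0 := mul_ne_zero hg.o013 hg.o324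
  have ho' : orderForm (rev p) (ξ : Space) ≠ 0 := by
    rw [orderForm_rev]
    exact neg_ne_zero.2 (mul_ne_zero hg.o134 hg.o012)
  rw [IsK21Projection, firstK21_rev_iff, FirstK21]
  by_cases hA : Crosses p (ξ : Space) 0 2
  · by_cases hB : Crosses p (ξ : Space) 0 3
    · have hAB := overBool_eq_iff hp hA hB
      obtain ⟨ord, ord'⟩ := param_order₀ hp hA hB
      by_cases hC : Crosses p (ξ : Space) 1 3
      · have hBC := overBool_eq_iff' hp hC hB
        -- With all three crossings present the orders on e1 and e4 are forced.
        rw [gaussWord_three hp hg hA hB hC (ord (orderForm_pos_of_outer hp hA hC))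
          ((param_order₃ hp hC hB).1 (orderForm_pos_of_outer hp.rev
          (crosses_rev_eq.1.2 hC) (crosses_rev_eq.2.2.2 hA)))]
        refine ⟨fun h => absurd h (by simp [hA, hC]), fun _ => ?_⟩
        have := trivialDiagram_threeWord hAB hBC (not_tauSign_eq_of_crosses hp hA hB)
        simpa [projWrithe, signIf, hA, hB, hC, threeWord] using this
      · rcases lt_or_gt_of_ne ho with ho | ho
        · rw [gaussWord_first_nested hp hg hA hB hC (ord' ho)]
          refine ⟨fun h => absurd h (by simp [hA, ho.le]), fun _ => ?_⟩
          have := trivialDiagram_nested 4 9 (by simp) (overBool p ξ 0 3) (tauSign p 0 3)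
            (overBool p ξ 0 2) (tauSign p 0 2)
          rw [add_comm] at this
          simpa [projWrithe, signIf, hA, hB, hC] using this
        · rw [gaussWord_first_interlaced hp hg hA hB hC (ord ho)]
          by_cases hs : tauSign p 0 2 = tauSign p 0 3
          · refine ⟨fun _ => ?_, fun h => absurd h (by simp [hA, hB, hC, ho, hs])⟩
            -- Equal signs force alternation, the pattern of the standard k2.1 word.
            have e : overBool p ξ 0 3 = !overBool p ξ 0 2 :=
              (Bool.eq_not.2 fun h => hAB.1 h.symm hs)
            rw [hs, e, Bool.not_not]
            exact k21Diagram_interlaced 4 9 (by simp) (overBool p ξ 0 2) (tauSign p 0 3)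
          · refine ⟨fun h => absurd h (by simp [hA, hs]), fun _ => ?_⟩
            have e : overBool p ξ 0 3 = overBool p ξ 0 2 := (hAB.2 hs).symm
            have e' : tauSign p 0 3 = !tauSign p 0 2 := Bool.eq_not.2 (Ne.symm hs)
            have hz : projWrithe p ξ = 0 := by
              simp only [projWrithe, signIf, hA, hB, hC, e', if_true, if_false]
              cases tauSign p 0 2 <;> rfl
            rw [e, e', hz]
            exact trivialDiagram_bigon 4 9 (by simp) (overBool p ξ 0 2) (tauSign p 0 2)
    · have hC : ¬ Crosses p (ξ : Space) 1 3 := fun h => hB (hAC hA h)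
      rw [gaussWord_first hp hg hA hB hC]
      refine ⟨fun h => absurd h (by simp [hB]), fun _ => ?_⟩
      have := trivialDiagram_loop 4 (by simp) (overBool p ξ 0 2) (tauSign p 0 2)
      simpa [projWrithe, signIf, hA, hB, hC] using this
  · by_cases hB : Crosses p (ξ : Space) 0 3
    · by_cases hC : Crosses p (ξ : Space) 1 3
      · have hBC := overBool_eq_iff' hp hC hB
        obtain ⟨ord, ord'⟩ := param_order₃ hp hC hB
        rcases lt_or_gt_of_ne ho' with ho | ho
        · rw [gaussWord_last_nested hp hg hA hB hC (ord' ho)]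
          refine ⟨fun h => absurd h (by simp [hA, ho.le]), fun _ => ?_⟩
          have := trivialDiagram_nested 10 9 (by simp) (overBool p ξ 0 3) (tauSign p 0 3)
            (overBool p ξ 1 3) (tauSign p 1 3)
          simpa [projWrithe, signIf, hA, hB, hC] using this
        · rw [gaussWord_last_interlaced hp hg hA hB hC (ord ho)]
          by_cases hs : tauSign p 1 3 = tauSign p 0 3
          · refine ⟨fun _ => ?_, fun h => absurd h (by simp [hA, hB, hC, ho, hs])⟩
            have e : overBool p ξ 1 3 = !overBool p ξ 0 3 :=
              Bool.eq_not.2 fun h => hBC.1 h.symm hs.symm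
            rw [hs, e, Bool.not_not]
            exact k21Diagram_interlaced 9 10 (by simp) (overBool p ξ 0 3) (tauSign p 0 3)
          · refine ⟨fun h => absurd h (by simp [hA, hs]), fun _ => ?_⟩
            have e : overBool p ξ 1 3 = overBool p ξ 0 3 := (hBC.2 (Ne.symm hs)).symm
            have e' : tauSign p 1 3 = !tauSign p 0 3 := Bool.eq_not.2 hs
            have hz : projWrithe p ξ = 0 := by
              simp only [projWrithe, signIf, hA, hB, hC, e', if_true, if_false]
              cases tauSign p 0 3 <;> rfl
            rw [e, e', hz]
            exact trivialDiagram_bigon 9 10 (by simp) (overBool p ξ 0 3) (tauSign p 0 3)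
      · rw [gaussWord_middle hp hg hA hB hC]
        refine ⟨fun h => absurd h (by simp [hA, hC]), fun _ => ?_⟩
        have := trivialDiagram_loop 9 (by simp) (overBool p ξ 0 3) (tauSign p 0 3)
        simpa [projWrithe, signIf, hA, hB, hC] using this
    · refine ⟨fun h => absurd h (by simp [hB]), fun _ => ?_⟩
      by_cases hC : Crosses p (ξ : Space) 1 3
      · rw [gaussWord_last hp hg hA hB hC]
        have := trivialDiagram_loop 10 (by simp) (overBool p ξ 1 3) (tauSign p 1 3)
        simpa [projWrithe, signIf, hA, hB, hC] using this
      · have hw : gaussWord p ξ = [] := by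
          rw [gaussWord_eq_map []]
          · rfl
          · intro i j
            rw [cross_iff_crosses hp hg]
            simp [hA, hB, hC]
          · simp
        rw [hw]
        simpa [projWrithe, signIf, hA, hB, hC] using trivialDiagram_nil

end

end OpenChain

namespace OpenChain

/-! ## The measure on the sphere of directions -/

instance : IsFiniteMeasure sphereMeasure := by
  unfold sphereMeasure
  infer_instance

theorem area_univ : area univ = 4 * Real.pi := by
  rw [area, sphereMeasure, Measure.toSphere_real_apply_univ, Measure.real,
    EuclideanSpace.volume_ball_fin_three]
  rw [ENNReal.ofReal_one, one_pow, one_mul, ENNReal.toReal_ofReal (by positivity)]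
  simp
  ring

/-- Area is three times the volume of the cone over the set, three being the dimension. Null sets,
the antipodal symmetry and the areas of quadrangles are all handled through this cone. -/
theorem sphereMeasure_apply {s : Set Dir} (hs : MeasurableSet s) :
    sphereMeasure s = 3 * volume (Ioo (0 : ℝ) 1 • ((↑) '' s : Set Space)) := by
  rw [sphereMeasure, Measure.toSphere_apply' _ hs]
  simp

/-- The cone over a great circle lies in a plane, a proper subspace. -/
theorem ae_inner_ne_zero {v : Space} (hv : v ≠ 0) :
    ∀ᵐ ξ : Dir ∂sphereMeasure, inner ℝ v (ξ : Space) ≠ 0 := by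
  rw [ae_iff]
  simp only [not_not]
  have hm : MeasurableSet {ξ : Dir | inner ℝ v (ξ : Space) = 0} :=
    (isClosed_eq (continuous_const.inner continuous_subtype_val) continuous_const).measurableSet
  rw [sphereMeasure_apply hm]
  have hsub : Ioo (0 : ℝ) 1 • ((↑) '' {ξ : Dir | inner ℝ v (ξ : Space) = 0} : Set Space) ⊆
      (LinearMap.ker (innerₗ Space v) : Set Space) := by
    rintro _ ⟨r, -, _, ⟨ξ, hξ, rfl⟩, rfl⟩
    simp only [mem_ofPred_eq] at hξ
    simp [hξ]
  have hne : LinearMap.ker (innerₗ Space v) ≠ ⊤ := by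
    intro h
    have : v ∈ LinearMap.ker (innerₗ Space v) := by rw [h]; trivial
    simp only [LinearMap.mem_ker, innerₗ_apply_apply, inner_self_eq_zero] at this
    exact hv this
  rw [measure_mono_null hsub (Measure.addHaar_submodule _ _ hne), mul_zero]

theorem measurePreserving_neg : MeasurePreserving (fun ξ : Dir => -ξ) sphereMeasure sphereMeasure := by
  have hmeas : Measurable fun ξ : Dir => -ξ := by fun_prop
  refine ⟨hmeas, ?_⟩
  ext s hs
  rw [Measure.map_apply hmeas hs, sphereMeasure_apply (hmeas hs), sphereMeasure_apply hs,
    ← Measure.measure_neg volume (Ioo (0 : ℝ) 1 • ((↑) '' s : Set Space))]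
  congr 2
  ext x
  simp only [mem_smul, mem_neg, mem_image, mem_preimage]
  constructor
  · rintro ⟨r, hr, _, ⟨ξ, hξ, rfl⟩, rfl⟩
    exact ⟨r, hr, _, ⟨-ξ, hξ, rfl⟩, by simp⟩
  · rintro ⟨r, hr, _, ⟨ξ, hξ, rfl⟩, h⟩
    refine ⟨r, hr, _, ⟨-ξ, by simpa using hξ, rfl⟩, ?_⟩
    rw [← neg_neg x, ← h]
    simp

theorem area_neg (X : Set Dir) : area (-X) = area X := by
  have h : MeasurableEmbedding (fun ξ : Dir => -ξ) := (MeasurableEquiv.neg Dir).measurableEmbedding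
  exact congrArg ENNReal.toReal (measurePreserving_neg.measure_preimage_emb h X)

theorem ae_neg {P : Dir → Prop} (h : ∀ᵐ ξ ∂sphereMeasure, P ξ) :
    ∀ᵐ ξ ∂sphereMeasure, P (-ξ) :=
  measurePreserving_neg.quasiMeasurePreserving.ae h

theorem area_congr {X Y : Set Dir} (h : ∀ᵐ ξ ∂sphereMeasure, ξ ∈ X ↔ ξ ∈ Y) : area X = area Y :=
  measureReal_congr (Filter.eventuallyEq_set.2 h)

/-! ## The area of a spherical quadrangle -/

/-- Coordinates on space. -/
noncomputable def spaceCoord (q : ℝ × ℝ × ℝ) : Space := WithLp.toLp 2 ![q.1, q.2.1, q.2.2]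

theorem measurePreserving_spaceCoord : MeasurePreserving spaceCoord volume volume := by
  have h1 := (volume_preserving_finTwoArrow ℝ).symm
  have h2 := (volume_preserving_piFinSuccAbove (fun _ : Fin 3 => ℝ) 0).symm
  have h3 := ((MeasurePreserving.id (volume : Measure ℝ)).prod h1)
  have h4 := (PiLp.volume_preserving_toLp (Fin 3)).comp (h2.comp h3)
  have e : spaceCoord = WithLp.toLp 2 ∘ ⇑(MeasurableEquiv.piFinSuccAbove (fun _ => ℝ) 0).symm ∘
      Prod.map id ⇑MeasurableEquiv.finTwoArrow.symm := by
    funext q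
    simp only [spaceCoord, Function.comp]
    congr 1
    funext k
    fin_cases k <;> rfl
  rw [e]
  exact h4

theorem injective_spaceCoord : Function.Injective spaceCoord := by
  rintro ⟨a, b, c⟩ ⟨a', b', c'⟩ h
  have h' := congrArg WithLp.ofLp h
  have h0 := congrFun h' 0
  have h1 := congrFun h' 1
  have h2 := congrFun h' 2
  simp [spaceCoord] at h0 h1 h2
  simp [h0, h1, h2]

/-- The linear map sending the standard basis to `a`, `b`, `c`. -/
noncomputable def frameMap (a b c : Space) : Space →ₗ[ℝ] Space where
  toFun w := w 0 • a + w 1 • b + w 2 • c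
  map_add' x y := by simp only [PiLp.add_apply]; module
  map_smul' r x := by
    simp only [PiLp.smul_apply, smul_eq_mul, RingHom.id_apply]
    module

theorem det_frameMap (a b c : Space) : LinearMap.det (frameMap a b c) = triple a b c := by
  rw [← LinearMap.det_toMatrix (EuclideanSpace.basisFun (Fin 3) ℝ).toBasis, Matrix.det_fin_three]
  simp [LinearMap.toMatrix_apply, frameMap, triple_apply]
  ring

theorem measurableEmbedding_spaceCoord : MeasurableEmbedding spaceCoord := by
  have : Continuous spaceCoord := by
    unfold spaceCoord
    refine (PiLp.continuous_toLp 2 _).comp (continuous_pi fun k => ?_)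
    fin_cases k <;> simp <;> fun_prop
  exact this.measurableEmbedding injective_spaceCoord

theorem volume_image_frame (a b c : Space) (D : Set (ℝ × ℝ × ℝ)) :
    volume ((fun q : ℝ × ℝ × ℝ => q.1 • a + q.2.1 • b + q.2.2 • c) '' D) =
      ENNReal.ofReal |triple a b c| * volume D := by
  have : (fun q : ℝ × ℝ × ℝ => q.1 • a + q.2.1 • b + q.2.2 • c) '' D =
      frameMap a b c '' (spaceCoord '' D) := by
    rw [image_image]
    rfl
  rw [this, Measure.addHaar_image_linearMap, det_frameMap]
  congr 1
  rw [← measurePreserving_spaceCoord.measure_preimage_emb measurableEmbedding_spaceCoord,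
    injective_spaceCoord.preimage_image]

theorem lintegral_Ioo_sq {b : ℝ} (hb : 0 ≤ b) :
    ∫⁻ r in Ioo 0 b, ENNReal.ofReal (r ^ 2) = ENNReal.ofReal (b ^ 3 / 3) := by
  rw [← ofReal_integral_eq_lintegral_ofReal]
  · rw [← integral_Ioc_eq_integral_Ioo, ← intervalIntegral.integral_of_le hb, integral_pow]
    norm_num
  · exact (continuous_pow 2).continuousOn.integrableOn_Icc.mono_set Ioo_subset_Icc_self
  · exact Filter.Eventually.of_forall fun r => sq_nonneg r

/-- The open unit square. -/
def unitSquare : Set (ℝ × ℝ) := Ioo 0 1 ×ˢ Ioo 0 1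

/-- In the coordinates (r, r q) the Jacobian is r², and the condition becomes r g(q) < 1.
Integrating r² from 0 to 1 / g(q) gives the integrand. The homogeneous coordinates need only Fubini
and the scaling of plane area instead of a change of variables formula. -/
theorem volume_cone (g : ℝ × ℝ → ℝ) (hg : Continuous g) (hpos : ∀ q ∈ unitSquare, 0 < g q)
    (f : ℝ × ℝ × ℝ → ℝ) (hf : Continuous f)
    (hfg : ∀ r, 0 < r → ∀ q : ℝ × ℝ, f (r, r • q) = r * g q) :
    volume {q : ℝ × ℝ × ℝ | 0 < q.1 ∧ q.2 ∈ q.1 • unitSquare ∧ f q < 1} =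
      ∫⁻ q in unitSquare, ENNReal.ofReal (1 / g q ^ 3 / 3) := by
  have hsq : IsOpen unitSquare := isOpen_Ioo.prod isOpen_Ioo
  set D := {q : ℝ × ℝ × ℝ | 0 < q.1 ∧ q.2 ∈ q.1 • unitSquare ∧ f q < 1} with hD
  have hDo : IsOpen D := by
    have : D = {q | 0 < q.1} ∩ {q | 0 < q.2.1} ∩ {q | q.2.1 < q.1} ∩ {q | 0 < q.2.2} ∩
        {q | q.2.2 < q.1} ∩ {q | f q < 1} := by
      ext ⟨r, x, y⟩
      simp only [hD, mem_ofPred_eq, mem_inter_iff]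
      constructor
      · rintro ⟨hr, ⟨⟨t, s⟩, ⟨⟨h1, h2⟩, ⟨h3, h4⟩⟩, h⟩, hf⟩
        obtain ⟨rfl, rfl⟩ := Prod.mk.inj h
        simp only [smul_eq_mul] at *
        refine ⟨⟨⟨⟨⟨hr, by positivity⟩, by nlinarith⟩, by positivity⟩, by nlinarith⟩, hf⟩
      · rintro ⟨⟨⟨⟨⟨hr, h1⟩, h2⟩, h3⟩, h4⟩, h5⟩
        refine ⟨hr, ⟨(x / r, y / r), ⟨⟨by positivity, (div_lt_one hr).2 h2⟩,
          ⟨by positivity, (div_lt_one hr).2 h4⟩⟩, ?_⟩, h5⟩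
        simp [mul_div_cancel₀ _ hr.ne']
    rw [this]
    exact (((((isOpen_lt (by fun_prop) (by fun_prop)).inter (isOpen_lt (by fun_prop)
      (by fun_prop))).inter (isOpen_lt (by fun_prop) (by fun_prop))).inter (isOpen_lt (by fun_prop)
      (by fun_prop))).inter (isOpen_lt (by fun_prop) (by fun_prop))).inter
      (isOpen_lt hf continuous_const)
  -- The slice at height r is a dilate by r of a part of the square. Its area is written as an
  -- integral over the square of a function supported on r < 1 / g(q), ready for exchanging the
  -- integrations.
  have hslice : ∀ r : ℝ, volume (Prod.mk r ⁻¹' D) = ∫⁻ q in unitSquare,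
      (Ioo 0 (1 / g q)).indicator (fun r => ENNReal.ofReal (r ^ 2)) r := by
    intro r
    by_cases hr : 0 < r
    · have hset : Prod.mk r ⁻¹' D = r • (unitSquare ∩ {q | r * g q < 1}) := by
        ext q
        simp only [hD, mem_preimage, mem_ofPred_eq]
        constructor
        · rintro ⟨-, ⟨q, hq, rfl⟩, h⟩
          refine ⟨q, ⟨hq, ?_⟩, rfl⟩
          rw [mem_ofPred_eq, ← hfg r hr]
          exact h
        · rintro ⟨q, ⟨hq, h⟩, rfl⟩
          refine ⟨hr, ⟨q, hq, rfl⟩, ?_⟩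
          simp only
          rw [hfg r hr]
          exact h
      have hmeas : MeasurableSet {q | r * g q < 1} :=
        (isOpen_lt (by fun_prop) continuous_const).measurableSet
      rw [hset, Measure.addHaar_smul_of_nonneg _ hr.le]
      have hcongr : ∀ q ∈ unitSquare,
          (Ioo 0 (1 / g q)).indicator (fun r => ENNReal.ofReal (r ^ 2)) r =
          {q | r * g q < 1}.indicator (fun _ => ENNReal.ofReal (r ^ 2)) q := by
        intro q hq
        simp only [indicator, mem_Ioo, mem_ofPred_eq, hr, true_and, lt_div_iff₀ (hpos q hq)]
      rw [setLIntegral_congr_fun hsq.measurableSet hcongr, lintegral_indicator hmeas,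
        setLIntegral_const, Measure.restrict_apply hmeas, inter_comm]
      simp
    · have hset : Prod.mk r ⁻¹' D = ∅ := by
        ext q
        simp [hD, hr]
      have hzero : ∀ q, (Ioo 0 (1 / g q)).indicator (fun r => ENNReal.ofReal (r ^ 2)) r = 0 := by
        intro q
        simp [indicator, hr]
      simp only [hset, hzero, measure_empty, lintegral_const, zero_mul]
  rw [Measure.volume_eq_prod, Measure.prod_apply hDo.measurableSet]
  simp only [hslice]
  rw [lintegral_lintegral_swap]
  · refine setLIntegral_congr_fun hsq.measurableSet fun q hq => ?_
    have : 0 < g q := hpos q hq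
    rw [lintegral_indicator measurableSet_Ioo, lintegral_Ioo_sq (by positivity)]
    congr 1
    rw [div_pow, one_pow]
  · have hm : MeasurableSet {z : ℝ × ℝ × ℝ | z.1 ∈ Ioo 0 (1 / g z.2)} := by
      have hgm : Measurable fun z : ℝ × ℝ × ℝ => 1 / g z.2 :=
        (hg.measurable.comp measurable_snd).const_div 1
      exact (measurableSet_lt measurable_const measurable_fst).inter
        (measurableSet_lt measurable_fst hgm)
    have : Measurable fun z : ℝ × ℝ × ℝ => {z : ℝ × ℝ × ℝ | z.1 ∈ Ioo 0 (1 / g z.2)}.indicator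
        (fun z => ENNReal.ofReal (z.1 ^ 2)) z :=
      Measurable.indicator (by fun_prop) hm
    exact this.aemeasurable

end OpenChain

/-! ### Area of the quadrangle of directions and the Gauss linking integral -/

namespace OpenChain

section

variable {n : ℕ} {p : Fin (n + 1) → Space} {i j : Fin n}

/-- The vector between points of two edges. -/
noncomputable def chord (p : Fin (n + 1) → Space) (i j : Fin n) (q : ℝ × ℝ) : Space :=
  edge p i q.1 - edge p j q.2

theorem chord_eq (q : ℝ × ℝ) : chord p i j q =
    (p i.castSucc - p j.castSucc) + q.1 • edgeVec p i + q.2 • -edgeVec p j := by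
  simp only [chord, edge, edgeVec]
  module

theorem triple_chord (q : ℝ × ℝ) :
    triple (edgeVec p i) (edgeVec p j) (chord p i j q) = tau p i j := by
  simp [chord_eq, triple_apply, tau]
  ring

theorem chord_ne_zero (hτ : tau p i j ≠ 0) (q : ℝ × ℝ) : chord p i j q ≠ 0 := by
  intro h
  rw [← triple_chord q, h] at hτ
  simp [triple] at hτ

theorem continuous_chord : Continuous (chord p i j) := by
  have : chord p i j = fun q => (p i.castSucc - p j.castSucc) + q.1 • edgeVec p i +
    q.2 • -edgeVec p j := funext chord_eq
  rw [this]
  fun_prop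

theorem measurableSet_Q2 (hτ : tau p i j ≠ 0) : MeasurableSet (Q2 p i j) := by
  have : Q2 p i j = ⋂ k, {ξ : Dir | 0 < tau p i j *
      side (p i.castSucc) (p i.succ) (p j.castSucc) (p j.succ) ξ k} := by
    ext ξ
    rw [mem_Q2_iff, over_iff hτ]
    simp
  rw [this]
  refine MeasurableSet.iInter fun k => (isOpen_lt continuous_const ?_).measurableSet
  refine continuous_const.mul ?_
  fin_cases k <;> exact continuous_const.inner continuous_subtype_val

/-- A point of the open cone over the quadrangle is r times a chord. Expanding the chord makes this
linear in (r, r t, r s), so the cone is a linear image of the region measured in `volume_cone`. -/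
theorem cone_Q2 (hτ : tau p i j ≠ 0) : (Ioo (0 : ℝ) 1 • ((↑) '' Q2 p i j : Set Space)) =
    (fun q : ℝ × ℝ × ℝ => q.1 • (p i.castSucc - p j.castSucc) + q.2.1 • edgeVec p i +
      q.2.2 • -edgeVec p j) '' {q : ℝ × ℝ × ℝ | 0 < q.1 ∧ q.2 ∈ q.1 • unitSquare ∧
        ‖q.1 • (p i.castSucc - p j.castSucc) + q.2.1 • edgeVec p i +
          q.2.2 • -edgeVec p j‖ < 1} := by
  have key : ∀ (r : ℝ) (q : ℝ × ℝ), r • (p i.castSucc - p j.castSucc) + (r • q).1 • edgeVec p i +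
      (r • q).2 • -edgeVec p j = r • chord p i j q := by
    intro r q
    rw [chord_eq]
    simp only [Prod.smul_fst, Prod.smul_snd, smul_eq_mul]
    module
  ext x
  constructor
  · rintro ⟨l, ⟨hl0, hl1⟩, _, ⟨ξ, ⟨t, s, h, ⟨ht, hs, H⟩, hh⟩, rfl⟩, rfl⟩
    have hξ : ‖(ξ : Space)‖ = 1 := by simp
    have e : (l / h) • chord p i j (t, s) = l • (ξ : Space) := by
      rw [chord, H, smul_smul, div_mul_cancel₀ _ hh.ne']
    refine ⟨(l / h, (l / h) • (t, s)), ⟨by positivity, ⟨(t, s), ⟨ht, hs⟩, rfl⟩, ?_⟩, ?_⟩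
    · simp only
      rw [key, e, norm_smul, hξ, mul_one, Real.norm_eq_abs, abs_of_pos hl0]
      exact hl1
    · simp only
      rw [key, e]
  · rintro ⟨⟨r, z⟩, ⟨hr, ⟨q, hq, hz⟩, hlt⟩, rfl⟩
    obtain rfl : r • q = z := hz
    simp only at hr hlt ⊢
    rw [key] at hlt ⊢
    have hne : ‖chord p i j q‖ ≠ 0 := norm_ne_zero_iff.2 (chord_ne_zero hτ q)
    have hpos : 0 < ‖chord p i j q‖ := norm_pos_iff.2 (chord_ne_zero hτ q)
    rw [norm_smul, Real.norm_eq_abs, abs_of_pos hr] at hlt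
    refine ⟨r * ‖chord p i j q‖, ⟨by positivity, hlt⟩, ‖chord p i j q‖⁻¹ • chord p i j q,
      ⟨⟨‖chord p i j q‖⁻¹ • chord p i j q, ?_⟩, ⟨q.1, q.2, ‖chord p i j q‖, ⟨hq.1, hq.2, ?_⟩, hpos⟩,
        rfl⟩, ?_⟩
    · simp [norm_smul, hne]
    · rw [smul_smul, mul_inv_cancel₀ hne, one_smul]
      rfl
    · simp only
      rw [smul_smul, mul_assoc, mul_inv_cancel₀ hne, mul_one]

/-- The integral which gives both the linking integral and the area. -/
noncomputable def chordIntegral (p : Fin (n + 1) → Space) (i j : Fin n) : ℝ :=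
  ∫ q in unitSquare, 1 / ‖chord p i j q‖ ^ 3

theorem continuous_chord_inv (hτ : tau p i j ≠ 0) :
    Continuous fun q => 1 / ‖chord p i j q‖ ^ 3 := by
  refine continuous_const.div (continuous_chord.norm.pow 3) fun q => ?_
  exact pow_ne_zero _ (norm_ne_zero_iff.2 (chord_ne_zero hτ q))

theorem integrableOn_chord (hτ : tau p i j ≠ 0) :
    IntegrableOn (fun q => 1 / ‖chord p i j q‖ ^ 3) (Icc 0 1 ×ˢ Icc 0 1) volume :=
  (continuous_chord_inv hτ).continuousOn.integrableOn_compact (isCompact_Icc.prod isCompact_Icc)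

theorem integrableOn_unitSquare (hτ : tau p i j ≠ 0) :
    IntegrableOn (fun q => 1 / ‖chord p i j q‖ ^ 3) unitSquare volume :=
  (integrableOn_chord hτ).mono_set (prod_mono Ioo_subset_Icc_self Ioo_subset_Icc_self)

/-- The frame consisting of the initial chord and the edge vectors has determinant ±τ. The factor 3
from `sphereMeasure_apply` cancels the 1/3 from the radial integral. -/
theorem area_Q2_eq (hτ : tau p i j ≠ 0) : area (Q2 p i j) = |tau p i j| * chordIntegral p i j := by
  have hpos : ∀ q, 0 < ‖chord p i j q‖ := fun q => norm_pos_iff.2 (chord_ne_zero hτ q)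
  have ht : |triple (p i.castSucc - p j.castSucc) (edgeVec p i) (-edgeVec p j)| =
      |tau p i j| := by
    rw [← abs_neg]
    congr 1
    simp [triple_apply, tau]
    ring
  rw [area, Measure.real, sphereMeasure_apply (measurableSet_Q2 hτ), cone_Q2 hτ,
    volume_image_frame, ht, volume_cone (fun q => ‖chord p i j q‖) continuous_chord.norm
      (fun q _ => hpos q) _ (by fun_prop)]
  · rw [← ofReal_integral_eq_lintegral_ofReal]
    · rw [ENNReal.toReal_mul, ENNReal.toReal_mul, ENNReal.toReal_ofReal (abs_nonneg _),
        ENNReal.toReal_ofReal, integral_div, chordIntegral]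
      · norm_num
        ring
      · exact integral_nonneg fun q => by positivity
    · exact (integrableOn_unitSquare hτ).div_const 3
    · exact Filter.Eventually.of_forall fun q => by positivity
  · intro r hr q
    have : r • (p i.castSucc - p j.castSucc) + (r • q).1 • edgeVec p i +
        (r • q).2 • -edgeVec p j = r • chord p i j q := by
      rw [chord_eq]
      simp only [Prod.smul_fst, Prod.smul_snd, smul_eq_mul]
      module
    simp only
    rw [this, norm_smul, Real.norm_eq_abs, abs_of_pos hr]

theorem deriv_edge (i : Fin n) (t : ℝ) : deriv (edge p i) t = edgeVec p i := by
  have : HasDerivAt (fun t : ℝ => p i.castSucc + t • edgeVec p i) (edgeVec p i) t := by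
    simpa only [one_smul] using
      ((hasDerivAt_id' t).smul_const (edgeVec p i)).const_add (p i.castSucc)
  exact this.deriv

/-- The numerator of the Gauss integrand is the constant τ by `triple_chord`, which leaves the same
integral as for the area. Sign and absolute value of L follow. -/
theorem L_eq (hτ : tau p i j ≠ 0) :
    L p i j = 1 / (4 * Real.pi) * (tau p i j * chordIntegral p i j) := by
  have h : ∀ t s : ℝ, triple (deriv (edge p i) t) (deriv (edge p j) s) (edge p i t - edge p j s) /
      ‖edge p i t - edge p j s‖ ^ 3 = tau p i j * (1 / ‖chord p i j (t, s)‖ ^ 3) := by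
    intro t s
    rw [deriv_edge, deriv_edge, mul_one_div]
    exact congrArg (· / _) (triple_chord (t, s))
  rw [L, gaussLinking]
  simp only [h, intervalIntegral.integral_const_mul]
  congr 2
  rw [chordIntegral, unitSquare, Measure.volume_eq_prod, setIntegral_prod]
  · rw [intervalIntegral.integral_of_le zero_le_one, integral_Ioc_eq_integral_Ioo]
    congr 1
    funext t
    rw [intervalIntegral.integral_of_le zero_le_one, integral_Ioc_eq_integral_Ioo]
  · exact integrableOn_unitSquare hτ

theorem chordIntegral_pos (hτ : tau p i j ≠ 0) : 0 < chordIntegral p i j := by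
  have hsq : IsOpen unitSquare := isOpen_Ioo.prod isOpen_Ioo
  rw [chordIntegral, setIntegral_pos_iff_support_of_nonneg_ae]
  · have : Function.support (fun q => 1 / ‖chord p i j q‖ ^ 3) = univ := by
      ext q
      simp [chord_ne_zero hτ q]
    rw [this, univ_inter]
    exact hsq.measure_pos _ ⟨(1 / 2, 1 / 2), by constructor <;> constructor <;> norm_num⟩
  · exact Filter.Eventually.of_forall fun q => by positivity
  · exact integrableOn_unitSquare hτ

theorem area_Q2 (hτ : tau p i j ≠ 0) : area (Q2 p i j) = 4 * Real.pi * |L p i j| := by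
  rw [area_Q2_eq hτ, L_eq hτ, abs_mul, abs_mul, abs_of_pos (chordIntegral_pos hτ),
    abs_of_pos (show 0 < 1 / (4 * Real.pi) by positivity)]
  field_simp

theorem sign_L (hτ : tau p i j ≠ 0) : SignType.sign (L p i j) = SignType.sign (tau p i j) := by
  have h := chordIntegral_pos hτ
  have h' : 0 < 1 / (4 * Real.pi) := by positivity
  rw [L_eq hτ, sign_mul, sign_mul, sign_pos h, sign_pos h', one_mul, mul_one]

end

end OpenChain

namespace OpenChain

/-! ## General position -/

/-- A vector in the left kernel of the singular matrix of differences, completed at a by minus the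
sum of its entries, would be an affine dependence. -/
theorem triple_ne_zero_of_affineIndependent {a b c d : Space}
    (h : AffineIndependent ℝ ![a, b, c, d]) : triple (b - a) (c - a) (d - a) ≠ 0 := by
  intro h0
  have hdet : (Matrix.of ![(b - a).ofLp, (c - a).ofLp, (d - a).ofLp]).det = 0 := by
    rw [← h0, Matrix.det_fin_three, triple_apply]
    simp
    ring
  obtain ⟨v, hv, hv0⟩ := Matrix.exists_vecMul_eq_zero_iff.2 hdet
  rw [affineIndependent_iff] at h
  have key := h Finset.univ ![-(v 0 + v 1 + v 2), v 0, v 1, v 2]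
    (by simp [Fin.sum_univ_four]; ring) (by
      ext k
      have := congrFun hv0 k
      simp [Matrix.vecMul, dotProduct, Fin.sum_univ_three] at this
      simp [Fin.sum_univ_four]
      linarith)
  refine hv (funext fun k => ?_)
  fin_cases k
  · exact key 1 (Finset.mem_univ _)
  · exact key 2 (Finset.mem_univ _)
  · exact key 3 (Finset.mem_univ _)

variable {p : Fin 5 → Space}

theorem nonCoplanar_of_affineIndependent (h13 : AffineIndependent ℝ ![p 0, p 1, p 2, p 3])
    (h14 : AffineIndependent ℝ ![p 0, p 1, p 3, p 4])
    (h24 : AffineIndependent ℝ ![p 1, p 2, p 3, p 4]) : NonCoplanar p := by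
  have e1 := triple_ne_zero_of_affineIndependent h13
  have e2 := triple_ne_zero_of_affineIndependent h14
  have e3 := triple_ne_zero_of_affineIndependent h24
  refine ⟨fun h => e1 ?_, fun h => e2 ?_, fun h => e3 ?_⟩
  · rw [← h]
    simp [tau, edgeVec, triple_apply]
    ring
  · rw [← h]
    simp [tau, edgeVec, triple_apply]
    ring
  · rw [← h]
    simp [tau, edgeVec, triple_apply]
    ring

theorem cross_ne_zero_of_triple {a b c : Space} (h : triple a b c ≠ 0) : cross a b ≠ 0 := by
  intro h0
  rw [triple, h0, inner_zero_left] at h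
  exact h rfl

/-- Every triangle in `Generic` is a face of one of the three non-degenerate tetrahedra, so its
normal vector is non-zero and the excluded directions form a great circle. -/
theorem NonCoplanar.ae_generic (hp : NonCoplanar p) :
    ∀ᵐ ξ : Dir ∂sphereMeasure, Generic p (ξ : Space) := by
  -- The index l is the apex completing the triangle ijk to such a tetrahedron.
  have key : ∀ (i j k l : Fin 5) {t : ℝ}, t ≠ 0 →
      (triple (p j - p i) (p k - p i) (p l - p i) = t ∨
        triple (p j - p i) (p k - p i) (p l - p i) = -t) →
      ∀ᵐ ξ : Dir ∂sphereMeasure, orient p (ξ : Space) i j k ≠ 0 := by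
    intro i j k l t ht h
    refine ae_inner_ne_zero (cross_ne_zero_of_triple (c := p l - p i) ?_)
    rcases h with h | h
    · rwa [h]
    · rw [h]
      exact neg_ne_zero.2 ht
  have h1 := key 0 1 2 3 hp.t02 (Or.inl (by simp [tau, edgeVec, triple_apply]; ring))
  have h2 := key 1 2 3 0 hp.t02 (Or.inr (by simp [tau, edgeVec, triple_apply]; ring))
  have h3 := key 3 2 4 1 hp.t13 (Or.inl (by simp [tau, edgeVec, triple_apply]; ring))
  have h4 := key 1 3 4 0 hp.t03 (Or.inr (by simp [tau, edgeVec, triple_apply]; ring))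
  have h5 := key 0 1 3 2 hp.t02 (Or.inr (by simp [tau, edgeVec, triple_apply]; ring))
  have h6 := key 1 2 4 3 hp.t13 (Or.inr (by simp [tau, edgeVec, triple_apply]; ring))
  have h7 := key 0 2 3 1 hp.t02 (Or.inl (by simp [tau, edgeVec, triple_apply]; ring))
  filter_upwards [h1, h2, h3, h4, h5, h6, h7] with ξ g1 g2 g3 g4 g5 g6 g7
  exact ⟨g1, g2, g3, g4, g5, g6, g7⟩

theorem eps_eq {n : ℕ} {p : Fin (n + 1) → Space} {i j : Fin n} (hτ : tau p i j ≠ 0) :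
    eps p i j = SignType.sign (tau p i j) := by
  rw [eps, sign_L hτ]

theorem eps_eq_boolSign {p : Fin 5 → Space} {i j : Fin 4} (hτ : tau p i j ≠ 0) :
    eps p i j = boolSign (tauSign p i j) := by
  rw [eps_eq hτ]
  rcases lt_or_gt_of_ne hτ with h | h
  · simp [sign_neg h, tauSign, boolSign, h.not_gt]
  · simp [sign_pos h, tauSign, boolSign, h]

theorem boolSign_injective : Function.Injective boolSign := by decide

theorem eps_eq_eps_iff {i j k l : Fin 4} (h : tau p i j ≠ 0) (h' : tau p k l ≠ 0) :
    eps p i j = eps p k l ↔ tauSign p i j = tauSign p k l := by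
  rw [eps_eq_boolSign h, eps_eq_boolSign h']
  exact boolSign_injective.eq_iff

theorem eps_mul_tau_pos {n : ℕ} {p : Fin (n + 1) → Space} {i j : Fin n} (hτ : tau p i j ≠ 0) :
    0 < (eps p i j : ℝ) * tau p i j := by
  rw [eps_eq hτ]
  rcases lt_or_gt_of_ne hτ with h | h
  · simpa [sign_neg h] using h
  · simpa [sign_pos h] using h

theorem eps_eq_one_or {n : ℕ} {p : Fin (n + 1) → Space} {i j : Fin n} (hτ : tau p i j ≠ 0) :
    eps p i j = 1 ∨ eps p i j = -1 := by
  rw [eps_eq hτ]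
  rcases lt_or_gt_of_ne hτ with h | h
  · simp [sign_neg h]
  · simp [sign_pos h]

/-! ## The normal vectors and the signs which select a row of the table -/

/-- A degenerate normal vector is no exception: both sides are then false. -/
theorem inner_unitCross_pos {a b ξ : Space} :
    0 < inner ℝ (unitCross a b) ξ ↔ 0 < triple a b ξ := by
  rw [unitCross, real_inner_smul_left, triple]
  by_cases h : cross a b = 0
  · simp [h]
  · exact mul_pos_iff_of_pos_left (by positivity)

theorem inner_neg_unitCross_pos {a b ξ : Space} :
    0 < inner ℝ (-unitCross a b) ξ ↔ 0 < -triple a b ξ := by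
  rw [unitCross, inner_neg_left, real_inner_smul_left, ← mul_neg, triple]
  by_cases h : cross a b = 0
  · simp [h]
  · exact mul_pos_iff_of_pos_left (by positivity)

section

variable (p : Fin 5 → Space) (ξ : Space)

theorem nn_pos :
    (0 < inner ℝ (nn p).v1 ξ ↔ 0 < wedge p ξ 0 2) ∧
    (0 < inner ℝ (nn p).v2 ξ ↔ 0 < wedge p ξ 0 1) ∧
    (0 < inner ℝ (nn p).v3 ξ ↔ 0 < -wedge p ξ 1 2) ∧
    (0 < inner ℝ (nn p).v4 ξ ↔ 0 < -(wedge p ξ 0 1 + wedge p ξ 1 2 - wedge p ξ 0 2)) := by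
  have h := side_eq₀₂ p ξ
  have h0 := congrFun h 0
  have h1 := congrFun h 1
  have h2 := congrFun h 2
  have h3 := congrFun h 3
  refine ⟨inner_unitCross_pos.trans ?_, inner_unitCross_pos.trans ?_,
    inner_unitCross_pos.trans ?_, inner_unitCross_pos.trans ?_⟩
  · exact (congrArg (0 < ·) h0).to_iff
  · exact (congrArg (0 < ·) h1).to_iff
  · exact (congrArg (0 < ·) h2).to_iff
  · exact (congrArg (0 < ·) h3).to_iff

theorem uu_pos :
    (0 < inner ℝ (-(uu p).v1) ξ ↔ 0 < wedge p ξ 0 4) ∧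
    (0 < inner ℝ (-(uu p).v2) ξ ↔ 0 < -(wedge p ξ 0 1 + wedge p ξ 1 4 - wedge p ξ 0 4)) ∧
    (0 < inner ℝ (-(uu p).v3) ξ ↔ 0 < -wedge p ξ 1 4) := by
  have h := side_eq₀₃ p ξ
  have h0 := congrFun h 0
  have h1 := congrFun h 1
  have h2 := congrFun h 2
  refine ⟨inner_neg_unitCross_pos.trans ?_, inner_neg_unitCross_pos.trans ?_,
    inner_neg_unitCross_pos.trans ?_⟩
  · exact (congrArg (0 < ·) ((congrArg Neg.neg h0).trans (neg_neg _))).to_iff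
  · exact (congrArg (0 < -·) h1).to_iff
  · exact (congrArg (0 < -·) h2).to_iff

theorem vv_pos :
    (0 < inner ℝ (vv p).v1 ξ ↔ 0 < -wedge p ξ 1 4) ∧
    (0 < inner ℝ (vv p).v2 ξ ↔ 0 < wedge p ξ 1 2 + wedge p ξ 2 4 - wedge p ξ 1 4) ∧
    (0 < inner ℝ (vv p).v3 ξ ↔ 0 < wedge p ξ 2 4) ∧
    (0 < inner ℝ (-(vv p).v2) ξ ↔ 0 < -(wedge p ξ 1 2 + wedge p ξ 2 4 - wedge p ξ 1 4)) ∧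
    (0 < inner ℝ (-(vv p).v3) ξ ↔ 0 < -wedge p ξ 2 4) := by
  have h := side_eq₁₃ p ξ
  have h0 := congrFun h 0
  have h1 := congrFun h 1
  have h2 := congrFun h 2
  refine ⟨inner_unitCross_pos.trans ?_, inner_unitCross_pos.trans ?_,
    inner_unitCross_pos.trans ?_, inner_neg_unitCross_pos.trans ?_,
    inner_neg_unitCross_pos.trans ?_⟩
  · exact (congrArg (0 < ·) h0).to_iff
  · exact (congrArg (0 < ·) h1).to_iff
  · exact (congrArg (0 < ·) h2).to_iff
  · exact (congrArg (0 < -·) h1).to_iff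
  · exact (congrArg (0 < -·) h2).to_iff

end

theorem cross_smul_smul (a b : Space) (r s : ℝ) :
    cross (r • a) (s • b) = (r * s) • cross a b := by
  ext k
  fin_cases k <;> simp [cross, cross_apply] <;> ring

theorem cross_cross_cross (x y d : Space) :
    cross (cross x d) (cross y d) = triple x y d • d := by
  ext k
  fin_cases k <;> simp [cross, cross_apply, triple_apply] <;> ring


end OpenChain

namespace OpenChain

variable {p : Fin 5 → Space}

/-! ## The signs which select a row of the table -/

/-- Normals of planes containing a common line with direction d have cross products along d, so an
inner product of two such cross products is a product of two volumes times |d|². -/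
theorem inner_cross_smul (x y z d : Space) (r s t : ℝ) :
    inner ℝ (cross (r • cross x d) (-(s • cross y d))) (cross (r • cross x d) (t • -cross z d)) =
      r ^ 2 * s * t * ‖d‖ ^ 2 * (triple x y d * triple x z d) := by
  have h : -(s • cross y d) = (-s) • cross y d := by simp
  have h' : t • -cross z d = (-t) • cross z d := by simp
  rw [h, h', cross_smul_smul, cross_smul_smul, cross_cross_cross, cross_cross_cross,
    real_inner_smul_left, real_inner_smul_left, real_inner_smul_right, real_inner_smul_right,
    real_inner_self_eq_norm_sq]
  ring

/-- The value, up to a factor, of the determinant of the vertices `0`, `1`, `2`, `4`. -/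
noncomputable def outerVol (p : Fin 5 → Space) : ℝ :=
  vol p 1 2 4 - vol p 0 2 4 + vol p 0 1 4 - vol p 0 1 2

/-- The normals u2, n2, n4 all belong to planes through the first edge. A factor that is only
non-negative suffices: a strict sign of w still passes to the product of volumes. -/
theorem exists_wSign_eq (p : Fin 5 → Space) :
    ∃ k : ℝ, 0 ≤ k ∧ wSign p = k * (vol p 0 1 4 * outerVol p) := by
  have h1 : cross (p 0 - p 4) (p 1 - p 4) = cross (p 0 - p 4) (p 1 - p 0) := by
    ext k
    fin_cases k <;> simp [cross, cross_apply] <;> ring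
  have h2 : cross (p 0 - p 3) (p 1 - p 3) = cross (p 0 - p 3) (p 1 - p 0) := by
    ext k
    fin_cases k <;> simp [cross, cross_apply] <;> ring
  have h3 : cross (p 1 - p 2) (p 0 - p 2) = -cross (p 0 - p 2) (p 1 - p 0) := by
    ext k
    fin_cases k <;> simp [cross, cross_apply] <;> ring
  have e1 : triple (p 0 - p 4) (p 0 - p 3) (p 1 - p 0) = -vol p 0 1 4 := by
    simp [vol, triple_apply]
    ring
  have e2 : triple (p 0 - p 4) (p 0 - p 2) (p 1 - p 0) = -outerVol p := by
    simp [outerVol, vol, triple_apply]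
    ring
  refine ⟨‖cross (p 0 - p 4) (p 1 - p 0)‖⁻¹ ^ 2 * ‖cross (p 0 - p 3) (p 1 - p 0)‖⁻¹ *
    ‖-cross (p 0 - p 2) (p 1 - p 0)‖⁻¹ * ‖p 1 - p 0‖ ^ 2, by positivity, ?_⟩
  change inner ℝ (cross (unitCross (p 0 - p 4) (p 1 - p 4)) (-unitCross (p 0 - p 3) (p 1 - p 3)))
    (cross (unitCross (p 0 - p 4) (p 1 - p 4)) (unitCross (p 1 - p 2) (p 0 - p 2))) = _
  rw [unitCross, unitCross, unitCross, h1, h2, h3, inner_cross_smul, e1, e2, neg_mul_neg]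

/-- As for w, the common line now being the third edge. -/
theorem exists_w0Sign_eq (p : Fin 5 → Space) :
    ∃ k : ℝ, 0 ≤ k ∧ w0Sign p = k * (vol p 0 2 4 * vol p 1 2 4) := by
  have h2 : cross (p 0 - p 2) (p 0 - p 3) = cross (p 0 - p 2) (p 2 - p 3) := by
    ext k
    fin_cases k <;> simp [cross, cross_apply] <;> ring
  have h3 : cross (p 1 - p 3) (p 1 - p 2) = -cross (p 1 - p 2) (p 2 - p 3) := by
    ext k
    fin_cases k <;> simp [cross, cross_apply] <;> ring
  have e1 : triple (p 2 - p 4) (p 0 - p 2) (p 2 - p 3) = -vol p 0 2 4 := by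
    simp [vol, triple_apply]
    ring
  have e2 : triple (p 2 - p 4) (p 1 - p 2) (p 2 - p 3) = -vol p 1 2 4 := by
    simp [vol, triple_apply]
    ring
  refine ⟨‖cross (p 2 - p 4) (p 2 - p 3)‖⁻¹ ^ 2 * ‖cross (p 0 - p 2) (p 2 - p 3)‖⁻¹ *
    ‖-cross (p 1 - p 2) (p 2 - p 3)‖⁻¹ * ‖p 2 - p 3‖ ^ 2, by positivity, ?_⟩
  change inner ℝ (cross (unitCross (p 2 - p 4) (p 2 - p 3)) (-unitCross (p 0 - p 2) (p 0 - p 3)))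
    (cross (unitCross (p 2 - p 4) (p 2 - p 3)) (unitCross (p 1 - p 3) (p 1 - p 2))) = _
  rw [unitCross, unitCross, unitCross, h2, h3, inner_cross_smul, e1, e2, neg_mul_neg]

theorem exists_cSign_eq (i j : Fin 5) (a b : Space) :
    ∃ k : ℝ, 0 ≤ k ∧ cSign p i j (unitCross a b) = k * (eps p 0 2 * triple a b (p j - p i)) := by
  refine ⟨‖cross a b‖⁻¹, by positivity, ?_⟩
  rw [cSign, unitCross, real_inner_smul_right, real_inner_comm, triple]
  ring

/-- The chain with the determinants normalized such that the first and the third edge have the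
linking sign `1`. -/
structure RowSigns (p : Fin 5 → Space) (t0 t1 t2 t4 : ℝ) : Prop where
  rel : ∀ ξ, ChainRel t0 t1 t2 t4 (wedge p ξ 0 1) (wedge p ξ 0 2) (wedge p ξ 0 4) (wedge p ξ 1 2)
    (wedge p ξ 1 4) (wedge p ξ 2 4)
  t4_neg : t4 < 0
  t2_pos : eps p 0 2 = eps p 0 3 → 0 < t2
  t2_neg : eps p 0 2 = -eps p 0 3 → t2 < 0
  w : ∃ k : ℝ, 0 ≤ k ∧ wSign p = k * (t2 * (t0 - t1 + t2 - t4))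
  w0 : ∃ k : ℝ, 0 ≤ k ∧ w0Sign p = k * (t1 * t0)
  c31 : ∃ k : ℝ, 0 ≤ k ∧ cSign p 3 1 (nn p).v1 = k * -t4
  c41 : ∃ k : ℝ, 0 ≤ k ∧ cSign p 4 1 (nn p).v1 = k * (-t4 - t1)
  c30 : ∃ k : ℝ, 0 ≤ k ∧ cSign p 3 0 (nn p).v3 = k * -t4
  c40 : ∃ k : ℝ, 0 ≤ k ∧ cSign p 4 0 (nn p).v3 = k * (t0 - t4)
  c40' : ∃ k : ℝ, 0 ≤ k ∧ cSign p 4 0 (nn p).v1 = k * -t1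
  c41' : ∃ k : ℝ, 0 ≤ k ∧ cSign p 4 1 (nn p).v3 = k * t0

theorem eps_mul_self {n : ℕ} {p : Fin (n + 1) → Space} {i j : Fin n} (hτ : tau p i j ≠ 0) :
    (eps p i j : ℝ) * eps p i j = 1 := by
  rcases eps_eq_one_or hτ with h | h <;> simp [h]

/-- All determinants are multiplied by ε_{1,3}. The relations are homogeneous in them, w and w0 are
quadratic and unaffected, and each c is linear and carries the factor ε_{1,3} already. -/
theorem NonCoplanar.rowSigns (hp : NonCoplanar p) : RowSigns p (eps p 0 2 * vol p 1 2 4)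
    (eps p 0 2 * vol p 0 2 4) (eps p 0 2 * vol p 0 1 4) (eps p 0 2 * vol p 0 1 2) := by
  obtain ⟨e1, e2, e3⟩ := tau_eq p
  have hs := eps_mul_self hp.t02
  constructor
  · intro ξ
    simpa only [one_mul] using (chainRel p ξ).scale (eps p 0 2) 1
  · have := eps_mul_tau_pos hp.t02
    rw [e1] at this
    linarith
  · intro h
    have := eps_mul_tau_pos hp.t03
    rwa [e2, ← h] at this
  · intro h
    have := eps_mul_tau_pos hp.t03
    rw [e2] at this
    rw [h]
    push_cast
    linarith
  · obtain ⟨k, hk, h⟩ := exists_wSign_eq p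
    refine ⟨k, hk, h.trans ?_⟩
    rw [outerVol]
    linear_combination (-k * (vol p 0 1 4 * (vol p 1 2 4 - vol p 0 2 4 + vol p 0 1 4 - vol p 0 1 2))) * hs
  · obtain ⟨k, hk, h⟩ := exists_w0Sign_eq p
    refine ⟨k, hk, h.trans ?_⟩
    linear_combination (-k * (vol p 0 2 4 * vol p 1 2 4)) * hs
  · obtain ⟨k, hk, h⟩ := exists_cSign_eq (p := p) 3 1 (p 0 - p 2) (p 0 - p 3)
    refine ⟨k, hk, h.trans ?_⟩
    rw [← mul_neg]
    congr 2
    simp [vol, triple_apply]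
    ring
  · obtain ⟨k, hk, h⟩ := exists_cSign_eq (p := p) 4 1 (p 0 - p 2) (p 0 - p 3)
    refine ⟨k, hk, h.trans ?_⟩
    rw [← mul_neg, ← mul_sub]
    congr 2
    simp [vol, triple_apply]
    ring
  · obtain ⟨k, hk, h⟩ := exists_cSign_eq (p := p) 3 0 (p 1 - p 3) (p 1 - p 2)
    refine ⟨k, hk, h.trans ?_⟩
    rw [← mul_neg]
    congr 2
    simp [vol, triple_apply]
    ring
  · obtain ⟨k, hk, h⟩ := exists_cSign_eq (p := p) 4 0 (p 1 - p 3) (p 1 - p 2)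
    refine ⟨k, hk, h.trans ?_⟩
    rw [← mul_sub]
    congr 2
    simp [vol, triple_apply]
    ring
  · obtain ⟨k, hk, h⟩ := exists_cSign_eq (p := p) 4 0 (p 0 - p 2) (p 0 - p 3)
    refine ⟨k, hk, h.trans ?_⟩
    rw [← mul_neg]
    congr 2
    simp [vol, triple_apply]
    ring
  · obtain ⟨k, hk, h⟩ := exists_cSign_eq (p := p) 4 1 (p 1 - p 3) (p 1 - p 2)
    refine ⟨k, hk, h.trans ?_⟩
    congr 2
    simp [vol, triple_apply]
    ring

/-- Two real numbers which differ by a non-negative factor have the same sign where the first one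
does not vanish. -/
theorem sign_transfer {x y : ℝ} (h : ∃ k : ℝ, 0 ≤ k ∧ x = k * y) :
    (0 < x → 0 < y) ∧ (x < 0 → y < 0) := by
  obtain ⟨k, hk, rfl⟩ := h
  exact ⟨fun h => pos_of_mul_pos_right h hk, fun h => neg_of_mul_neg_right h hk⟩

end OpenChain

namespace OpenChain

variable {p : Fin 5 → Space}

/-! ## The rows of the table -/

/-- The first edge crosses the third and the fourth one, as seen from one of the two sides. -/
def SeenCross (p : Fin 5 → Space) (ξ : Space) : Prop :=
  DoubleCross (wedge p ξ 0 1) (wedge p ξ 0 2) (wedge p ξ 0 4) (wedge p ξ 1 2) (wedge p ξ 1 4)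

/-- The second edge then crosses the fourth one. -/
def SeenThird (p : Fin 5 → Space) (ξ : Space) : Prop :=
  0 < wedge p ξ 1 2 + wedge p ξ 2 4 - wedge p ξ 1 4 ∧ 0 < wedge p ξ 2 4

/-- The projection is then a diagram of `k2.1`. -/
def SeenK21 (p : Fin 5 → Space) (ξ : Space) : Prop :=
  eps p 0 2 = eps p 0 3 ∧ SeenCross p ξ ∧ 0 < wedge p ξ 2 4 ∧
    wedge p ξ 1 2 + wedge p ξ 2 4 - wedge p ξ 1 4 < 0

theorem mem_poly_cons {v : Space} {l : List Space} {ξ : Dir} :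
    ξ ∈ poly (v :: l) ↔ 0 < inner ℝ v (ξ : Space) ∧ ξ ∈ poly l := by
  simp only [poly, mem_ofPred_eq, List.forall_mem_cons]

theorem mem_poly_nil {ξ : Dir} : ξ ∈ poly [] := by
  simp [poly]

theorem Generic.third_ne_zero {ξ : Space} (hg : Generic p ξ) :
    wedge p ξ 2 4 ≠ 0 ∧ wedge p ξ 1 2 + wedge p ξ 2 4 - wedge p ξ 1 4 ≠ 0 := by
  obtain ⟨-, -, h, -, -, -, -, -, h'⟩ := orient_eq p ξ
  exact ⟨h' ▸ hg.o324, h ▸ hg.o124⟩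

theorem RowSigns.same {t0 t1 t2 t4 : ℝ} (S : RowSigns p t0 t1 t2 t4)
    (he : eps p 0 2 = eps p 0 3) (hw : wSign p < 0) (hw0 : w0Sign p < 0) :
    t0 < 0 ∧ 0 < t1 ∧ t0 - t1 + t2 - t4 < 0 := by
  have h2 := S.t2_pos he
  have h4 := S.t4_neg
  have hq : t0 - t1 + t2 - t4 < 0 := neg_of_mul_neg_right ((sign_transfer S.w).2 hw) h2.le
  rcases mul_neg_iff.1 ((sign_transfer S.w0).2 hw0) with ⟨h1, h0⟩ | ⟨h1, h0⟩
  · exact ⟨h0, h1, hq⟩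
  -- With t1 < 0 < t0, the quantity t0 - t1 + t2 - t4 would be a sum of positive terms, contrary to
  -- `hq`.
  · linarith

theorem RowSigns.not_seenCross {t0 t1 t2 t4 : ℝ} (S : RowSigns p t0 t1 t2 t4)
    (he : eps p 0 2 = eps p 0 3) (hw : 0 < wSign p ∨ 0 < w0Sign p) (ξ : Space) :
    ¬ SeenCross p ξ := by
  intro h
  obtain ⟨h0, h1, hq⟩ := (S.rel ξ).same_signs h S.t4_neg (S.t2_pos he)
  rcases hw with hw | hw
  · exact (mul_neg_of_pos_of_neg (S.t2_pos he) hq).not_gt ((sign_transfer S.w).1 hw)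
  · exact (mul_neg_of_pos_of_neg h1 h0).not_gt ((sign_transfer S.w0).1 hw)

theorem K21Polygon.mem_iff (hp : NonCoplanar p) {K : Set Dir} (hK : K21Polygon p K) {ξ : Dir} :
    ξ ∈ K ↔ SeenK21 p (ξ : Space) := by
  have S := hp.rowSigns
  have R := S.rel (ξ : Space)
  obtain ⟨n1, -, -, -⟩ := nn_pos p ξ
  obtain ⟨-, u2, -⟩ := uu_pos p ξ
  obtain ⟨-, -, v3, v2, -⟩ := vv_pos p ξ
  cases hK with
  | empty h =>
    refine iff_of_false (notMem_empty _) ?_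
    rintro ⟨he, hc, -⟩
    exact S.not_seenCross he (h.resolve_left (not_not_intro he)) _ hc
  | triangle he hw hw0 hc =>
    obtain ⟨h0, h1, hq⟩ := S.same he hw hw0
    have c := (sign_transfer S.c41).2 hc
    simp only [mem_poly_cons, mem_poly_nil, and_true, u2, v3, v2]
    constructor
    · rintro ⟨a, b, d⟩
      exact ⟨he, doubleCross_triangle R S.t4_neg (S.t2_pos he) hq h0 h1 c a b d, a, by linarith⟩
    · rintro ⟨-, D, a, b⟩
      exact ⟨a, by linarith, D.u2⟩
  | quadrangle he hw hw0 _ =>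
    obtain ⟨h0, h1, hq⟩ := S.same he hw hw0
    simp only [mem_poly_cons, mem_poly_nil, and_true, n1, u2, v3, v2]
    constructor
    · rintro ⟨a, b, d, e⟩
      exact ⟨he, doubleCross_quadrangle R S.t4_neg (S.t2_pos he) hq h0 h1 a b d e, a,
        by linarith⟩
    · rintro ⟨-, D, a, b⟩
      exact ⟨a, by linarith, D.n1, D.u2⟩

theorem mem_poly_same (hp : NonCoplanar p) (he : eps p 0 2 = eps p 0 3) (hw : wSign p < 0)
    (hw0 : w0Sign p < 0) {l r : List Space} (hl : FirstSides p l) (hr : LastSides p r) {ξ : Dir} :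
    (ξ ∈ poly ([(nn p).v4] ++ l ++ [-(uu p).v2] ++ r) ↔ SeenCross p (ξ : Space)) ∧
    (ξ ∈ poly ([(nn p).v4, -(vv p).v3, -(uu p).v2] ++ r) ↔
      SeenCross p (ξ : Space) ∧ 0 < -wedge p (ξ : Space) 2 4) := by
  have S := hp.rowSigns
  have R := S.rel (ξ : Space)
  have h4 := S.t4_neg
  have h2 := S.t2_pos he
  obtain ⟨n1, -, n3, n4⟩ := nn_pos p ξ
  obtain ⟨u1, u2, u3⟩ := uu_pos p ξ
  obtain ⟨-, -, -, -, v3⟩ := vv_pos p ξ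
  obtain ⟨h0, h1, hq⟩ := S.same he hw hw0
  cases hl with
  -- c_{3,1} and c_{3,0} are non-negative multiples of -t4 > 0, so the cases where one of them is
  -- negative do not occur.
  | mm hc => linarith [(sign_transfer S.c31).2 hc]
  | mp hc => linarith [(sign_transfer S.c31).2 hc]
  | pp _ hc1 =>
    have c1 := (sign_transfer S.c41).1 hc1
    cases hr with
    | mm hc => linarith [(sign_transfer S.c30).2 hc]
    | mp hc => linarith [(sign_transfer S.c30).2 hc]
    | pp _ hc0 =>
      have c0 := (sign_transfer S.c40).1 hc0
      simp only [List.cons_append, List.nil_append, mem_poly_cons, mem_poly_nil, and_true, n1, n3,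
        n4, u2, v3]
      exact ⟨⟨fun ⟨a, b, c, d⟩ => doubleCross_same_pp R h4 h2 hq h1 c1 c0 a b c d,
        fun D => ⟨D.n4, D.n1, D.u2, D.n3⟩⟩,
        ⟨fun ⟨a, b, c, d⟩ => ⟨doubleCross_single_p R h4 h2 hq h0 h1 c0 a b c d, b⟩,
        fun ⟨D, b⟩ => ⟨D.n4, b, D.u2, D.n3⟩⟩⟩
    | pm =>
      simp only [List.cons_append, List.nil_append, mem_poly_cons, mem_poly_nil, and_true, n1, n3,
        n4, u1, u2, v3]
      exact ⟨⟨fun ⟨a, b, c, d, e⟩ => doubleCross_same_pm R h4 h2 hq h1 c1 a b c d e,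
        fun D => ⟨D.n4, D.n1, D.u2, D.u1, D.n3⟩⟩,
        ⟨fun ⟨a, b, c, d, e⟩ => ⟨doubleCross_single_m R h4 h2 hq h0 h1 a b c d e, b⟩,
        fun ⟨D, b⟩ => ⟨D.n4, b, D.u2, D.u1, D.n3⟩⟩⟩
  | pm =>
    cases hr with
    | mm hc => linarith [(sign_transfer S.c30).2 hc]
    | mp hc => linarith [(sign_transfer S.c30).2 hc]
    | pp _ hc0 =>
      have c0 := (sign_transfer S.c40).1 hc0
      simp only [List.cons_append, List.nil_append, mem_poly_cons, mem_poly_nil, and_true, n1, n3,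
        n4, u2, u3, v3]
      exact ⟨⟨fun ⟨a, b, c, d, e⟩ => doubleCross_same_mp R h4 h2 hq h0 c0 a b c d e,
        fun D => ⟨D.n4, D.n1, D.u3, D.u2, D.n3⟩⟩,
        ⟨fun ⟨a, b, c, d⟩ => ⟨doubleCross_single_p R h4 h2 hq h0 h1 c0 a b c d, b⟩,
        fun ⟨D, b⟩ => ⟨D.n4, b, D.u2, D.n3⟩⟩⟩
    | pm =>
      simp only [List.cons_append, List.nil_append, mem_poly_cons, mem_poly_nil, and_true, n1, n3,
        n4, u1, u2, u3, v3]
      exact ⟨⟨fun ⟨a, b, c, d, e, f⟩ => doubleCross_same_mm R h4 h2 hq a b c d e f,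
        fun D => ⟨D.n4, D.n1, D.u3, D.u2, D.u1, D.n3⟩⟩,
        ⟨fun ⟨a, b, c, d, e⟩ => ⟨doubleCross_single_m R h4 h2 hq h0 h1 a b c d e, b⟩,
        fun ⟨D, b⟩ => ⟨D.n4, b, D.u2, D.u1, D.n3⟩⟩⟩

/-- The second polygon only has to be right inside the first, where the two sides shared with the
double crossing are automatic. In most rows with opposite signs the determinants settle a further
side, or exclude or force the crossing of e2 and e4. -/
theorem Table.mem_iff (hp : NonCoplanar p) {T T₁ : Set Dir} (hT : Table p T T₁) {ξ : Dir}
    (hg : Generic p (ξ : Space)) : (ξ ∈ T ↔ SeenCross p (ξ : Space)) ∧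
      (ξ ∈ T₁ ↔ SeenCross p (ξ : Space) ∧ ¬ SeenThird p (ξ : Space)) := by
  have S := hp.rowSigns
  have R := S.rel (ξ : Space)
  have h4 := S.t4_neg
  have hw (he : eps p 0 2 = -eps p 0 3) (h : wSign p < 0) :=
    pos_of_mul_neg_right ((sign_transfer S.w).2 h) (S.t2_neg he).le
  have hw' (he : eps p 0 2 = -eps p 0 3) (h : 0 < wSign p) :=
    ((mul_pos_iff.1 ((sign_transfer S.w).1 h)).resolve_left
      fun h => h.1.not_gt (S.t2_neg he)).2
  obtain ⟨n1, n2, n3, n4⟩ := nn_pos p ξ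
  obtain ⟨u1, u2, u3⟩ := uu_pos p ξ
  obtain ⟨v1, v2, v3, -, -⟩ := vv_pos p ξ
  have key : ∀ {T : Set Dir}, (ξ ∈ T ↔ SeenCross p (ξ : Space)) →
      (SeenCross p (ξ : Space) → ¬ SeenThird p (ξ : Space)) → (ξ ∈ T ↔ SeenCross p (ξ : Space)) ∧
      (ξ ∈ T ↔ SeenCross p (ξ : Space) ∧ ¬ SeenThird p (ξ : Space)) :=
    fun h h' => ⟨h, h.trans ⟨fun D => ⟨D, h' D⟩, And.left⟩⟩
  have key' : ∀ {T X : Set Dir}, (ξ ∈ T ↔ SeenCross p (ξ : Space)) →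
      (SeenCross p (ξ : Space) → (ξ ∈ X ↔ SeenThird p (ξ : Space))) →
      (ξ ∈ T ↔ SeenCross p (ξ : Space)) ∧
      (ξ ∈ T \ X ↔ SeenCross p (ξ : Space) ∧ ¬ SeenThird p (ξ : Space)) :=
    fun h h' => ⟨h, by rw [mem_sdiff, h]; exact and_congr_right fun D => not_congr (h' D)⟩
  cases hT with
  | same l r K he hw hw0 hl hr hK =>
    obtain ⟨h1, h2⟩ := mem_poly_same hp he hw hw0 hl hr (ξ := ξ)
    refine ⟨h1, ?_⟩
    rw [mem_union, h2, hK.mem_iff hp, SeenK21, SeenThird]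
    -- Absence of the third crossing splits into x24 < 0, which is the polygon with the wall -v3,
    -- and x24 > 0 with the other side negative, which is the k2.1 polygon. General position
    -- discards equality.
    obtain ⟨g1, g2⟩ := hg.third_ne_zero
    constructor
    · rintro (⟨D, h⟩ | ⟨-, D, h, h'⟩)
      · exact ⟨D, fun h' => by linarith [h'.2]⟩
      · exact ⟨D, fun h' => by linarith [h'.1]⟩
    · rintro ⟨D, h⟩
      rcases lt_or_gt_of_ne g1 with h1 | h1
      · exact Or.inl ⟨D, by linarith⟩
      · exact Or.inr ⟨he, D, h1, lt_of_le_of_ne (not_lt.1 fun h' => h ⟨h', h1⟩) g2⟩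
  | sameEmpty he h =>
    have := S.not_seenCross he h (ξ : Space)
    simp [this]
  | negPP he h c1 c0 =>
    have c1 := (sign_transfer S.c40').1 c1
    have c0 := (sign_transfer S.c41').1 c0
    refine key' ?_ fun D => ?_
    · simp only [mem_poly_cons, mem_poly_nil, and_true, n2, u1, u2, u3]
      exact ⟨fun ⟨a, b, c, d⟩ => doubleCross_negPP R h4 (S.t2_neg he) (hw he h) c1 c0 a b c d,
        fun D => ⟨D.n2, D.u1, D.u2, D.u3⟩⟩
    · simp only [mem_poly_cons, mem_poly_nil, and_true, n2, v1, v2, v3]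
      exact ⟨fun ⟨_, b, c, _⟩ => ⟨b, c⟩, fun ⟨b, c⟩ => ⟨D.u3, b, c, D.n2⟩⟩
  | negMM he h c1 c0 =>
    have c1 := (sign_transfer S.c40').2 c1
    have c0 := (sign_transfer S.c41').2 c0
    refine key ?_ fun D => ?_
    · simp only [mem_poly_cons, mem_poly_nil, and_true, n1, n2, n3, u2]
      exact ⟨fun ⟨a, b, c, d⟩ => doubleCross_negMM R h4 (S.t2_neg he) (hw he h) c1 c0 a b c d,
        fun D => ⟨D.n2, D.n1, D.u2, D.n3⟩⟩
    · exact fun ⟨a, _⟩ => DoubleCross.not_cross_of_pos R h4 D (hw he h) c0 a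
  | negMP he h c1 c0 =>
    have c1 := (sign_transfer S.c40').2 c1
    have c0 := (sign_transfer S.c41').1 c0
    refine key' ?_ fun D => ?_
    · simp only [mem_poly_cons, mem_poly_nil, and_true, n1, n2, u2, u3]
      exact ⟨fun ⟨a, b, c, d⟩ => doubleCross_negMP R h4 (S.t2_neg he) (hw he h) c1 c0 a b c d,
        fun D => ⟨D.n2, D.n1, D.u2, D.u3⟩⟩
    · simp only [mem_poly_cons, mem_poly_nil, and_true, n1, n2, v1, v2]
      exact ⟨fun ⟨_, b, _, _⟩ => ⟨b, DoubleCross.v3_pos R h4 D c1 c0⟩,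
        fun ⟨b, _⟩ => ⟨D.u3, b, D.n1, D.n2⟩⟩
  | negPM he h c1 c0 =>
    have c1 := (sign_transfer S.c40').1 c1
    have c0 := (sign_transfer S.c41').2 c0
    refine key ?_ fun D => ?_
    · simp only [mem_poly_cons, mem_poly_nil, and_true, n2, n3, u1, u2]
      exact ⟨fun ⟨a, b, c, d⟩ => doubleCross_negPM R h4 (S.t2_neg he) (hw he h) c1 c0 a b c d,
        fun D => ⟨D.n2, D.u1, D.u2, D.n3⟩⟩
    · exact fun ⟨a, _⟩ => DoubleCross.not_cross_of_pos R h4 D (hw he h) c0 a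
  | posPP he h c1 c0 =>
    have c1 := (sign_transfer S.c40').1 c1
    have c0 := (sign_transfer S.c41').1 c0
    refine key' ?_ fun D => ?_
    · simp only [mem_poly_cons, mem_poly_nil, and_true, n2, n4, u1, u3]
      exact ⟨fun ⟨a, b, c, d⟩ => doubleCross_posPP R h4 (S.t2_neg he) (hw' he h) c1 c0 a b c d,
        fun D => ⟨D.n2, D.u1, D.n4, D.u3⟩⟩
    · simp only [mem_poly_cons, mem_poly_nil, and_true, n2, n4, u3, v3]
      exact ⟨fun ⟨_, _, b, _⟩ => ⟨DoubleCross.v2_pos R h4 D (hw' he h) c0 b, b⟩,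
        fun ⟨_, b⟩ => ⟨D.u3, D.n4, b, D.n2⟩⟩
  | posMMPos he h c1 c0 =>
    have c1 := (sign_transfer S.c40').2 c1
    have c0 := (sign_transfer S.c41').2 c0
    refine key' ?_ fun D => ?_
    · simp only [mem_poly_cons, mem_poly_nil, and_true, n1, n2, n3, n4]
      exact ⟨fun ⟨a, b, c, d⟩ => doubleCross_posMM R h4 (S.t2_neg he) (hw' he h) c1 c0 a b c d,
        fun D => ⟨D.n2, D.n1, D.n4, D.n3⟩⟩
    · simp only [mem_poly_cons, mem_poly_nil, and_true, n1, n4, v2, v3]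
      exact ⟨fun ⟨a, b, _, _⟩ => ⟨b, a⟩, fun ⟨a, b⟩ => ⟨b, a, D.n1, D.n4⟩⟩
  | posMMNeg he h c1 c0 =>
    have c1 := (sign_transfer S.c40').2 c1
    have c0 := (sign_transfer S.c41').2 c0
    refine key' ?_ fun D => ?_
    · simp only [mem_poly_cons, mem_poly_nil, and_true, n1, n2, n3, n4]
      exact ⟨fun ⟨a, b, c, d⟩ => doubleCross_posMM R h4 (S.t2_neg he) (hw' he h) c1 c0 a b c d,
        fun D => ⟨D.n2, D.n1, D.n4, D.n3⟩⟩
    · simp only [mem_poly_cons, mem_poly_nil, and_true, n1, n2, n4, v2, v3]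
      exact ⟨fun ⟨a, b, _⟩ => ⟨b, a⟩, fun ⟨a, b⟩ => ⟨b, a, D.n2, D.n1, D.n4⟩⟩
  | posMP he h c1 c0 =>
    have c1 := (sign_transfer S.c40').2 c1
    have c0 := (sign_transfer S.c41').1 c0
    constructor
    · simp only [mem_poly_cons, mem_poly_nil, and_true, n1, n2, n4, u3]
      exact ⟨fun ⟨a, b, c, d⟩ => doubleCross_posMP R h4 (S.t2_neg he) (hw' he h) c1 c0 a b c d,
        fun D => ⟨D.n2, D.n1, D.n4, D.u3⟩⟩
    · refine iff_of_false (notMem_empty _) fun ⟨D, h'⟩ => h' ?_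
      exact DoubleCross.v_pos R h4 D (hw' he h) c1 c0
  | posPM he h c1 c0 =>
    have c1 := (sign_transfer S.c40').1 c1
    have c0 := (sign_transfer S.c41').2 c0
    refine key ?_ fun D => ?_
    · simp only [mem_poly_cons, mem_poly_nil, and_true, n2, n3, n4, u1]
      exact ⟨fun ⟨a, b, c, d⟩ => doubleCross_posPM R h4 (S.t2_neg he) (hw' he h) c1 c0 a b c d,
        fun D => ⟨D.n2, D.u1, D.n4, D.n3⟩⟩
    · exact fun ⟨_, b⟩ => DoubleCross.not_cross_of_neg R h4 D c1 c0 b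

end OpenChain

namespace OpenChain

variable {p : Fin 5 → Space}

/-! ## The spherical polygons -/

theorem wedge_neg (ξ : Space) (i j : Fin 5) : wedge p (-ξ) i j = -wedge p ξ i j := by
  simp [wedge, triple]

theorem crosses_neg {ξ : Space} {i j : Fin 4} : Crosses p (-ξ) i j ↔ Crosses p ξ i j := by
  rw [Crosses, over_neg, over_neg, or_comm, Crosses]

theorem orderForm_neg (ξ : Space) : orderForm p (-ξ) = orderForm p ξ := by
  rw [orderForm_eq, orderForm_eq, wedge_neg, wedge_neg, neg_mul_neg]

theorem firstK21_neg {ξ : Space} : FirstK21 p (-ξ) ↔ FirstK21 p ξ := by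
  simp only [FirstK21, crosses_neg, orderForm_neg]

theorem Generic.neg {ξ : Space} (hg : Generic p ξ) : Generic p (-ξ) := by
  have h : ∀ i j k, orient p (-ξ) i j k = -orient p ξ i j k := fun i j k => by
    simp [orient, triple]
  obtain ⟨h1, h2, h3, h4, h5, h6, h7⟩ := hg
  constructor <;> rw [h] <;> exact neg_ne_zero.2 (by assumption)

theorem chainDoubleCross_iff_seenCross {ξ : Space} :
    (ChainDoubleCross p ξ 1 ↔ SeenCross p ξ) ∧ (ChainDoubleCross p ξ (-1) ↔ SeenCross p (-ξ)) := by
  simp only [ChainDoubleCross, SeenCross, wedge_neg, one_mul, neg_mul, and_self]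

theorem crosses_and_over_iff_of_neg (hp : NonCoplanar p) (h : tau p 0 3 < 0) {ξ : Space} :
    Crosses p ξ 0 2 ∧ Over p ξ 0 3 ↔ SeenCross p ξ := by
  rw [← chainDoubleCross_iff_seenCross.1, over_iff_of_neg h, crosses₀₂_iff hp,
    chainDoubleCross_one, SameSign]
  constructor
  · rintro ⟨h1 | h1, h2⟩
    · exact ⟨h1, h2⟩
    · exact absurd ⟨h1, h2⟩ not_both_neg
  · exact fun ⟨h1, h2⟩ => ⟨Or.inl h1, h2⟩

theorem crosses_and_over_iff_of_pos (hp : NonCoplanar p) (h : 0 < tau p 0 3) {ξ : Space} :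
    Crosses p ξ 0 2 ∧ Over p ξ 0 3 ↔ SeenCross p (-ξ) := by
  rw [← chainDoubleCross_iff_seenCross.2, over_iff_of_pos h, crosses₀₂_iff hp,
    chainDoubleCross_neg_one, SameSign]
  constructor
  · rintro ⟨h1 | h1, h2⟩
    · exact absurd ⟨h1, h2⟩ not_both_pos
    · exact ⟨h1, h2⟩
  · exact fun ⟨h1, h2⟩ => ⟨Or.inr h1, h2⟩

open Classical in
/-- The direction, on the side from which the fourth edge is seen in a standard position. -/
noncomputable def seen (p : Fin 5 → Space) (ξ : Dir) : Dir := if tau p 0 3 < 0 then ξ else -ξ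

theorem seen_cases (p : Fin 5 → Space) : seen p = id ∨ seen p = Neg.neg := by
  by_cases h : tau p 0 3 < 0
  · exact Or.inl (funext fun ξ => by simp [seen, h])
  · exact Or.inr (funext fun ξ => by simp [seen, h])

theorem seen_rev : seen (rev p) = seen p := by
  funext ξ
  rw [seen, seen, tau_rev_eq.2.1]

/-- Having e1 above e4 fixes the sign pattern of T_{1,4} through the sign of τ, and the pattern of
T_{1,3} must be the opposite one. The table describes one fixed pattern, whence the antipodal map
for one sign of τ. -/
theorem crosses_and_over_iff (hp : NonCoplanar p) {ξ : Dir} :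
    Crosses p (ξ : Space) 0 2 ∧ Over p (ξ : Space) 0 3 ↔ SeenCross p (seen p ξ : Space) := by
  rcases lt_or_gt_of_ne hp.t03 with h | h
  · rw [crosses_and_over_iff_of_neg hp h, seen, if_pos h]
  · rw [crosses_and_over_iff_of_pos hp h, seen, if_neg h.not_gt]
    rfl

theorem crosses_seen {ξ : Dir} {i j : Fin 4} :
    Crosses p (seen p ξ : Space) i j ↔ Crosses p (ξ : Space) i j := by
  rcases seen_cases p with h | h <;> rw [h]
  · rfl
  · exact crosses_neg

theorem Generic.seen {ξ : Dir} (hg : Generic p (ξ : Space)) : Generic p (seen p ξ : Space) := by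
  rcases seen_cases p with h | h <;> rw [h]
  · exact hg
  · exact hg.neg

theorem firstK21_seen {ξ : Dir} :
    FirstK21 p (seen p ξ : Space) ↔ FirstK21 p (ξ : Space) := by
  rcases seen_cases p with h | h <;> rw [h]
  · rfl
  · exact firstK21_neg

theorem SeenCross.crosses (hp : NonCoplanar p) {ξ : Space} (h : SeenCross p ξ) :
    Crosses p ξ 0 2 ∧ Crosses p ξ 0 3 ∧ (Crosses p ξ 1 3 ↔ SeenThird p ξ) := by
  have h' := chainDoubleCross_iff_seenCross.1.2 h
  have h'' := (crosses_and_crosses_iff hp).2 (Or.inl h')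
  refine ⟨h''.1, h''.2, ?_⟩
  rw [h'.crosses_iff hp (Or.inl rfl), SeenThird]
  simp only [one_mul]

theorem mem_Q134_iff_crosses {ξ : Dir} :
    ξ ∈ Q134 p ↔ Crosses p (ξ : Space) 0 2 ∧ Over p (ξ : Space) 0 3 := by
  rw [Q134, Q3, neg_Q2, ← union_inter_distrib_right]
  rfl

theorem mem_Qone_iff_crosses {ξ : Dir} :
    ξ ∈ Qone p ↔ (Crosses p (ξ : Space) 0 2 ∧ Over p (ξ : Space) 0 3) ∧
      ¬ Crosses p (ξ : Space) 1 3 := by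
  rw [Qone, mem_sdiff, mem_Q134_iff_crosses, neg_Q2]
  rfl

theorem Q134_rev : Q134 (rev p) = Q421 p := by
  simp only [Q134, Q421, Q3, Q2_rev]
  rfl

theorem Qone_rev : Qone (rev p) = Qtwo p := by
  rw [Qone, Qtwo, Q134_rev, Q2_rev, neg_Q2, neg_Q2, union_comm]
  rfl

theorem mem_Q134_iff (hp : NonCoplanar p) {ξ : Dir} :
    ξ ∈ Q134 p ↔ SeenCross p (seen p ξ : Space) :=
  mem_Q134_iff_crosses.trans (crosses_and_over_iff hp)

theorem mem_Qone_iff (hp : NonCoplanar p) {ξ : Dir} :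
    ξ ∈ Qone p ↔ SeenCross p (seen p ξ : Space) ∧ ¬ SeenThird p (seen p ξ : Space) := by
  rw [mem_Qone_iff_crosses, crosses_and_over_iff hp, ← crosses_seen]
  exact and_congr_right fun h => not_congr (h.crosses hp).2.2

theorem firstK21_and_over_iff (hp : NonCoplanar p) {ξ : Dir} (hg : Generic p (ξ : Space)) :
    FirstK21 p (ξ : Space) ∧ Over p (ξ : Space) 0 3 ↔ SeenK21 p (seen p ξ : Space) := by
  have hg' := hg.seen.third_ne_zero.2
  have key (h : SeenCross p (seen p ξ : Space)) : FirstK21 p (seen p ξ : Space) ↔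
      eps p 0 2 = eps p 0 3 ∧ 0 < wedge p (seen p ξ : Space) 2 4 ∧
        wedge p (seen p ξ : Space) 1 2 + wedge p (seen p ξ : Space) 2 4
          - wedge p (seen p ξ : Space) 1 4 < 0 := by
    obtain ⟨h1, h2, h3⟩ := h.crosses hp
    rw [FirstK21, eps_eq_eps_iff hp.t02 hp.t03, orderForm_eq, mul_pos_iff_of_pos_left h.n2, h3,
      SeenThird]
    simp only [h1, h2, true_and]
    constructor
    · rintro ⟨a, b, c⟩
      exact ⟨b, c, lt_of_le_of_ne (not_lt.1 fun h => a ⟨h, c⟩) hg'⟩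
    · rintro ⟨a, b, c⟩
      exact ⟨fun h => c.not_gt h.1, a, b⟩
  have hc := crosses_and_over_iff hp (ξ := ξ)
  rw [SeenK21, ← firstK21_seen]
  constructor
  · rintro ⟨h1, h2⟩
    have h := hc.1 ⟨crosses_seen.1 h1.1, h2⟩
    obtain ⟨a, b⟩ := (key h).1 h1
    exact ⟨a, h, b⟩
  · rintro ⟨a, h, b⟩
    exact ⟨(key h).2 ⟨a, b⟩, (hc.2 h).2⟩

theorem isK21_iff (hp : NonCoplanar p) {ξ : Dir} (hg : Generic p (ξ : Space)) :
    IsK21 (gaussWord p ξ) ↔ IsK21Projection p (ξ : Space) := by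
  obtain ⟨h1, h2⟩ := classification hp hg
  by_cases h : IsK21Projection p (ξ : Space)
  · exact iff_of_true (h1 h).isK21 h
  · exact iff_of_false (h2 h).isK0.not_isK21 h

theorem mem_Qk21_iff (hp : NonCoplanar p) {ξ : Dir} (hg : Generic p (ξ : Space)) :
    ξ ∈ Qk21 p ↔ SeenK21 p (seen p ξ : Space) ∨ SeenK21 (rev p) (seen p (-ξ) : Space) := by
  have h2 : FirstK21 (rev p) (ξ : Space) ∧ Over p (ξ : Space) 0 3 ↔
      SeenK21 (rev p) (seen p (-ξ) : Space) := by
    have := firstK21_and_over_iff hp.rev (ξ := -ξ) hg.rev.neg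
    rw [seen_rev] at this
    rw [← this]
    -- Reversal exchanges e1 and e4, so "above" becomes "below" and the direction has to be replaced
    -- by its antipode.
    exact and_congr firstK21_neg.symm (by
      rw [over_rev]
      exact over_neg.symm)
  rw [← firstK21_and_over_iff hp hg, ← h2, ← or_and_right, and_comm]
  change ξ ∈ Q2 p 0 3 ∧ _ ↔ _
  rw [isK21_iff hp hg]
  rfl

/-- Through e1, a k2.1 needs ε_{1,4} = ε_{1,3}, and `ChainRel.same_signs` then makes ε_{2,4} the
opposite sign; through the reversed chain it needs ε_{2,4} = ε_{1,4}. -/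
theorem SeenK21.not_seenK21_rev (hp : NonCoplanar p) {ξ η : Space} (h : SeenK21 p ξ) :
    ¬ SeenK21 (rev p) η := by
  intro h'
  have S := hp.rowSigns
  have h1 := ((S.rel ξ).same_signs h.2.1 S.t4_neg (S.t2_pos h.1)).1
  rw [← (tau_eq p).2.2, h.1] at h1
  have h2 := h'.1
  rw [eps_eq hp.rev.t02, eps_eq hp.rev.t03, tau_rev_eq.1, tau_rev_eq.2.1, ← eps_eq hp.t13,
    ← eps_eq hp.t03] at h2
  rw [← h2] at h1
  exact h1.not_gt (eps_mul_tau_pos hp.t13)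

theorem samePolygon_of_ae {X Y : Set Dir} {P : Dir → Prop} {f : Dir → Dir}
    (hf : f = id ∨ f = Neg.neg) (hX : ∀ᵐ ξ ∂sphereMeasure, ξ ∈ X ↔ P (f ξ))
    (hY : ∀ᵐ ξ ∂sphereMeasure, ξ ∈ Y ↔ P ξ) : SamePolygon X Y := by
  rcases hf with rfl | rfl
  · have h : ∀ᵐ ξ ∂sphereMeasure, ξ ∈ X ↔ ξ ∈ Y := by
      filter_upwards [hX, hY] with ξ h1 h2
      exact h1.trans h2.symm
    exact ⟨Or.inl (Filter.eventuallyEq_set.2 h), area_congr h⟩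
  · have h : ∀ᵐ ξ ∂sphereMeasure, ξ ∈ X ↔ ξ ∈ -Y := by
      filter_upwards [hX, ae_neg hY] with ξ h1 h2
      exact h1.trans h2.symm
    exact ⟨Or.inr (Filter.eventuallyEq_set.2 h), (area_congr h).trans (area_neg Y)⟩

theorem samePolygon_table (hp : NonCoplanar p) {T T₁ : Set Dir} (hT : Table p T T₁) :
    SamePolygon (Q134 p) T ∧ SamePolygon (Qone p) T₁ := by
  constructor
  · refine samePolygon_of_ae (P := fun ξ => SeenCross p (ξ : Space)) (seen_cases p)
      (Filter.Eventually.of_forall fun ξ => mem_Q134_iff hp) ?_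
    filter_upwards [hp.ae_generic] with ξ hg
    exact (hT.mem_iff hp hg).1
  · refine samePolygon_of_ae (P := fun ξ => SeenCross p (ξ : Space) ∧ ¬ SeenThird p (ξ : Space))
      (seen_cases p) (Filter.Eventually.of_forall fun ξ => mem_Qone_iff hp) ?_
    filter_upwards [hp.ae_generic] with ξ hg
    exact (hT.mem_iff hp hg).2

/-- The two parts of Q could require different antipodal corrections, but at most one of them is
non-empty, so a single correction works for the union. -/
theorem samePolygon_k21 (hp : NonCoplanar p) {K K' : Set Dir} (hK : K21Polygon p K)
    (hK' : K21Polygon (rev p) K') : SamePolygon (Qk21 p) (K ∪ K') := by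
  have hmem : ∀ ξ : Dir, ξ ∈ K ∪ K' ↔ SeenK21 p (ξ : Space) ∨ SeenK21 (rev p) (ξ : Space) :=
    fun ξ => or_congr (hK.mem_iff hp) (hK'.mem_iff hp.rev)
  by_cases h : ∃ ξ : Space, SeenK21 p ξ
  · obtain ⟨ξ₀, h⟩ := h
    have h' : ∀ η : Space, ¬ SeenK21 (rev p) η := fun η => h.not_seenK21_rev hp
    refine samePolygon_of_ae (P := fun ξ => SeenK21 p (ξ : Space)) (seen_cases p) ?_
      (Filter.Eventually.of_forall fun ξ => by simp [hmem, h'])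
    filter_upwards [hp.ae_generic] with ξ hg
    simp [mem_Qk21_iff hp hg, h']
  · push Not at h
    refine samePolygon_of_ae (P := fun ξ => SeenK21 (rev p) (ξ : Space))
      (f := fun ξ => seen p (-ξ)) ?_ ?_ (Filter.Eventually.of_forall fun ξ => by simp [hmem, h])
    · rcases seen_cases p with e | e <;> rw [e]
      · exact Or.inr rfl
      · exact Or.inl (funext fun ξ => neg_neg ξ)
    · filter_upwards [hp.ae_generic] with ξ hg
      simp [mem_Qk21_iff hp hg, h]

end OpenChain

namespace OpenChain

variable {p : Fin 5 → Space}

/-! ## The areas of the crossing events -/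

/-- The directions along which two edges cross. -/
def crossSet (p : Fin 5 → Space) (i j : Fin 4) : Set Dir := {ξ | Crosses p (ξ : Space) i j}

/-- The directions along which the projection is a diagram of `k2.1`. -/
def k21Set (p : Fin 5 → Space) : Set Dir := {ξ | IsK21Projection p (ξ : Space)}

theorem measurableSet_crossSet {i j : Fin 4} (hτ : tau p i j ≠ 0) :
    MeasurableSet (crossSet p i j) :=
  (measurableSet_Q2 hτ).union (measurableSet_Q2 (i := j) (j := i) (by rwa [tau_symm]))

theorem measurableSet_orderForm : MeasurableSet {ξ : Dir | 0 < orderForm p (ξ : Space)} := by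
  have h : ∀ i j k, Continuous fun ξ : Dir => orient p (ξ : Space) i j k := fun i j k =>
    continuous_const.inner continuous_subtype_val
  exact (isOpen_lt continuous_const ((h 0 1 3).mul (h 3 2 4))).measurableSet

theorem measurableSet_firstK21 (hp : NonCoplanar p) :
    MeasurableSet {ξ : Dir | FirstK21 p (ξ : Space)} :=
  (measurableSet_crossSet hp.t02).inter ((measurableSet_crossSet hp.t03).inter
    ((measurableSet_crossSet hp.t13).compl.inter ((MeasurableSet.const _).inter
      measurableSet_orderForm)))

theorem measurableSet_k21Set (hp : NonCoplanar p) : MeasurableSet (k21Set p) :=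
  (measurableSet_firstK21 hp).union (measurableSet_firstK21 hp.rev)

/-- Where two edges cross, exactly one is on top, and the antipodal map exchanges the two
possibilities. This is the source of the factors 2|L| and 1/(2π). -/
theorem area_eq_two_mul {i j : Fin 4} (hτ : tau p i j ≠ 0) {S : Set Dir}
    (hS : S ⊆ crossSet p i j) (hneg : -S = S) : area S = 2 * area (S ∩ Q2 p i j) := by
  have h1 : area (S ∩ Q2 p i j) + area (S \ Q2 p i j) = area S :=
    measureReal_inter_add_sdiff (measurableSet_Q2 hτ)
  have h2 : S \ Q2 p i j = -(S ∩ Q2 p i j) := by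
    rw [inter_neg, hneg, neg_Q2]
    ext ξ
    constructor
    · rintro ⟨h, h'⟩
      exact ⟨h, (hS h).resolve_left h'⟩
    · rintro ⟨h, h'⟩
      exact ⟨h, fun h'' => Over.not_over hτ h'' h'⟩
  rw [h2, area_neg] at h1
  linarith

theorem neg_crossSet (i j : Fin 4) : -crossSet p i j = crossSet p i j := by
  ext ξ
  exact crosses_neg

theorem area_crossSet {i j : Fin 4} (hτ : tau p i j ≠ 0) :
    area (crossSet p i j) = 4 * Real.pi * (2 * |L p i j|) := by
  rw [area_eq_two_mul hτ subset_rfl (neg_crossSet i j),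
    inter_eq_right.2 (show Q2 p i j ⊆ crossSet p i j from fun ξ h => Or.inl h), area_Q2 hτ]
  ring

theorem area_first (hp : NonCoplanar p) :
    area (crossSet p 0 2 ∩ crossSet p 0 3) = 4 * Real.pi * (1 / (2 * Real.pi) * area (Q134 p)) := by
  rw [area_eq_two_mul hp.t03 inter_subset_right (by rw [inter_neg, neg_crossSet, neg_crossSet])]
  have : crossSet p 0 2 ∩ crossSet p 0 3 ∩ Q2 p 0 3 = Q134 p := by
    ext ξ
    rw [mem_Q134_iff_crosses]
    exact ⟨fun h => ⟨h.1.1, h.2⟩, fun h => ⟨⟨h.1, Or.inl h.2⟩, h.2⟩⟩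
  rw [this]
  field_simp
  ring

theorem area_first_only (hp : NonCoplanar p) :
    area ((crossSet p 0 2 ∩ crossSet p 0 3) \ crossSet p 1 3) =
      4 * Real.pi * (1 / (2 * Real.pi) * area (Qone p)) := by
  rw [area_eq_two_mul hp.t03 (sdiff_subset.trans inter_subset_right) (by
    ext ξ
    exact and_congr (and_congr crosses_neg crosses_neg) (not_congr crosses_neg))]
  have : ((crossSet p 0 2 ∩ crossSet p 0 3) \ crossSet p 1 3) ∩ Q2 p 0 3 = Qone p := by
    ext ξ
    rw [mem_Qone_iff_crosses]
    exact ⟨fun h => ⟨⟨h.1.1.1, h.2⟩, h.1.2⟩, fun h => ⟨⟨⟨h.1.1, Or.inl h.1.2⟩, h.2⟩, h.1.2⟩⟩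
  rw [this]
  field_simp
  ring

theorem crossSet_rev : crossSet (rev p) 0 2 = crossSet p 1 3 ∧
    crossSet (rev p) 0 3 = crossSet p 0 3 ∧ crossSet (rev p) 1 3 = crossSet p 0 2 :=
  ⟨ext fun _ => crosses_rev_eq.1, ext fun _ => crosses_rev_eq.2.1, ext fun _ => crosses_rev_eq.2.2⟩

theorem area_last (hp : NonCoplanar p) :
    area (crossSet p 1 3 ∩ crossSet p 0 3) = 4 * Real.pi * (1 / (2 * Real.pi) * area (Q421 p)) := by
  have := area_first hp.rev
  rwa [Q134_rev, crossSet_rev.1, crossSet_rev.2.1] at this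

theorem area_last_only (hp : NonCoplanar p) :
    area ((crossSet p 1 3 ∩ crossSet p 0 3) \ crossSet p 0 2) =
      4 * Real.pi * (1 / (2 * Real.pi) * area (Qtwo p)) := by
  have := area_first_only hp.rev
  rwa [Qone_rev, crossSet_rev.1, crossSet_rev.2.1, crossSet_rev.2.2] at this

theorem area_k21Set (hp : NonCoplanar p) :
    area (k21Set p) = 4 * Real.pi * (1 / (2 * Real.pi) * area (Qk21 p)) := by
  have h1 : k21Set p ⊆ crossSet p 0 3 := by
    rintro ξ (h | h)
    · exact h.2.1
    · exact crosses_rev_eq.2.1.1 h.2.1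
  rw [area_eq_two_mul hp.t03 h1 (by
    ext ξ
    exact or_congr firstK21_neg firstK21_neg)]
  have : area (k21Set p ∩ Q2 p 0 3) = area (Qk21 p) := by
    refine area_congr ?_
    filter_upwards [hp.ae_generic] with ξ hg
    exact and_comm.trans (and_congr_right fun _ => (isK21_iff hp hg).symm)
  rw [this]
  field_simp
  ring

/-! ## The distribution of the writhe -/

/-- The sets whose areas determine the distribution of the writhe. -/
def basicSet (p : Fin 5 → Space) : Fin 9 → Set Dir :=
  ![univ, crossSet p 0 2, crossSet p 0 3, crossSet p 1 3, crossSet p 0 2 ∩ crossSet p 0 3,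
    crossSet p 1 3 ∩ crossSet p 0 3, (crossSet p 0 2 ∩ crossSet p 0 3) \ crossSet p 1 3,
    (crossSet p 1 3 ∩ crossSet p 0 3) \ crossSet p 0 2, k21Set p]

/-- Their probabilities. -/
noncomputable def basicProb (p : Fin 5 → Space) : Fin 9 → ℝ :=
  ![1, 2 * |L p 0 2|, 2 * |L p 0 3|, 2 * |L p 1 3|, 1 / (2 * Real.pi) * area (Q134 p),
    1 / (2 * Real.pi) * area (Q421 p), 1 / (2 * Real.pi) * area (Qone p),
    1 / (2 * Real.pi) * area (Qtwo p), 1 / (2 * Real.pi) * area (Qk21 p)]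

/-- Membership in these sets, in terms of the crossings and of being a diagram of `k2.1`. -/
def basicInd (a b c k : Bool) : Fin 9 → ℤ :=
  ![1, a.toInt, b.toInt, c.toInt, (a && b).toInt, (c && b).toInt, (a && b && !c).toInt,
    (c && b && !a).toInt, k.toInt]

theorem measurableSet_basicSet (hp : NonCoplanar p) (i : Fin 9) :
    MeasurableSet (basicSet p i) := by
  have h1 := measurableSet_crossSet hp.t02
  have h2 := measurableSet_crossSet hp.t03
  have h3 := measurableSet_crossSet hp.t13
  fin_cases i
  · exact MeasurableSet.univ
  · exact h1
  · exact h2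
  · exact h3
  · exact h1.inter h2
  · exact h3.inter h2
  · exact (h1.inter h2).diff h3
  · exact (h3.inter h2).diff h1
  · exact measurableSet_k21Set hp

theorem area_basicSet (hp : NonCoplanar p) (i : Fin 9) :
    area (basicSet p i) = 4 * Real.pi * basicProb p i := by
  fin_cases i
  · exact area_univ.trans (mul_one _).symm
  · exact area_crossSet hp.t02
  · exact area_crossSet hp.t03
  · exact area_crossSet hp.t13
  · exact area_first hp
  · exact area_last hp
  · exact area_first_only hp
  · exact area_last_only hp
  · exact area_k21Set hp

open Classical in
theorem indicator_basicSet (i : Fin 9) (ξ : Dir) : (basicSet p i).indicator (1 : Dir → ℝ) ξ =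
    (basicInd (decide (Crosses p (ξ : Space) 0 2)) (decide (Crosses p (ξ : Space) 0 3))
      (decide (Crosses p (ξ : Space) 1 3)) (decide (IsK21Projection p (ξ : Space))) i : ℝ) := by
  have key : ∀ (X : Set Dir) (b : Bool), (ξ ∈ X ↔ b = true) →
      X.indicator (1 : Dir → ℝ) ξ = (b.toInt : ℝ) := by
    intro X b h
    cases b <;> simp_all
  fin_cases i
  · simp [basicSet, basicInd]
  all_goals
    refine key _ _ ?_
    simp [basicSet, crossSet, k21Set]

end OpenChain

/-! ### Indicator identities and their integrals -/

namespace OpenChain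

variable {p : Fin 5 → Space}

/-- The combinatorial constraints between the crossings, the signs `s`, `t`, `u` of the edges, and
the property of being a diagram of `k2.1`. -/
def Admissible (s t u a b c k : Bool) : Prop :=
  (a → c → b) ∧ (a → b → ¬ (s = t ∧ t = u)) ∧ (c → b → ¬ (s = t ∧ t = u)) ∧
    (k → (a ∧ b ∧ ¬ c ∧ s = t) ∨ (c ∧ b ∧ ¬ a ∧ u = t))

instance (s t u a b c k : Bool) : Decidable (Admissible s t u a b c k) := by
  unfold Admissible
  infer_instance

/-- The writhe in terms of the crossings and the signs. -/
def signSum (s t u a b c : Bool) : ℤ :=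
  (if a then boolSign s else 0) + (if b then boolSign t else 0) + if c then boolSign u else 0

/-- The directions along which the projection is a trivial diagram of writhe `j`. -/
def trivialSet (p : Fin 5 → Space) (j : ℤ) : Set Dir :=
  {ξ | ¬ IsK21Projection p (ξ : Space) ∧ projWrithe p (ξ : Space) = j}

open Classical in
theorem projWrithe_eq (ξ : Space) : projWrithe p ξ = signSum (tauSign p 0 2) (tauSign p 0 3)
    (tauSign p 1 3) (decide (Crosses p ξ 0 2)) (decide (Crosses p ξ 0 3))
    (decide (Crosses p ξ 1 3)) := by
  simp only [projWrithe, signIf, signSum, decide_eq_true_eq]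

open Classical in
theorem admissible (hp : NonCoplanar p) (ξ : Space) : Admissible (tauSign p 0 2) (tauSign p 0 3)
    (tauSign p 1 3) (decide (Crosses p ξ 0 2)) (decide (Crosses p ξ 0 3))
    (decide (Crosses p ξ 1 3)) (decide (IsK21Projection p ξ)) := by
  simp only [Admissible, decide_eq_true_eq]
  refine ⟨fun h h' => crosses_middle hp h h', fun h h' => not_tauSign_eq_of_crosses hp h h',
    fun h h' => not_tauSign_eq_of_crosses' hp h h', ?_⟩
  rw [IsK21Projection, firstK21_rev_iff]
  rintro (⟨h1, h2, h3, h4, -⟩ | ⟨h1, h2, h3, h4, -⟩)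
  · exact Or.inl ⟨h1, h2, h3, h4⟩
  · exact Or.inr ⟨h1, h2, h3, h4⟩

theorem measurable_projWrithe (hp : NonCoplanar p) :
    Measurable fun ξ : Dir => projWrithe p (ξ : Space) := by
  have h : ∀ {i j : Fin 4} (s : Bool), tau p i j ≠ 0 →
      Measurable fun ξ : Dir => signIf (Crosses p (ξ : Space) i j) s := fun s hτ =>
    Measurable.ite (measurableSet_crossSet hτ) measurable_const measurable_const
  exact ((h _ hp.t02).add (h _ hp.t03)).add (h _ hp.t13)

theorem measurableSet_trivialSet (hp : NonCoplanar p) (j : ℤ) :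
    MeasurableSet (trivialSet p j) :=
  (measurableSet_k21Set hp).compl.inter (measurable_projWrithe hp (measurableSet_singleton j))

theorem area_eq_sum (hp : NonCoplanar p) {X : Set Dir} (hX : MeasurableSet X) (f : Fin 9 → ℤ)
    (h : ∀ ξ, X.indicator (1 : Dir → ℝ) ξ = ∑ i, (f i : ℝ) * (basicSet p i).indicator 1 ξ) :
    area X = 4 * Real.pi * ∑ i, (f i : ℝ) * basicProb p i := by
  have h1 : area X = ∫ ξ, X.indicator (1 : Dir → ℝ) ξ ∂sphereMeasure :=
    (integral_indicator_one hX).symm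
  have hi : ∀ i : Fin 9, Integrable ((basicSet p i).indicator (1 : Dir → ℝ)) sphereMeasure :=
    fun i => (integrable_const (1 : ℝ)).indicator (measurableSet_basicSet hp i)
  rw [h1, integral_congr_ae (Filter.Eventually.of_forall h),
    integral_finsetSum _ fun i _ => (hi i).const_mul _, Finset.mul_sum]
  refine Finset.sum_congr rfl fun i _ => ?_
  rw [integral_const_mul, integral_indicator_one (measurableSet_basicSet hp i)]
  change _ * area (basicSet p i) = _
  rw [area_basicSet hp]
  ring

/-- Reduces a probability to an identity between integer functions of four Booleans, needed only on
the combinations allowed by the geometry. -/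
theorem area_trivialSet (hp : NonCoplanar p) (j : ℤ) (f : Fin 9 → ℤ)
    (h : ∀ a b c k, Admissible (tauSign p 0 2) (tauSign p 0 3) (tauSign p 1 3) a b c k →
      (if k = false ∧ signSum (tauSign p 0 2) (tauSign p 0 3) (tauSign p 1 3) a b c = j then 1
        else 0) = ∑ i, f i * basicInd a b c k i) :
    area (trivialSet p j) = 4 * Real.pi * ∑ i, (f i : ℝ) * basicProb p i := by
  classical
  refine area_eq_sum hp (measurableSet_trivialSet hp j) f fun ξ => ?_
  simp only [indicator_basicSet]
  have := h _ _ _ _ (admissible hp (ξ : Space))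
  rw [← projWrithe_eq] at this
  have e := congrArg (Int.cast : ℤ → ℝ) this
  push_cast at e
  rw [← e]
  by_cases hξ : ξ ∈ trivialSet p j
  · rw [indicator_of_mem hξ, if_pos ⟨decide_eq_false hξ.1, hξ.2⟩]
    rfl
  · rw [indicator_of_notMem hξ, if_neg fun h' => hξ ⟨of_decide_eq_false h'.1, h'.2⟩]

theorem area_k21Set_eq_zero (h1 : tauSign p 0 2 ≠ tauSign p 0 3)
    (h2 : tauSign p 0 3 ≠ tauSign p 1 3) : area (k21Set p) = 0 := by
  have : k21Set p = ∅ := by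
    rw [eq_empty_iff_forall_notMem]
    rintro ξ (h | h)
    · exact h1 h.2.2.2.1
    · exact h2 (firstK21_rev_iff.1 h).2.2.2.1.symm
  rw [this]
  exact measureReal_empty

theorem probK0_eq (hp : NonCoplanar p) (j : ℤ) :
    probK0 p j = area (trivialSet p j) / (4 * Real.pi) := by
  rw [probK0, prob]
  congr 1
  refine area_congr ?_
  filter_upwards [hp.ae_generic] with ξ hg
  obtain ⟨h1, h2⟩ := classification hp hg
  by_cases h : IsK21Projection p (ξ : Space)
  · exact iff_of_false (fun h' => h'.1.not_isK21 (h1 h).isK21) fun h' => h'.1 h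
  · exact ⟨fun h' => ⟨h, (h2 h).writhe_eq.symm.trans h'.2⟩,
      fun h' => ⟨(h2 h).isK0, (h2 h).writhe_eq.trans h'.2⟩⟩

theorem probK0_eq_sum (hp : NonCoplanar p) (j : ℤ) (f : Fin 9 → ℤ)
    (h : ∀ a b c k, Admissible (tauSign p 0 2) (tauSign p 0 3) (tauSign p 1 3) a b c k →
      (if k = false ∧ signSum (tauSign p 0 2) (tauSign p 0 3) (tauSign p 1 3) a b c = j then 1
        else 0) = ∑ i, f i * basicInd a b c k i) :
    probK0 p j = ∑ i, (f i : ℝ) * basicProb p i := by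
  rw [probK0_eq hp, area_trivialSet hp j f h, mul_div_cancel_left₀ _ (by positivity)]

end OpenChain

/-! ### The coefficients of the formula -/

namespace OpenChain

variable {p : Fin 5 → Space}

/-- The probability of the writhe `ε_{2,4}` in terms of the basic ones. -/
def coeffPlus (s t u : Bool) : Fin 9 → ℤ :=
  if s = t then if t = u then ![0, 1, 1, 1, 0, 0, 0, 0, 0] else ![0, 0, 0, 1, 0, -1, 0, 0, 0]
  else if t = u then ![0, 0, 1, 1, 0, -1, -1, -1, 0] else ![0, 1, 0, 1, 0, -1, -1, 0, 0]

/-- The probability of the writhe `-ε_{2,4}` in terms of the basic ones. -/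
def coeffMinus (s t u : Bool) : Fin 9 → ℤ :=
  if s = t then if t = u then 0 else ![0, 1, 1, 0, -1, 0, -1, -1, 0]
  else if t = u then ![0, 1, 0, 0, -1, 0, 0, 0, 0] else ![0, 0, 1, 0, -1, 0, 0, -1, 0]

/-- The probability of the writhe `2 ε_{2,4}` in terms of the basic ones. -/
def coeffPlusTwo (s t u : Bool) : Fin 9 → ℤ :=
  if s ≠ t ∧ t = u then ![0, 0, 0, 0, 0, 0, 0, 1, -1] else 0

/-- The probability of the writhe `-2 ε_{2,4}` in terms of the basic ones. -/
def coeffMinusTwo (s t u : Bool) : Fin 9 → ℤ :=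
  if s = t ∧ t ≠ u then ![0, 0, 0, 0, 0, 0, 1, 0, -1] else 0

/-- The probability of the trivial knotoid with the writhe `0` in terms of the basic ones. -/
def coeffZero (s t u : Bool) : Fin 9 → ℤ :=
  if s = t then
    if t = u then ![1, -1, -1, -1, 0, 0, 0, 0, -1] else ![1, -1, -1, -1, 1, 1, 0, 1, 0]
  else if t = u then ![1, -1, -1, -1, 1, 1, 1, 0, 0] else ![1, -1, -1, -1, 1, 1, 1, 1, 0]

/-- The coefficients encode inclusion and exclusion; the check runs over all signs and crossings
satisfying `Admissible`. The same applies to the four identities below. -/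
theorem indicator_eq_sum_plus : ∀ s t u a b c k, Admissible s t u a b c k →
    (if k = false ∧ signSum s t u a b c = boolSign u then 1 else 0) =
      ∑ i, coeffPlus s t u i * basicInd a b c k i := by decide +kernel

theorem indicator_eq_sum_minus : ∀ s t u a b c k, Admissible s t u a b c k →
    (if k = false ∧ signSum s t u a b c = -boolSign u then 1 else 0) =
      ∑ i, coeffMinus s t u i * basicInd a b c k i := by decide +kernel

theorem indicator_eq_sum_plusTwo : ∀ s t u a b c k, Admissible s t u a b c k →
    (if k = false ∧ signSum s t u a b c = 2 * boolSign u then 1 else 0) =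
      ∑ i, coeffPlusTwo s t u i * basicInd a b c k i := by decide +kernel

theorem indicator_eq_sum_minusTwo : ∀ s t u a b c k, Admissible s t u a b c k →
    (if k = false ∧ signSum s t u a b c = -2 * boolSign u then 1 else 0) =
      ∑ i, coeffMinusTwo s t u i * basicInd a b c k i := by decide +kernel

theorem indicator_eq_sum_zero : ∀ s t u a b c k, Admissible s t u a b c k →
    (if k = false ∧ signSum s t u a b c = 0 then 1 else 0) =
      ∑ i, coeffZero s t u i * basicInd a b c k i := by decide +kernel

section

variable (hp : NonCoplanar p)
include hp

theorem eps_values : eps p 0 2 = boolSign (tauSign p 0 2) ∧ eps p 0 3 = boolSign (tauSign p 0 3) ∧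
    eps p 1 3 = boolSign (tauSign p 1 3) :=
  ⟨eps_eq_boolSign hp.t02, eps_eq_boolSign hp.t03, eps_eq_boolSign hp.t13⟩

theorem pPlus_eq : pPlus p =
    ∑ i, (coeffPlus (tauSign p 0 2) (tauSign p 0 3) (tauSign p 1 3) i : ℝ) * basicProb p i := by
  obtain ⟨e1, e2, e3⟩ := eps_values hp
  rw [pPlus, e1, e2, e3]
  generalize tauSign p 0 2 = s, tauSign p 0 3 = t, tauSign p 1 3 = u
  cases s <;> cases t <;> cases u <;>
    simp [coeffPlus, boolSign, basicProb, Fin.sum_univ_succ] <;> ring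

theorem pMinus_eq : pMinus p =
    ∑ i, (coeffMinus (tauSign p 0 2) (tauSign p 0 3) (tauSign p 1 3) i : ℝ) * basicProb p i := by
  obtain ⟨e1, e2, e3⟩ := eps_values hp
  rw [pMinus, e1, e2, e3]
  generalize tauSign p 0 2 = s, tauSign p 0 3 = t, tauSign p 1 3 = u
  cases s <;> cases t <;> cases u <;>
    simp [coeffMinus, boolSign, basicProb, Fin.sum_univ_succ] <;> ring

theorem pPlusTwo_eq : pPlusTwo p =
    ∑ i, (coeffPlusTwo (tauSign p 0 2) (tauSign p 0 3) (tauSign p 1 3) i : ℝ) *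
      basicProb p i := by
  obtain ⟨e1, e2, e3⟩ := eps_values hp
  rw [pPlusTwo, e1, e2, e3]
  generalize tauSign p 0 2 = s, tauSign p 0 3 = t, tauSign p 1 3 = u
  cases s <;> cases t <;> cases u <;>
    simp [coeffPlusTwo, boolSign, basicProb, Fin.sum_univ_succ] <;> ring

theorem pMinusTwo_eq : pMinusTwo p =
    ∑ i, (coeffMinusTwo (tauSign p 0 2) (tauSign p 0 3) (tauSign p 1 3) i : ℝ) *
      basicProb p i := by
  obtain ⟨e1, e2, e3⟩ := eps_values hp
  rw [pMinusTwo, e1, e2, e3]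
  generalize tauSign p 0 2 = s, tauSign p 0 3 = t, tauSign p 1 3 = u
  cases s <;> cases t <;> cases u <;>
    simp [coeffMinusTwo, boolSign, basicProb, Fin.sum_univ_succ] <;> ring

theorem pZero_eq : pZero p =
    ∑ i, (coeffZero (tauSign p 0 2) (tauSign p 0 3) (tauSign p 1 3) i : ℝ) * basicProb p i := by
  obtain ⟨e1, e2, e3⟩ := eps_values hp
  rw [pZero, pPlus_eq hp, pMinus_eq hp, pPlusTwo_eq hp, pMinusTwo_eq hp, pK21, e1, e2, e3]
  generalize tauSign p 0 2 = s, tauSign p 0 3 = t, tauSign p 1 3 = u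
  cases s <;> cases t <;> cases u <;>
    simp [coeffPlus, coeffMinus, coeffPlusTwo, coeffMinusTwo, coeffZero, boolSign, basicProb,
      Fin.sum_univ_succ] <;> ring

theorem probK0_plus : probK0 p (eps p 1 3) = pPlus p := by
  rw [pPlus_eq hp, (eps_values hp).2.2]
  exact probK0_eq_sum hp _ _ (indicator_eq_sum_plus _ _ _)

theorem probK0_minus : probK0 p (-eps p 1 3) = pMinus p := by
  rw [pMinus_eq hp, (eps_values hp).2.2]
  exact probK0_eq_sum hp _ _ (indicator_eq_sum_minus _ _ _)

theorem probK0_plusTwo : probK0 p (2 * eps p 1 3) = pPlusTwo p := by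
  rw [pPlusTwo_eq hp, (eps_values hp).2.2]
  exact probK0_eq_sum hp _ _ (indicator_eq_sum_plusTwo _ _ _)

theorem probK0_minusTwo : probK0 p (-2 * eps p 1 3) = pMinusTwo p := by
  rw [pMinusTwo_eq hp, (eps_values hp).2.2]
  exact probK0_eq_sum hp _ _ (indicator_eq_sum_minusTwo _ _ _)

theorem probK0_zero : probK0 p 0 = pZero p := by
  rw [pZero_eq hp]
  exact probK0_eq_sum hp _ _ (indicator_eq_sum_zero _ _ _)

theorem pK21_eq : area (k21Set p) / (4 * Real.pi) = pK21 p := by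
  simp only [pK21, eps_eq_eps_iff hp.t02 hp.t03, eps_eq_eps_iff hp.t03 hp.t13]
  split_ifs with h
  · rw [area_k21Set hp, mul_div_cancel_left₀ _ (by positivity)]
  · push Not at h
    rw [area_k21Set_eq_zero h.1 h.2, zero_div]

theorem prob_isK21 : prob {ξ | IsK21 (gaussWord p ξ)} = pK21 p := by
  rw [← pK21_eq hp, prob]
  congr 1
  refine area_congr ?_
  filter_upwards [hp.ae_generic] with ξ hg
  exact isK21_iff hp hg

theorem prob_isK21_writhe :
    prob {ξ | IsK21 (gaussWord p ξ) ∧ writhe (gaussWord p ξ) = 2 * eps p 0 3} = pK21 p := by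
  rw [← prob_isK21 hp, prob, prob]
  congr 1
  refine area_congr ?_
  filter_upwards [hp.ae_generic] with ξ hg
  refine and_iff_left_of_imp fun h => ?_
  rw [eps_eq_boolSign hp.t03]
  exact ((classification hp hg).1 ((isK21_iff hp hg).1 h)).writhe_eq

end

/-! ## The bracket polynomial -/

theorem signSum_mem : ∀ s t u a b c k, Admissible s t u a b c k →
    signSum s t u a b c ∈ Finset.Icc (-2 : ℤ) 2 := by decide +kernel

/-- Exactly one term survives: the one for k2.1, or the one whose j is the writhe. Writhe ±3 would
need three crossings of equal sign, which is excluded. -/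
theorem coeff_bracket (hp : NonCoplanar p) (n : ℤ) {ξ : Dir} (hg : Generic p (ξ : Space)) :
    (bracket (gaussWord p ξ)).coeff n =
      (k21Set p).indicator 1 ξ * (k21Bracket (eps p 0 3)).coeff n +
        ∑ j ∈ Finset.Icc (-2 : ℤ) 2, (trivialSet p j).indicator 1 ξ * (curl j).coeff n := by
  classical
  obtain ⟨h1, h2⟩ := classification hp hg
  by_cases h : IsK21Projection p (ξ : Space)
  · rw [(h1 h).bracket_eq, indicator_of_mem (show ξ ∈ k21Set p from h), eps_eq_boolSign hp.t03,
      Finset.sum_eq_zero, add_zero, Pi.one_apply, one_mul]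
    intro j _
    rw [indicator_of_notMem (fun h' => h'.1 h), zero_mul]
  · have hm := signSum_mem _ _ _ _ _ _ _ (admissible hp (ξ : Space))
    rw [← projWrithe_eq] at hm
    rw [(h2 h).bracket_eq, indicator_of_notMem (show ξ ∉ k21Set p from h), zero_mul, zero_add,
      Finset.sum_eq_single_of_mem _ hm, indicator_of_mem (show ξ ∈ trivialSet p _ from ⟨h, rfl⟩),
      Pi.one_apply, one_mul]
    intro j _ hj
    rw [indicator_of_notMem (fun h' => hj h'.2.symm), zero_mul]

theorem integral_coeff_bracket (hp : NonCoplanar p) (n : ℤ) :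
    Integrable (fun ξ : Dir => (bracket (gaussWord p ξ)).coeff n) sphereMeasure ∧
    1 / (4 * Real.pi) * ∫ ξ, (bracket (gaussWord p ξ)).coeff n ∂sphereMeasure =
      pK21 p * (k21Bracket (eps p 0 3)).coeff n +
        ∑ j ∈ Finset.Icc (-2 : ℤ) 2, probK0 p j * (curl j).coeff n := by
  have hi : ∀ {X : Set Dir}, MeasurableSet X → ∀ r : ℝ,
      Integrable (fun ξ => X.indicator (1 : Dir → ℝ) ξ * r) sphereMeasure :=
    fun hX r => ((integrable_const (1 : ℝ)).indicator hX).mul_const r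
  have hk := hi (measurableSet_k21Set hp) ((k21Bracket (eps p 0 3)).coeff n)
  have ht := integrable_finsetSum (Finset.Icc (-2 : ℤ) 2) fun j _ =>
    hi (measurableSet_trivialSet hp j) ((curl j).coeff n)
  have he : (fun ξ : Dir => (bracket (gaussWord p ξ)).coeff n) =ᵐ[sphereMeasure] fun ξ =>
      (k21Set p).indicator 1 ξ * (k21Bracket (eps p 0 3)).coeff n +
        ∑ j ∈ Finset.Icc (-2 : ℤ) 2, (trivialSet p j).indicator 1 ξ * (curl j).coeff n := by
    filter_upwards [hp.ae_generic] with ξ hg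
    exact coeff_bracket hp n hg
  refine ⟨(hk.add ht).congr he.symm, ?_⟩
  rw [integral_congr_ae he, integral_add hk ht, integral_finsetSum _ fun j _ =>
    hi (measurableSet_trivialSet hp j) ((curl j).coeff n), integral_mul_const,
    integral_indicator_one (measurableSet_k21Set hp), mul_add, Finset.mul_sum, ← pK21_eq hp]
  congr 1
  · rw [area]
    ring
  · refine Finset.sum_congr rfl fun j _ => ?_
    rw [integral_mul_const, integral_indicator_one (measurableSet_trivialSet hp j), probK0_eq hp,
      area]
    ring

theorem hasBracket (hp : NonCoplanar p) : HasBracket p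
    (LaurentPolynomial.C (pK21 p) * k21Bracket (eps p 0 3)
      + LaurentPolynomial.C (pPlus p) * curl (eps p 1 3)
      + LaurentPolynomial.C (pMinus p) * curl (-eps p 1 3)
      + LaurentPolynomial.C (pMinusTwo p) * curl (-2 * eps p 1 3)
      + LaurentPolynomial.C (pPlusTwo p) * curl (2 * eps p 1 3)
      + LaurentPolynomial.C (pZero p)) := by
  intro n
  obtain ⟨h1, h2⟩ := integral_coeff_bracket hp n
  refine ⟨h1, ?_⟩
  have h0 : LaurentPolynomial.C (pZero p) = pZero p • curl 0 := by
    rw [curl_values.1, LaurentPolynomial.smul_eq_C_mul, mul_one]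
  have hI : Finset.Icc (-2 : ℤ) 2 = {-2, -1, 0, 1, 2} := by decide
  rw [h2, h0, ← probK0_plus hp, ← probK0_minus hp, ← probK0_minusTwo hp, ← probK0_plusTwo hp,
    ← probK0_zero hp, hI]
  simp only [← LaurentPolynomial.smul_eq_C_mul, AddMonoidAlgebra.coeff_add, Finsupp.add_apply,
    AddMonoidAlgebra.coeff_smul_apply, smul_eq_mul]
  -- The sum runs over j = -2, ..., 2, while the formula indexes by multiples of ε_{2,4}; the two
  -- values of this sign merely permute the terms.
  rcases eps_eq_one_or hp.t13 with h | h <;> rw [h] <;> simp <;> ring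

theorem bracket_k21Word (hp : NonCoplanar p) (o : Bool) :
    bracket (k21Word (decide (0 < eps p 0 3)) o) = k21Bracket (eps p 0 3) := by
  have : boolSign (decide (0 < eps p 0 3)) = eps p 0 3 := by
    rcases eps_eq_one_or hp.t03 with h | h <;> rw [h] <;> rfl
  rw [k21Word, bracket_interlaced 1 2 (by simp), this]

end OpenChain

theorem mainTheorem5 (p : Fin 5 → Space)
    (h13 : AffineIndependent ℝ ![p 0, p 1, p 2, p 3])
    (h14 : AffineIndependent ℝ ![p 0, p 1, p 3, p 4])
    (h24 : AffineIndependent ℝ ![p 1, p 2, p 3, p 4]) :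
    -- the bracket polynomial of the chain
    HasBracket p
      (LaurentPolynomial.C (pK21 p) * k21Bracket (eps p 0 3)
        + LaurentPolynomial.C (pPlus p) * curl (eps p 1 3)
        + LaurentPolynomial.C (pMinus p) * curl (-eps p 1 3)
        + LaurentPolynomial.C (pMinusTwo p) * curl (-2 * eps p 1 3)
        + LaurentPolynomial.C (pPlusTwo p) * curl (2 * eps p 1 3)
        + LaurentPolynomial.C (pZero p)) ∧
    (∀ o : Bool, bracket (k21Word (decide (0 < eps p 0 3)) o) = k21Bracket (eps p 0 3)) ∧
    (eps p 0 2).natAbs = 1 ∧ (eps p 0 3).natAbs = 1 ∧ (eps p 1 3).natAbs = 1 ∧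
    -- the coefficients are the probabilities of the diagrams
    prob {ξ | IsK21 (gaussWord p ξ)} = pK21 p ∧
    prob {ξ | IsK21 (gaussWord p ξ) ∧ writhe (gaussWord p ξ) = 2 * eps p 0 3} = pK21 p ∧
    probK0 p (eps p 1 3) = pPlus p ∧
    probK0 p (-eps p 1 3) = pMinus p ∧
    probK0 p (2 * eps p 1 3) = pPlusTwo p ∧
    probK0 p (-2 * eps p 1 3) = pMinusTwo p ∧
    probK0 p 0 = pZero p ∧
    -- the spherical polygons
    (∀ K K' : Set Dir, K21Polygon p K → K21Polygon (rev p) K' → SamePolygon (Qk21 p) (K ∪ K')) ∧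
    (∀ T T₁ : Set Dir, Table p T T₁ → SamePolygon (Q134 p) T ∧ SamePolygon (Qone p) T₁) ∧
    (∀ T T₁ : Set Dir, Table (rev p) T T₁ → SamePolygon (Q421 p) T ∧ SamePolygon (Qtwo p) T₁) := by
  have hp := nonCoplanar_of_affineIndependent h13 h14 h24
  have hn : ∀ {i j : Fin 4}, tau p i j ≠ 0 → (eps p i j).natAbs = 1 := fun h => by
    rcases eps_eq_one_or h with h | h <;> rw [h] <;> rfl
  refine ⟨hasBracket hp, bracket_k21Word hp, hn hp.t02, hn hp.t03, hn hp.t13, prob_isK21 hp,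
    prob_isK21_writhe hp, probK0_plus hp, probK0_minus hp, probK0_plusTwo hp, probK0_minusTwo hp,
    probK0_zero hp, fun K K' => samePolygon_k21 hp, fun T T₁ => samePolygon_table hp,
    fun T T₁ hT => ?_⟩
  have := samePolygon_table hp.rev hT
  rwa [Q134_rev, Qone_rev] at this
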